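/- Let $M$ be a compact $C^\infty$ Riemannian manifold, with or without boundary, let $X$ be a $C^1$ vector field on $M$ and let $X_t$ be the $C^1$ flow generated by $X$ (if $\partial M\neq\emptyset$, the maps $X_t$, $t\ge 0$, are defined on $M$, and $X_{-t}$ is the inverse of $X_t$, defined on $X_t(M)$). Let $\Lambda\subset M$ be a compact set with $X_t(\Lambda)=\Lambda$ for all $t\in\mathbb R$, and let $T_\Lambda M=E\oplus F$ be a continuous $DX_t$-invariant splitting with $E_x\ne\{0\}$ and $\dim F_x=k\ge 2$ for all $x\in\Lambda$. Let $\widetilde F_x=\wedge^k F_x\subset\wedge^k T_xM$, and let $\widetilde E_x\subset\wedge^k T_xM$ be the subspace spanned by the exterior products of $i$ vectors of $E_x$ and $j$ vectors of $F_x$ with $i+j=k$, $i\ge1$, $j\ge 0$. The spaces $\wedge^kT_xM$ carry the norm induced by the Riemannian metric. A splitting $V\oplus W$ of the restriction to $\Lambda$ of a vector bundle, with a linear cocycle $A_t$ over $X_t$, is dominated if it is continuous and $A_t$-invariant, $V_x\neq\{0\}$ and $W_x\ne\{0\}$ for all $x\in\Lambda$, and there are constants $K,\lambda>0$ with $$\|A_t|_{V_x}\|\cdot\|A_{-t}|_{W_{X_t(x)}}\|<Ke^{-\lambda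 t}\quad\text{for all }x\in\Lambda,\ t>0 .$$ A set $Y\subset\Lambda$ has total probability in $\Lambda$ if $\mu(Y)=1$ for every probability measure $\mu$ on $\Lambda$ that is invariant under $X_t|_\Lambda$ for all $t\in\mathbb R$. The co-norm of a linear map $L$ is $m(L)=\inf_{\|v\|=1}\|Lv\|$. Then $\widetilde E\oplus\widetilde F$ is a dominated splitting over $\Lambda$ for $\wedge^kDX_t$ if and only if there exists $\eta<0$ such that $$\liminf_{t\to+\infty}\frac1t\log\|DX_t|_{E_x}\|-\limsup_{t\to+\infty}\frac1t\log m(DX_t|_{F_x})<\eta$$ for all $x$ in a set of total probability in $\Lambda$. -/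

import Mathlib

open Set Filter Topology MeasureTheory Bundle
open scoped Manifold ContDiff

noncomputable section

/-! ### Flows generated by vector fields -/

section Flow

variable {n : ℕ} {H : Type*} [TopologicalSpace H]
  (I : ModelWithCorners ℝ (EuclideanSpace ℝ (Fin n)) H)
  {M : Type*} [TopologicalSpace M] [ChartedSpace H M]

/-- The domain of the time-`t` map of a flow on a manifold that may have a boundary across which
orbits enter: all of `M` for `t ≥ 0`, and the image of the time-`(-t)` map for `t < 0`.
(On a closed manifold it is all of `M` for every `t`.) -/
def flowDomain (φ : ℝ → M → M) (t : ℝ) : Set M :=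
  {x | 0 ≤ t ∨ x ∈ range (φ (-t))}

/-- `φ t = X_t` is the `C^1` flow generated by the vector field `X`. The maps `X_t`, `t ≥ 0`, are
defined on all of `M`; the map `X_{-t}` is the inverse of `X_t`, defined on `X_t(M)`
(the values of `φ (-t)` off `X_t(M)` are irrelevant). -/
structure IsC1FlowOf (X : ∀ x : M, TangentSpace I x) (φ : ℝ → M → M) : Prop where
  map_zero : ∀ x, φ 0 x = x
  map_add : ∀ s t : ℝ, 0 ≤ s → 0 ≤ t → ∀ x, φ (s + t) x = φ s (φ t x)
  neg_apply : ∀ t : ℝ, 0 ≤ t → ∀ x, φ (-t) (φ t x) = x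
  integralCurve : ∀ x, IsMIntegralCurveOn (fun t ↦ φ t x) X (Ici 0)
  contMDiffOn : ContMDiffOn (𝓘(ℝ, ℝ).prod I) I 1 (fun p : ℝ × M ↦ φ p.1 p.2) (Ici 0 ×ˢ univ)
  contMDiffOn_neg : ∀ t : ℝ, t < 0 → ContMDiffOn I I 1 (φ t) (flowDomain φ t)

/-- The derivative `DX_t(x) : T_x M → T_{X_t(x)} M` of the flow. -/
def flowDeriv (φ : ℝ → M → M) (t : ℝ) (x : M) :
    TangentSpace I x →L[ℝ] TangentSpace I (φ t x) :=
  mfderivWithin I I (φ t) (flowDomain φ t) x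

end Flow

/-- `Λ` is invariant under the flow: `X_t(Λ) = Λ` for all real `t`. -/
def IsFlowInvariant {M : Type*} (φ : ℝ → M → M) (Λ : Set M) : Prop :=
  ∀ t : ℝ, φ t '' Λ = Λ

/-! ### Invariant measures -/

section Measures

variable {M : Type*} [MeasurableSpace M]

/-- `μ` is a probability measure carried by `Λ` that is invariant under the flow restricted to
`Λ`; note that `Λ ∩ φ t ⁻¹' A` is the preimage of `A` under `X_t : Λ → Λ`. -/
structure IsInvariantProbabilityOn (φ : ℝ → M → M) (Λ : Set M) (μ : Measure M) : Prop where
  isProbabilityMeasure : IsProbabilityMeasure μ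
  compl_eq_zero : μ Λᶜ = 0
  invariant : ∀ t : ℝ, ∀ A : Set M, MeasurableSet A → μ (Λ ∩ φ t ⁻¹' A) = μ A

/-- `Y` has total probability in `Λ`: it has full measure for every invariant probability
measure of the flow on `Λ`. -/
def HasTotalProbability (φ : ℝ → M → M) (Λ Y : Set M) : Prop :=
  ∀ μ : Measure M, IsInvariantProbabilityOn φ Λ μ → ∀ᵐ x ∂μ, x ∈ Y

end Measures

/-! ### Norms of restrictions -/

section Norms

variable {V W : Type*} [NormedAddCommGroup V] [NormedSpace ℝ V]
  [NormedAddCommGroup W] [NormedSpace ℝ W]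

/-- The operator norm `‖L|_S‖` of the restriction of `L` to the subspace `S`. -/
def restrictNorm (L : V →L[ℝ] W) (S : Submodule ℝ V) : ℝ :=
  ‖L.comp S.subtypeL‖

/-- The co-norm `m(L|_S) = inf {‖L v‖ : v ∈ S, ‖v‖ = 1}` of the restriction of `L` to `S`. -/
def restrictConorm (L : V →L[ℝ] W) (S : Submodule ℝ V) : ℝ :=
  sInf ((fun v ↦ ‖L v‖) '' {v | v ∈ S ∧ ‖v‖ = 1})

end Norms

/-! ### Splittings of a vector bundle with a linear cocycle over the flow

The bundle is given by its normed fibers `W x`, together with the local coordinates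
`τ x₀ x : W x → W₀`, valid for `x` close to `x₀`, that define its topology; the linear cocycle is
given by its maps `A t x : W x → W (φ t x)`. -/

section Splittings

variable {M : Type*} [TopologicalSpace M] {W : M → Type*} [∀ x, NormedAddCommGroup (W x)]
  [∀ x, NormedSpace ℝ (W x)] {W₀ : Type*} [NormedAddCommGroup W₀] [NormedSpace ℝ W₀]

/-- The field of subspaces `V` is a continuous subbundle over `Λ`: near each point of `Λ` it has
a frame of sections that are continuous on `Λ`. -/
def IsContinuousSubbundle (τ : ∀ _ x : M, W x →ₗ[ℝ] W₀) (Λ : Set M)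
    (V : ∀ x, Submodule ℝ (W x)) : Prop :=
  ∀ x₀ ∈ Λ, ∃ U : Set M, IsOpen U ∧ x₀ ∈ U ∧ ∃ (d : ℕ) (s : Fin d → ∀ x, W x),
    (∀ i, ContinuousOn (fun x ↦ τ x₀ x (s i x)) (U ∩ Λ)) ∧
    ∀ x ∈ U ∩ Λ, LinearIndependent ℝ (fun i ↦ s i x) ∧
      Submodule.span ℝ (range fun i ↦ s i x) = V x

/-- A continuous splitting `V₁ ⊕ V₂` over `Λ`, invariant under the cocycle `A`. -/
structure IsContinuousInvariantSplitting (τ : ∀ _ x : M, W x →ₗ[ℝ] W₀) (φ : ℝ → M → M)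
    (A : ∀ t x, W x →L[ℝ] W (φ t x)) (Λ : Set M) (V₁ V₂ : ∀ x, Submodule ℝ (W x)) : Prop where
  isCompl : ∀ x ∈ Λ, IsCompl (V₁ x) (V₂ x)
  continuous_fst : IsContinuousSubbundle τ Λ V₁
  continuous_snd : IsContinuousSubbundle τ Λ V₂
  map_fst : ∀ t : ℝ, ∀ x ∈ Λ, (V₁ x).map (A t x).toLinearMap = V₁ (φ t x)
  map_snd : ∀ t : ℝ, ∀ x ∈ Λ, (V₂ x).map (A t x).toLinearMap = V₂ (φ t x)

/-- A dominated splitting `V₁ ⊕ V₂` over `Λ` for the cocycle `A`. -/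
structure IsDominatedSplitting (τ : ∀ _ x : M, W x →ₗ[ℝ] W₀) (φ : ℝ → M → M)
    (A : ∀ t x, W x →L[ℝ] W (φ t x)) (Λ : Set M) (V₁ V₂ : ∀ x, Submodule ℝ (W x)) : Prop
    extends IsContinuousInvariantSplitting τ φ A Λ V₁ V₂ where
  fst_ne_bot : ∀ x ∈ Λ, V₁ x ≠ ⊥
  snd_ne_bot : ∀ x ∈ Λ, V₂ x ≠ ⊥
  domination : ∃ K > (0 : ℝ), ∃ lam > (0 : ℝ), ∀ x ∈ Λ, ∀ t : ℝ, 0 < t →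
    restrictNorm (A t x) (V₁ x) * restrictNorm (A (-t) (φ t x)) (V₂ (φ t x))
      < K * Real.exp (-lam * t)

end Splittings

/-! ### The tangent bundle and its exterior powers -/

section Exterior

variable {n : ℕ} {H : Type*} [TopologicalSpace H]
  (I : ModelWithCorners ℝ (EuclideanSpace ℝ (Fin n)) H)
  {M : Type*} [TopologicalSpace M] [ChartedSpace H M]

instance instFiniteDimensionalTangentSpace (x : M) : FiniteDimensional ℝ (TangentSpace I x) :=
  inferInstanceAs (FiniteDimensional ℝ (EuclideanSpace ℝ (Fin n)))

/-- Local coordinates of the tangent bundle around `x₀`. -/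
def tangentCoord [IsManifold I 1 M] (x₀ x : M) :
    TangentSpace I x →ₗ[ℝ] EuclideanSpace ℝ (Fin n) :=
  ((trivializationAt (EuclideanSpace ℝ (Fin n)) (TangentSpace I : M → Type _)
    x₀).continuousLinearMapAt ℝ x).toLinearMap

/-- Local coordinates of the `k`-th exterior power of the tangent bundle around `x₀`. -/
def extTangentCoord [IsManifold I 1 M] (k : ℕ) (x₀ x : M) :
    ⋀[ℝ]^k (TangentSpace I x) →ₗ[ℝ] ⋀[ℝ]^k (EuclideanSpace ℝ (Fin n)) :=
  exteriorPower.map k (tangentCoord I x₀ x)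

/-- The action `∧^k DX_t(x)` on the `k`-th exterior powers of the tangent spaces, which carry the
inner product induced by the Riemannian metric. -/
def extFlowDeriv [RiemannianBundle (fun x : M ↦ TangentSpace I x)] (k : ℕ) (φ : ℝ → M → M)
    (t : ℝ) (x : M) :
    ⋀[ℝ]^k (TangentSpace I x) →L[ℝ] ⋀[ℝ]^k (TangentSpace I (φ t x)) :=
  LinearMap.toContinuousLinearMap (exteriorPower.map k (flowDeriv I φ t x).toLinearMap)

end Exterior

section Induced

variable {V : Type*} [AddCommGroup V] [Module ℝ V]

/-- The subspace `∧^k F` of `∧^k V`, spanned by the products of `k` vectors of `F`. -/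
def extF (k : ℕ) (F : Submodule ℝ V) : Submodule ℝ (⋀[ℝ]^k V) :=
  Submodule.span ℝ {w | ∃ v : Fin k → V, (∀ i, v i ∈ F) ∧ exteriorPower.ιMulti ℝ k v = w}

/-- The subspace of `∧^k V` spanned by the products of `i ≥ 1` vectors of `E` and
`j = k - i ≥ 0` vectors of `F`. -/
def extE (k : ℕ) (E F : Submodule ℝ V) : Submodule ℝ (⋀[ℝ]^k V) :=
  Submodule.span ℝ {w | ∃ v : Fin k → V, (∀ i, v i ∈ E ∨ v i ∈ F) ∧ (∃ i, v i ∈ E) ∧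
    exteriorPower.ιMulti ℝ k v = w}

end Induced

end

/-! Both conditions are equivalent to domination of `E ⊕ F` itself, in the form ‖DX_t|E‖ ≤ C e^(-λt)
m(DX_t|F), uniformly on `Λ`.

The passage to exterior powers is linear algebra for a single injective map A. The singular vectors
f_i of A|F form an orthonormal basis of F with orthogonal images, so ∧^k F is a line that A
stretches by exactly the product of the singular values. If A expands E at most κ times as much as
it contracts F, exchanging p ≥ 1 factors from F for factors from E costs at least a factor κ^p, up
to constants (`restrictNorm_extMap_mul_le`). Conversely, putting v ∈ E in place of the f_j with the
smallest singular value tests the exterior domination on one vector, and the comparison of E with F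
can be read off (`norm_mul_norm_le_of_extMap`). The angle between E and F enters only through a
constant, uniform by compactness (`exists_isSplittingBound`).

Domination gives the inequality of growth rates at every point, by taking logarithms and dividing by
t. For the converse, α_t = log ‖DX_t|E‖ and β_t = -log m(DX_t|F) are continuous subadditive cocycles
over the flow on `Λ`, and the hypothesis says that liminf α_t/t + liminf β_t/t < η almost everywhere
for every invariant measure. If α_n + β_n took a nonnegative value for every n ≥ 1, a limit of
empirical measures would be an invariant measure under which every α_m + β_m has nonnegative
integral (`exists_invariant_integral_nonneg`). The upper half of the subadditive ergodic theorem,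
proved by a covering argument along orbits (`exists_integral_le`), excludes this. So some α_n + β_n
is negative everywhere, bounded away from 0 by compactness, and subadditivity turns this into
exponential decay (`exists_decay`). -/

/-! ### Subadditive sequences of functions over a map -/

/-- A subadditive sequence of functions over `T`, with first term bounded above and
almost decreasing along orbits. -/
structure IsSubadditiveOver {K : Type*} (T : K → K) (a : ℕ → K → ℝ) (C : ℝ) : Prop where
  zero : ∀ x, a 0 x = 0
  add_le : ∀ m n x, a (m + n) x ≤ a m x + a n (T^[m] x)
  one_le : ∀ x, a 1 x ≤ C
  shift_le : ∀ n x, a n (T x) ≤ a (n + 1) x + C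

namespace IsSubadditiveOver

variable {K : Type*} {T : K → K} {a : ℕ → K → ℝ} {C : ℝ}

lemma le_mul (h : IsSubadditiveOver T a C) (n : ℕ) (x : K) : a n x ≤ C * n := by
  induction n generalizing x with
  | zero => simp [h.zero x]
  | succ n ih =>
    have h1 := h.add_le n 1 x
    have h2 := h.one_le (T^[n] x)
    have h3 := ih x
    push_cast
    linarith

lemma neg_le (h : IsSubadditiveOver T a C) (n : ℕ) (x : K) : -(C * n) ≤ a n x := by
  induction n generalizing x with
  | zero => simp [h.zero x]
  | succ n ih =>
    have h1 := h.shift_le n x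
    have h3 := ih (T x)
    push_cast
    linarith

lemma nonneg (h : IsSubadditiveOver T a C) (x : K) : 0 ≤ C := by
  have h1 := h.le_mul 1 x
  have h2 := h.neg_le 1 x
  push_cast at *
  linarith

lemma div_le (h : IsSubadditiveOver T a C) (n : ℕ) (x : K) : a n x / n ≤ C := by
  rcases Nat.eq_zero_or_pos n with rfl | hn
  · simpa using h.nonneg x
  · have : (0 : ℝ) < n := by exact_mod_cast hn
    rw [div_le_iff₀ this]
    exact h.le_mul n x

lemma le_div (h : IsSubadditiveOver T a C) (n : ℕ) (x : K) : -C ≤ a n x / n := by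
  rcases Nat.eq_zero_or_pos n with rfl | hn
  · simpa using h.nonneg x
  · have : (0 : ℝ) < n := by exact_mod_cast hn
    rw [le_div_iff₀ this]
    have := h.neg_le n x
    linarith

lemma isBoundedUnder_ge (h : IsSubadditiveOver T a C) (x : K) :
    IsBoundedUnder (· ≥ ·) atTop (fun n : ℕ ↦ a n x / n) :=
  isBoundedUnder_of ⟨-C, fun n ↦ h.le_div n x⟩

lemma isBoundedUnder_le (h : IsSubadditiveOver T a C) (x : K) :
    IsBoundedUnder (· ≤ ·) atTop (fun n : ℕ ↦ a n x / n) :=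
  isBoundedUnder_of ⟨C, fun n ↦ h.div_le n x⟩

/-- The lower growth rate. -/
noncomputable def _root_.lowerRate {K : Type*} (a : ℕ → K → ℝ) (x : K) : ℝ :=
  liminf (fun n : ℕ ↦ a n x / n) atTop

lemma abs_lowerRate_le (h : IsSubadditiveOver T a C) (x : K) : |lowerRate a x| ≤ C := by
  rw [abs_le]
  constructor
  · exact le_liminf_of_le (h.isBoundedUnder_le x).isCoboundedUnder_ge
      (Eventually.of_forall fun n ↦ h.le_div n x)
  · exact liminf_le_of_frequently_le (Eventually.of_forall fun n ↦ h.div_le n x).frequently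
      (h.isBoundedUnder_ge x)

/-- By `shift_le`, moving the base point one step changes the sequence upwards by at most a
constant, which is lost after division by `n`. Only this one-sided monotonicity is needed later. -/
lemma lowerRate_map_le (h : IsSubadditiveOver T a C) (x : K) :
    lowerRate a (T x) ≤ lowerRate a x := by
  refine le_of_forall_pos_le_add fun ε hε ↦ ?_
  have hfr : ∃ᶠ n : ℕ in atTop, a n x / n < lowerRate a x + ε / 2 :=
    frequently_lt_of_liminf_lt (h.isBoundedUnder_le x).isCoboundedUnder_ge
      (by unfold lowerRate; linarith)
  refine liminf_le_of_frequently_le ?_ (h.isBoundedUnder_ge (T x))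
  rw [frequently_atTop] at hfr ⊢
  intro N
  -- Beyond `N'` the spare `m * (ε / 2)` absorbs both the constant `C` and the passage from the
  -- factor `m + 1` to `m`.
  obtain ⟨N', hN'⟩ := exists_nat_gt ((|lowerRate a x + ε / 2| + C) / (ε / 2))
  obtain ⟨n, hn, hlt⟩ := hfr (max N N' + 2)
  obtain ⟨m, rfl⟩ : ∃ m, n = m + 1 := ⟨n - 1, by omega⟩
  have hmN : N ≤ m := by have := le_max_left N N'; omega
  have hmN' : N' ≤ m := by have := le_max_right N N'; omega
  refine ⟨m, hmN, ?_⟩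
  have hm0 : (0 : ℝ) < m := by
    have : 0 < m := by omega
    exact_mod_cast this
  have hmN'' : (N' : ℝ) ≤ m := by exact_mod_cast hmN'
  rw [div_lt_iff₀ (by positivity)] at hN' hlt
  rw [div_le_iff₀ hm0]
  have h1 := h.shift_le m x
  have h2 := le_abs_self (lowerRate a x + ε / 2)
  push_cast at hlt
  have h3 : (N' : ℝ) * (ε / 2) ≤ m * (ε / 2) := by gcongr
  nlinarith

lemma lowerRate_iterate_le (h : IsSubadditiveOver T a C) (n : ℕ) (x : K) :
    lowerRate a (T^[n] x) ≤ lowerRate a x := by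
  induction n with
  | zero => simp
  | succ n ih => rw [Function.iterate_succ_apply']; exact (h.lowerRate_map_le _).trans ih

/-- The points that reach a growth rate `ε`-close to the lower growth rate before time `N`. -/
def _root_.earlySet {K : Type*} (a : ℕ → K → ℝ) (ε : ℝ) (N : ℕ) : Set K :=
  {x | ∃ n ≤ N, 1 ≤ n ∧ a n x ≤ n * (lowerRate a x + ε)}

lemma exists_mem_earlySet (h : IsSubadditiveOver T a C) {ε : ℝ} (hε : 0 < ε) (x : K) :
    ∃ N, x ∈ earlySet a ε N := by
  have hfr : ∃ᶠ n : ℕ in atTop, a n x / n < lowerRate a x + ε :=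
    frequently_lt_of_liminf_lt (h.isBoundedUnder_le x).isCoboundedUnder_ge
      (by unfold lowerRate; linarith)
  obtain ⟨n, hn, hlt⟩ := (frequently_atTop.1 hfr) 1
  have hn0 : (0 : ℝ) < n := by exact_mod_cast hn
  rw [div_lt_iff₀ hn0] at hlt
  exact ⟨n, n, le_rfl, hn, by linarith⟩

lemma _root_.earlySet_mono {K : Type*} (a : ℕ → K → ℝ) (ε : ℝ) : Monotone (earlySet a ε) :=
  fun _ _ hNM _ ⟨n, hn, h⟩ ↦ ⟨n, hn.trans hNM, h⟩

/-- Covering argument: walk along the orbit, jumping over a good block of length at most `N` from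
each point of `G` and making a single step, at the extra cost `D`, from each point outside `G`. The
summand `N` pays for a last block that overshoots the end. -/
lemma le_of_orbit (h : IsSubadditiveOver T a C) {A D : ℝ} (hD : 0 ≤ D) (hC : C ≤ A + D)
    {G : Set K} {N : ℕ} (L : ℕ) (x : K)
    (hG : ∀ i, T^[i] x ∈ G → ∃ n ≤ N, 1 ≤ n ∧ a n (T^[i] x) ≤ n * A) :
    a L x ≤ L * A + D * (∑ i ∈ Finset.range L, Gᶜ.indicator 1 (T^[i] x) + N) := by
  induction L using Nat.strong_induction_on generalizing x with
  | _ L ih =>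
  have hind : ∀ y : K, (0 : ℝ) ≤ Gᶜ.indicator 1 y := fun y ↦
    indicator_nonneg (fun _ _ ↦ zero_le_one) y
  have hsum : ∀ (m : ℕ) (y : K), (0 : ℝ) ≤ ∑ i ∈ Finset.range m, Gᶜ.indicator 1 (T^[i] y) :=
    fun m y ↦ Finset.sum_nonneg fun i _ ↦ hind _
  have hstep : ∀ n ≤ L, 1 ≤ n → a L x ≤ a n x + ((L - n : ℝ) * A +
      D * (∑ i ∈ Finset.range (L - n), Gᶜ.indicator 1 (T^[n + i] x) + N)) := by
    intro n hnL hn1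
    have h1 := h.add_le n (L - n) x
    have h2 := ih (L - n) (by omega) (T^[n] x) (fun i hi ↦ by
      rw [← Function.iterate_add_apply] at hi ⊢
      exact hG _ hi)
    rw [Nat.add_sub_cancel' hnL] at h1
    simp only [← Function.iterate_add_apply, Nat.add_comm _ n] at h2
    rw [Nat.cast_sub hnL] at h2
    linarith
  rcases Nat.eq_zero_or_pos L with rfl | hL
  · simp only [h.zero, Finset.range_zero, Finset.sum_empty, CharP.cast_eq_zero, zero_mul, zero_add]
    positivity
  by_cases hx : x ∈ G
  · obtain ⟨n, hnN, hn1, hn⟩ := hG 0 hx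
    rw [Function.iterate_zero_apply] at hn
    rcases le_or_gt n L with hnL | hnL
    · have h1 := hstep n hnL hn1
      have h2 : ∑ i ∈ Finset.range (L - n), Gᶜ.indicator (1 : K → ℝ) (T^[n + i] x) ≤
          ∑ i ∈ Finset.range L, Gᶜ.indicator 1 (T^[i] x) := by
        obtain ⟨m, rfl⟩ := Nat.exists_eq_add_of_le hnL
        rw [Nat.add_sub_cancel_left, Finset.sum_range_add]
        linarith [hsum n x]
      have h3 := mul_le_mul_of_nonneg_left h2 hD
      linarith
    -- The good block is longer than what remains of the orbit; since `L ≤ N`, the crude bound `C *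
    -- L` is paid by `L * A + D * N`.
    · have h1 := h.le_mul L x
      have h2 : (L : ℝ) ≤ N := by exact_mod_cast hnL.le.trans hnN
      have h3 := mul_le_mul_of_nonneg_left h2 hD
      have h4 := mul_nonneg hD (hsum L x)
      have h5 : C * L ≤ (A + D) * L := by gcongr
      linarith
  · have h1 := hstep 1 hL le_rfl
    have h2 := h.one_le x
    have h3 : ∑ i ∈ Finset.range L, Gᶜ.indicator (1 : K → ℝ) (T^[i] x) =
        1 + ∑ i ∈ Finset.range (L - 1), Gᶜ.indicator 1 (T^[1 + i] x) := by
      obtain ⟨m, rfl⟩ := Nat.exists_eq_add_of_le hL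
      rw [Nat.add_sub_cancel_left, Nat.succ_eq_add_one, Nat.zero_add, Finset.sum_range_add]
      simp [hx]
    rw [h3]
    push_cast at h1
    linarith

/-- A block that is good relative to the rate at a later orbit point is good relative to the rate at
`x`, because the lower rate does not increase along orbits. The choice `D = 2 * C` is admissible
since the lower rate is at least `-C`. -/
lemma le_lowerRate_add (h : IsSubadditiveOver T a C) {ε : ℝ} (hε : 0 < ε) (N L : ℕ) (x : K) :
    a L x ≤ L * (lowerRate a x + ε) +
      2 * C * (∑ i ∈ Finset.range L, (earlySet a ε N)ᶜ.indicator 1 (T^[i] x) + N) := by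
  have hab := abs_le.1 (h.abs_lowerRate_le x)
  refine h.le_of_orbit (by linarith [h.nonneg x]) (by linarith) L x ?_
  rintro i ⟨n, hn, hn1, hle⟩
  refine ⟨n, hn, hn1, hle.trans ?_⟩
  gcongr
  exact h.lowerRate_iterate_le i x

variable [MeasurableSpace K]

lemma measurable_lowerRate (ha : ∀ n, Measurable (a n)) : Measurable (lowerRate a) :=
  Measurable.liminf fun n ↦ (ha n).div_const _

lemma measurableSet_earlySet (ha : ∀ n, Measurable (a n)) (ε : ℝ) (N : ℕ) :
    MeasurableSet (earlySet a ε N) := by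
  have : earlySet a ε N = ⋃ n, ⋃ (_ : n ≤ N), ⋃ (_ : 1 ≤ n),
      {x | a n x ≤ n * (lowerRate a x + ε)} := by
    ext x; simp [earlySet, and_left_comm]
  rw [this]
  refine .iUnion fun n ↦ .iUnion fun _ ↦ .iUnion fun _ ↦ measurableSet_le (ha n) ?_
  exact ((measurable_lowerRate ha).add_const _).const_mul _

/-- The early sets increase with `N` and exhaust the space, so continuity from above of `ν` applies
to their complements. -/
lemma tendsto_measure_compl_earlySet (h : IsSubadditiveOver T a C) (ha : ∀ n, Measurable (a n))
    (ν : Measure K) [IsProbabilityMeasure ν] {ε : ℝ} (hε : 0 < ε) :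
    Tendsto (fun N ↦ ν.real (earlySet a ε N)ᶜ) atTop (𝓝 0) := by
  have h1 : Tendsto (ν ∘ fun N ↦ (earlySet a ε N)ᶜ) atTop (𝓝 (ν (⋂ N, (earlySet a ε N)ᶜ))) :=
    tendsto_measure_iInter_atTop
      (fun N ↦ (measurableSet_earlySet ha ε N).compl.nullMeasurableSet)
      (fun _ _ h ↦ compl_subset_compl.2 (earlySet_mono a ε h)) ⟨0, measure_ne_top _ _⟩
  have h2 : ⋂ N, (earlySet a ε N)ᶜ = ∅ := by
    rw [← compl_iUnion, compl_empty_iff, eq_univ_iff_forall]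
    exact fun x ↦ mem_iUnion.2 (h.exists_mem_earlySet hε x)
  rw [h2, measure_empty] at h1
  exact (ENNReal.tendsto_toReal ENNReal.zero_ne_top).comp h1

lemma integrable (h : IsSubadditiveOver T a C) (ha : ∀ n, Measurable (a n))
    (ν : Measure K) [IsProbabilityMeasure ν] (n : ℕ) : Integrable (a n) ν :=
  .of_bound (ha n).aestronglyMeasurable (C * n) (Eventually.of_forall fun x ↦ by
    rw [Real.norm_eq_abs, abs_le]; exact ⟨h.neg_le n x, h.le_mul n x⟩)

/-- The upper half of the subadditive ergodic theorem, for the sum of two sequences. -/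
theorem exists_integral_le {b : ℕ → K → ℝ} (h : IsSubadditiveOver T a C)
    (h' : IsSubadditiveOver T b C) (ha : ∀ n, Measurable (a n)) (hb : ∀ n, Measurable (b n))
    (ν : Measure K) [IsProbabilityMeasure ν] (hT : MeasurePreserving T ν ν) {η : ℝ}
    (hη : ∀ᵐ x ∂ν, lowerRate a x + lowerRate b x ≤ η) {δ : ℝ} (hδ : 0 < δ) :
    ∃ L : ℕ, 1 ≤ L ∧ ∫ x, (a L x + b L x) ∂ν ≤ L * (η + δ) := by
  obtain ⟨x₀⟩ : Nonempty K := by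
    by_contra hK
    rw [not_nonempty_iff] at hK
    exact IsProbabilityMeasure.ne_zero ν (Measure.eq_zero_of_isEmpty ν)
  have hC := h.nonneg x₀
  have hev : Tendsto (fun N ↦ 2 * C * (ν.real (earlySet a (δ / 8) N)ᶜ +
      ν.real (earlySet b (δ / 8) N)ᶜ)) atTop (𝓝 (2 * C * (0 + 0))) :=
    ((h.tendsto_measure_compl_earlySet ha ν (by positivity)).add
      (h'.tendsto_measure_compl_earlySet hb ν (by positivity))).const_mul _
  -- Budget per unit of time: `δ / 4` for the visits to the two bad sets (choice of `N`), `δ / 4`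
  -- for the boundary term `2 * C * (2 * N)` (choice of `L`), and `δ / 4` from the two values `ε = δ
  -- / 8`.
  obtain ⟨N, hN⟩ := (hev.eventually_lt_const (u := δ / 4) (by simpa using by positivity)).exists
  obtain ⟨L, hL⟩ := exists_nat_gt (2 * C * (2 * N) / (δ / 4))
  have hind : ∀ c : ℕ → K → ℝ, (∀ n, Measurable (c n)) → ∀ i,
      Integrable (fun x ↦ (earlySet c (δ / 8) N)ᶜ.indicator (1 : K → ℝ) (T^[i] x)) ν ∧
      ∫ x, (earlySet c (δ / 8) N)ᶜ.indicator (1 : K → ℝ) (T^[i] x) ∂ν =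
        ν.real (earlySet c (δ / 8) N)ᶜ := by
    intro c hc i
    have hm := (measurableSet_earlySet hc (δ / 8) N).compl
    have hTi := hT.iterate i
    have hi : Integrable ((earlySet c (δ / 8) N)ᶜ.indicator (1 : K → ℝ)) ν :=
      (integrable_const (1 : ℝ)).indicator hm
    refine ⟨hTi.integrable_comp_of_integrable hi, ?_⟩
    rw [← integral_indicator_one hm]
    conv_rhs => rw [← hTi.map_eq]
    rw [integral_map hTi.measurable.aemeasurable]
    rw [hTi.map_eq]
    exact hi.aestronglyMeasurable
  refine ⟨L + 1, by omega, ?_⟩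
  have hL0 : (0 : ℝ) < (L + 1 : ℕ) := by positivity
  rw [div_lt_iff₀ (by positivity)] at hL
  have hint : ∀ c : ℕ → K → ℝ, (∀ n, Measurable (c n)) →
      Integrable (fun x ↦ ∑ i ∈ Finset.range (L + 1),
        (earlySet c (δ / 8) N)ᶜ.indicator (1 : K → ℝ) (T^[i] x)) ν :=
    fun c hc ↦ integrable_finsetSum _ fun i _ ↦ (hind c hc i).1
  calc ∫ x, (a (L + 1) x + b (L + 1) x) ∂ν
      ≤ ∫ x, ((L + 1 : ℕ) * (η + δ / 4) + 2 * C * (2 * N) + 2 * C * (∑ i ∈ Finset.range (L + 1),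
          (earlySet a (δ / 8) N)ᶜ.indicator (1 : K → ℝ) (T^[i] x) + ∑ i ∈ Finset.range (L + 1),
          (earlySet b (δ / 8) N)ᶜ.indicator (1 : K → ℝ) (T^[i] x))) ∂ν := by
        refine integral_mono_ae ((h.integrable ha ν _).add (h'.integrable hb ν _))
          ((integrable_const _).add (((hint a ha).add (hint b hb)).const_mul _)) ?_
        filter_upwards [hη] with x hx
        -- The two sequences are covered separately: the hypothesis bounds the sum of the lower
        -- rates, which may be smaller than the lower rate of the sum.
        have h1 := h.le_lowerRate_add (ε := δ / 8) (by positivity) N (L + 1) x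
        have h2 := h'.le_lowerRate_add (ε := δ / 8) (by positivity) N (L + 1) x
        have h3 := mul_le_mul_of_nonneg_left hx hL0.le
        linarith
    _ = (L + 1 : ℕ) * (η + δ / 4) + 2 * C * (2 * N) + (L + 1 : ℕ) * (2 * C *
          (ν.real (earlySet a (δ / 8) N)ᶜ + ν.real (earlySet b (δ / 8) N)ᶜ)) := by
        have hab := ((hint a ha).add (hint b hb)).const_mul (2 * C)
        simp only [Pi.add_apply] at hab
        rw [integral_add (integrable_const _) hab, integral_const_mul, integral_add (hint a ha) (hint b hb),
          integral_finsetSum _ fun i _ ↦ (hind a ha i).1,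
          integral_finsetSum _ fun i _ ↦ (hind b hb i).1,
          Finset.sum_congr rfl fun i _ ↦ (hind a ha i).2,
          Finset.sum_congr rfl fun i _ ↦ (hind b hb i).2]
        simp
        ring
    _ ≤ (L + 1 : ℕ) * (η + δ) := by
        have h1 := mul_le_mul_of_nonneg_left hN.le hL0.le
        have h2 : 0 ≤ L * δ := by positivity
        push_cast at *
        linarith

end IsSubadditiveOver

/-! ### Empirical measures of semiflows -/

/-- A continuous semiflow, indexed by the nonnegative reals. -/
structure IsSemiflow {K : Type*} [TopologicalSpace K] (ψ : ℝ → K → K) : Prop where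
  zero : ∀ x, ψ 0 x = x
  add : ∀ s t : ℝ, 0 ≤ s → 0 ≤ t → ∀ x, ψ (s + t) x = ψ s (ψ t x)
  continuousOn : ContinuousOn (fun p : ℝ × K ↦ ψ p.1 p.2) (Ici 0 ×ˢ univ)

/-- A continuous subadditive cocycle over a semiflow. -/
structure IsSubadditiveCocycle {K : Type*} [TopologicalSpace K] (ψ : ℝ → K → K)
    (f : ℝ → K → ℝ) : Prop where
  continuousOn : ContinuousOn (fun p : ℝ × K ↦ f p.1 p.2) (Ici 0 ×ˢ univ)
  add_le : ∀ s t : ℝ, 0 ≤ s → 0 ≤ t → ∀ x, f (s + t) x ≤ f s (ψ t x) + f t x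

section Empirical

variable {K : Type*} [TopologicalSpace K] {ψ : ℝ → K → K} {f g : ℝ → K → ℝ}

lemma IsSemiflow.continuous (h : IsSemiflow ψ) {t : ℝ} (ht : 0 ≤ t) : Continuous (ψ t) := by
  rw [← continuousOn_univ]
  exact h.continuousOn.comp (f := fun x ↦ (t, x)) (by fun_prop) fun x _ ↦ ⟨ht, mem_univ _⟩

/-- The absolute value extends the orbit continuously to negative times, so that interval integrals
along it need no one-sided continuity. -/
lemma IsSemiflow.continuous_orbit (h : IsSemiflow ψ) (x : K) : Continuous fun s ↦ ψ |s| x := by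
  rw [← continuousOn_univ]
  exact h.continuousOn.comp (f := fun s : ℝ ↦ (|s|, x)) (by fun_prop)
    fun s _ ↦ ⟨abs_nonneg s, mem_univ _⟩

lemma IsSemiflow.iterate (h : IsSemiflow ψ) (n : ℕ) {t : ℝ} (ht : 0 ≤ t) (x : K) :
    (ψ t)^[n] x = ψ (n * t) x := by
  induction n with
  | zero => simp [h.zero]
  | succ n ih =>
    rw [Function.iterate_succ_apply', ih, ← h.add t _ ht (by positivity)]
    congr 1
    push_cast
    ring

namespace IsSubadditiveCocycle

lemma add (hf : IsSubadditiveCocycle ψ f) (hg : IsSubadditiveCocycle ψ g) :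
    IsSubadditiveCocycle ψ (fun t x ↦ f t x + g t x) where
  continuousOn := hf.continuousOn.add hg.continuousOn
  add_le s t hs ht x := by
    have h1 := hf.add_le s t hs ht x
    have h2 := hg.add_le s t hs ht x
    linarith

lemma continuous (h : IsSubadditiveCocycle ψ f) {t : ℝ} (ht : 0 ≤ t) : Continuous (f t) := by
  rw [← continuousOn_univ]
  exact h.continuousOn.comp (f := fun x ↦ (t, x)) (by fun_prop) fun x _ ↦ ⟨ht, mem_univ _⟩

lemma exists_bound [CompactSpace K] (h : IsSubadditiveCocycle ψ f) (T : ℝ) :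
    ∃ D, 0 ≤ D ∧ ∀ s ∈ Icc 0 T, ∀ x, |f s x| ≤ D := by
  have hc : IsCompact (Icc (0 : ℝ) T ×ˢ (univ : Set K)) := isCompact_Icc.prod isCompact_univ
  obtain ⟨D, hD⟩ := hc.exists_bound_of_continuousOn
    (h.continuousOn.mono (prod_mono Icc_subset_Ici_self Subset.rfl))
  exact ⟨max D 0, le_max_right _ _, fun s hs x ↦
    (hD (s, x) ⟨hs, mem_univ _⟩).trans (le_max_left _ _)⟩

lemma le_sum (h : IsSubadditiveCocycle ψ f) {t : ℝ} (ht : 0 ≤ t) (q : ℕ)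
    (x : K) : f (q * t) x ≤ f 0 x + ∑ i ∈ Finset.range q, f t (ψ (i * t) x) := by
  induction q with
  | zero => simp
  | succ q ih =>
    rw [Finset.sum_range_succ]
    have := h.add_le t (q * t) ht (by positivity) x
    have e : ((q + 1 : ℕ) : ℝ) * t = t + q * t := by push_cast; ring
    rw [e]
    linarith

/-- For each offset `s` in `[0, m]`, cut the orbit segment into an initial piece of length `s`, `q`
blocks of length `m` and a final piece of length `m - s`. Averaging the resulting inequality over
`s` turns the sums over blocks into an integral along the orbit, with an error independent of `q`.
-/
lemma nonneg_le_integral [CompactSpace K] (hψ : IsSemiflow ψ) (h : IsSubadditiveCocycle ψ f)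
    (m : ℕ) : ∃ D, ∀ (q : ℕ) (x : K), 0 ≤ f ((q + 1 : ℕ) * m) x →
      0 ≤ D + ∫ s in (0 : ℝ)..((q + 1 : ℕ) * m), f m (ψ |s| x) := by
  obtain ⟨D, hD0, hD⟩ := h.exists_bound m
  -- Each offset costs `3 * D` (the two end pieces and the value at time `0`); completing the
  -- integral over the last interval of length `m` costs `m * D` more.
  refine ⟨m * (4 * D), fun q x hx ↦ ?_⟩
  have hm : (0 : ℝ) ≤ m := by positivity
  have hcont : Continuous fun s ↦ f m (ψ |s| x) := (h.continuous hm).comp (hψ.continuous_orbit x)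
  have key : ∀ s ∈ Icc (0 : ℝ) m,
      0 ≤ 3 * D + ∑ i ∈ Finset.range q, f m (ψ |s + i * m| x) := by
    intro s hs
    have hqm : (0 : ℝ) ≤ q * m := by positivity
    have h1 := h.add_le (m - s) (s + q * m) (by linarith [hs.2]) (by linarith [hs.1]) x
    have e1 : (m - s) + (s + q * m) = ((q + 1 : ℕ) : ℝ) * m := by push_cast; ring
    rw [e1] at h1
    have h2 := h.add_le (q * m) s hqm hs.1 x
    rw [add_comm (q * m : ℝ) s] at h2
    have h3 := h.le_sum hm q (ψ s x)
    have h4 : ∑ i ∈ Finset.range q, f m (ψ (i * m) (ψ s x)) =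
        ∑ i ∈ Finset.range q, f m (ψ |s + i * m| x) := by
      refine Finset.sum_congr rfl fun i _ ↦ ?_
      have : (0 : ℝ) ≤ i * m := by positivity
      rw [← hψ.add _ _ this hs.1, abs_of_nonneg (by linarith [hs.1]), add_comm s]
    have h5 := (abs_le.1 (hD (m - s) ⟨by linarith [hs.2], by linarith [hs.1]⟩
      (ψ (s + q * m) x))).2
    have h6 := (abs_le.1 (hD s hs x)).2
    have h7 := (abs_le.1 (hD 0 ⟨le_rfl, hm⟩ (ψ s x))).2
    linarith
  have hint : ∀ i : ℕ, Continuous fun s ↦ f m (ψ |s + i * m| x) := fun i ↦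
    hcont.comp (continuous_add_const _)
  have h1 : 0 ≤ ∫ s in (0 : ℝ)..m, (3 * D + ∑ i ∈ Finset.range q, f m (ψ |s + i * m| x)) :=
    intervalIntegral.integral_nonneg hm key
  have h2 : ∑ i ∈ Finset.range q, ∫ s in (0 : ℝ)..m, f m (ψ |s + i * m| x) =
      ∫ s in (0 : ℝ)..q * m, f m (ψ |s| x) := by
    have := intervalIntegral.sum_integral_adjacent_intervals (μ := volume)
      (f := fun s ↦ f m (ψ |s| x)) (a := fun i : ℕ ↦ (i : ℝ) * m) (n := q)
      fun k _ ↦ hcont.intervalIntegrable _ _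
    rw [Nat.cast_zero, zero_mul] at this
    rw [← this]
    refine Finset.sum_congr rfl fun i _ ↦ ?_
    rw [intervalIntegral.integral_comp_add_right (fun s ↦ f m (ψ |s| x))]
    congr 1 <;> push_cast <;> ring
  rw [intervalIntegral.integral_add (by simp)
    ((continuous_finsetSum _ fun i _ ↦ hint i).intervalIntegrable _ _),
    intervalIntegral.integral_finsetSum fun i _ ↦ (hint i).intervalIntegrable _ _, h2,
    intervalIntegral.integral_const] at h1
  have h3 := intervalIntegral.integral_add_adjacent_intervals (μ := volume)
    (hcont.intervalIntegrable 0 (q * m)) (hcont.intervalIntegrable (q * m) ((q + 1 : ℕ) * m))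
  have h4 : |∫ s in (q * m : ℝ)..((q + 1 : ℕ) * m), f m (ψ |s| x)| ≤ D * m := by
    have := intervalIntegral.norm_integral_le_of_norm_le_const (a := (q * m : ℝ))
      (b := (q + 1 : ℕ) * m) (f := fun s ↦ f m (ψ |s| x)) (C := D)
      fun s _ ↦ hD m ⟨hm, le_rfl⟩ _
    have e : ((q + 1 : ℕ) : ℝ) * m - q * m = m := by push_cast; ring
    rwa [e, abs_of_nonneg hm] at this
  have h5 := (abs_le.1 h4).1
  simp only [smul_eq_mul, sub_zero] at h1
  linarith

variable [CompactSpace K] [T2Space K] [TopologicalSpace.MetrizableSpace K] [MeasurableSpace K]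
  [BorelSpace K]

/-- If the times `f n` of a subadditive cocycle are not everywhere negative, then some invariant
measure gives all of them nonnegative integrals. -/
theorem exists_invariant_integral_nonneg (hψ : IsSemiflow ψ) (h : IsSubadditiveCocycle ψ f)
    (hpos : ∀ n : ℕ, 1 ≤ n → ∃ x, 0 ≤ f n x) :
    ∃ ν : Measure K, IsProbabilityMeasure ν ∧ (∀ t, 0 ≤ t → ν.map (ψ t) = ν) ∧
      ∀ m : ℕ, 1 ≤ m → 0 ≤ ∫ x, f m x ∂ν := by
  have hfac : ∀ n : ℕ, 0 < ((n.factorial : ℕ) : ℝ) := fun n ↦ by positivity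
  -- Orbit segments of length `n !` are used because every fixed `m` divides `n !` as soon as `m ≤
  -- n`, so one sequence of measures serves all `m` at once.
  choose x hx using fun n : ℕ ↦ hpos n.factorial n.factorial_pos
  let P : ℕ → Measure ℝ := fun n ↦ ENNReal.ofReal (n.factorial : ℝ)⁻¹ •
    volume.restrict (Ioc 0 (n.factorial : ℝ))
  have hP : ∀ n, IsProbabilityMeasure (P n) := fun n ↦ ⟨by
    simp only [P, Measure.smul_apply, Measure.restrict_apply_univ, Real.volume_Ioc, smul_eq_mul,
      sub_zero]
    rw [← ENNReal.ofReal_mul (by positivity), inv_mul_cancel₀ (hfac n).ne', ENNReal.ofReal_one]⟩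
  have horb : ∀ n, Measurable fun s ↦ ψ |s| (x n) := fun n ↦ (hψ.continuous_orbit _).measurable
  let μs : ℕ → ProbabilityMeasure K := fun n ↦ ⟨(P n).map fun s ↦ ψ |s| (x n),
    Measure.isProbabilityMeasure_map (horb n).aemeasurable⟩
  have hμs : ∀ n (g : K → ℝ), Continuous g → ∫ y, g y ∂(μs n : Measure K) =
      (n.factorial : ℝ)⁻¹ * ∫ s in (0 : ℝ)..n.factorial, g (ψ |s| (x n)) := by
    intro n g hg
    simp only [μs, ProbabilityMeasure.coe_mk]
    rw [integral_map (horb n).aemeasurable hg.aestronglyMeasurable, integral_smul_measure,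
      intervalIntegral.integral_of_le (hfac n).le, ENNReal.toReal_ofReal (by positivity),
      smul_eq_mul]
  -- The space of probability measures on a compact metrizable space is compact, so the empirical
  -- measures converge along a free ultrafilter and no subsequence has to be extracted.
  let 𝒰 : Ultrafilter ℕ := Filter.hyperfilter ℕ
  have h𝒰 : (𝒰 : Filter ℕ) ≤ atTop := Nat.hyperfilter_le_atTop
  let ν : ProbabilityMeasure K := (𝒰.map μs).lim
  have hν : Tendsto μs 𝒰 (𝓝 ν) := (𝒰.map μs).le_nhds_lim
  have hlim : ∀ g : K → ℝ, Continuous g →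
      Tendsto (fun n ↦ (n.factorial : ℝ)⁻¹ * ∫ s in (0 : ℝ)..n.factorial, g (ψ |s| (x n))) 𝒰
        (𝓝 (∫ y, g y ∂(ν : Measure K))) := by
    intro g hg
    have := ProbabilityMeasure.tendsto_iff_forall_integral_tendsto.1 hν
      (BoundedContinuousFunction.mkOfCompact ⟨g, hg⟩)
    refine this.congr fun n ↦ ?_
    exact hμs n g hg
  have hzero : ∀ D : ℝ, Tendsto (fun n : ℕ ↦ (n.factorial : ℝ)⁻¹ * D) 𝒰 (𝓝 0) := by
    intro D
    have h1 : Tendsto (fun n : ℕ ↦ (n.factorial : ℝ)⁻¹) atTop (𝓝 0) :=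
      tendsto_inv_atTop_zero.comp
        (tendsto_natCast_atTop_atTop.comp
          (tendsto_atTop_mono Nat.self_le_factorial tendsto_id))
    simpa using (h1.mul_const D).mono_left h𝒰
  refine ⟨ν, inferInstance, fun t ht ↦ ?_, fun m hm ↦ ?_⟩
  · have hψt := hψ.continuous ht
    have : IsProbabilityMeasure ((ν : Measure K).map (ψ t)) :=
      Measure.isProbabilityMeasure_map hψt.measurable.aemeasurable
    refine ext_of_forall_integral_eq_of_IsFiniteMeasure fun g ↦ ?_
    rw [integral_map hψt.measurable.aemeasurable g.continuous.aestronglyMeasurable]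
    have h1 := hlim (fun y ↦ g (ψ t y)) (g.continuous.comp hψt)
    have h2 := hlim g g.continuous
    have h3 := (hzero (2 * (‖g‖ * t)))
    refine tendsto_nhds_unique h1 ?_
    -- Translating the time interval by `t` changes the integral only through two end pieces of
    -- length `t`, each bounded by `‖g‖ * t`.
    have h4 : Tendsto (fun n ↦
        (n.factorial : ℝ)⁻¹ * (∫ s in (0 : ℝ)..n.factorial, g (ψ t (ψ |s| (x n)))) -
        (n.factorial : ℝ)⁻¹ * (∫ s in (0 : ℝ)..n.factorial, g (ψ |s| (x n)))) 𝒰 (𝓝 0) := by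
      refine squeeze_zero_norm (fun n ↦ ?_) h3
      have hc : Continuous fun s ↦ g (ψ |s| (x n)) := g.continuous.comp (hψ.continuous_orbit _)
      have e1 : ∫ s in (0 : ℝ)..n.factorial, g (ψ t (ψ |s| (x n))) =
          ∫ s in t..(n.factorial + t), g (ψ |s| (x n)) := by
        have := intervalIntegral.integral_comp_add_right (fun s ↦ g (ψ |s| (x n))) t
          (a := 0) (b := n.factorial)
        rw [zero_add] at this
        rw [← this]
        refine intervalIntegral.integral_congr fun s hs ↦ ?_
        rw [uIcc_of_le (hfac n).le] at hs
        rw [abs_of_nonneg hs.1, abs_of_nonneg (add_nonneg hs.1 ht), add_comm,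
          hψ.add t s ht hs.1]
      have e2 := intervalIntegral.integral_interval_sub_interval_comm (μ := volume)
        (hc.intervalIntegrable t (n.factorial + t)) (hc.intervalIntegrable 0 n.factorial)
        (hc.intervalIntegrable t 0)
      have b : ∀ u v : ℝ, ‖∫ s in u..v, g (ψ |s| (x n))‖ ≤ ‖g‖ * |v - u| := fun u v ↦
        intervalIntegral.norm_integral_le_of_norm_le_const fun s _ ↦ g.norm_coe_le_norm _
      have b1 := b t 0
      have b2 := b (n.factorial + t) n.factorial
      rw [zero_sub, abs_neg, abs_of_nonneg ht] at b1
      rw [sub_add_cancel_left, abs_neg, abs_of_nonneg ht] at b2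
      rw [← mul_sub, norm_mul, norm_inv, Real.norm_natCast, e1, e2]
      gcongr
      refine (norm_sub_le _ _).trans ?_
      linarith
    simpa using h4.add h2
  · have hm0 : (0 : ℝ) ≤ m := by positivity
    obtain ⟨D, hD⟩ := h.nonneg_le_integral hψ m
    have h1 := hlim (f m) (h.continuous hm0)
    have h2 := (hzero D).add h1
    rw [zero_add] at h2
    refine ge_of_tendsto h2 ?_
    have : ∀ᶠ n : ℕ in 𝒰, m ≤ n := (eventually_ge_atTop m).filter_mono h𝒰
    filter_upwards [this] with n hn
    obtain ⟨q, hq⟩ := Nat.dvd_factorial hm hn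
    have hq1 : q ≠ 0 := by
      rintro rfl
      exact n.factorial_ne_zero (by simpa using hq)
    obtain ⟨p, rfl⟩ := Nat.exists_eq_succ_of_ne_zero hq1
    have e : (n.factorial : ℝ) = (p + 1 : ℕ) * m := by
      rw [hq]; push_cast; ring
    have h3 := hD p (x n) (by rw [← e]; exact hx n)
    rw [← e] at h3
    rw [← mul_add]
    positivity

end IsSubadditiveCocycle

end Empirical

/-! ### Uniform decay of subadditive cocycles -/

/-- A continuous subadditive cocycle that starts at `0` and almost decreases along orbits. -/
structure IsGrowthCocycle {K : Type*} [TopologicalSpace K] (ψ : ℝ → K → K)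
    (f : ℝ → K → ℝ) : Prop extends IsSubadditiveCocycle ψ f where
  zero : ∀ x, f 0 x = 0
  shift_le : ∃ C, ∀ t x, 0 ≤ t → f t (ψ 1 x) ≤ f (t + 1) x + C

namespace IsGrowthCocycle

variable {K : Type*} [TopologicalSpace K] [CompactSpace K] {ψ : ℝ → K → K} {f g : ℝ → K → ℝ}

lemma isSubadditiveOver (hψ : IsSemiflow ψ) (h : IsGrowthCocycle ψ f) :
    ∃ C, IsSubadditiveOver (ψ 1) (fun n ↦ f n) C := by
  obtain ⟨C, hC⟩ := h.shift_le
  obtain ⟨D, -, hD⟩ := h.exists_bound 1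
  refine ⟨max C D, by simpa using h.zero, fun m n x ↦ ?_, fun x ↦ ?_, fun n x ↦ ?_⟩
  · rw [hψ.iterate m zero_le_one, mul_one, Nat.cast_add, add_comm (m : ℝ), add_comm (f m x)]
    exact h.add_le n m (by positivity) (by positivity) x
  · have := (abs_le.1 (hD 1 ⟨zero_le_one, le_rfl⟩ x)).2
    simpa using Or.inr this
  · have := hC n x (by positivity)
    push_cast
    linarith [le_max_left C D]

/-- Linear growth in both directions makes `f t x / t` bounded for `t ≥ 1`, which gives real-valued
`liminf` and `limsup` their expected meaning. -/
lemma exists_abs_le (h : IsGrowthCocycle ψ f) :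
    ∃ C, 0 ≤ C ∧ ∀ t x, 0 ≤ t → |f t x| ≤ C * (t + 1) := by
  obtain ⟨C, hC⟩ := h.shift_le
  obtain ⟨D, hD0, hD⟩ := h.exists_bound 1
  have key : ∀ (n : ℕ) (r : ℝ), r ∈ Icc (0 : ℝ) 1 → ∀ x,
      |f (r + n) x| ≤ (max C D) * (n + 1) := by
    intro n r hr
    induction n with
    | zero =>
      intro x
      have := hD r hr x
      simpa using Or.inr this
    | succ n ih =>
      intro x
      have hrn : 0 ≤ r + n := by have := hr.1; positivity
      have h1 := hC (r + n) x hrn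
      have h2 := h.add_le (r + n) 1 hrn zero_le_one x
      have h3 := abs_le.1 (hD 1 ⟨zero_le_one, le_rfl⟩ x)
      have h4 := abs_le.1 (ih (ψ 1 x))
      have h5 := le_max_left C D
      have h6 := le_max_right C D
      rw [abs_le]
      push_cast
      rw [← add_assoc]
      constructor <;> linarith
  refine ⟨max C D, hD0.trans (le_max_right _ _), fun t x ht ↦ ?_⟩
  have h1 := Nat.floor_le ht
  have h2 := Nat.lt_floor_add_one t
  have h3 := key ⌊t⌋₊ (t - ⌊t⌋₊) ⟨by linarith, by linarith⟩ x
  rw [sub_add_cancel] at h3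
  refine h3.trans ?_
  have : 0 ≤ max C D := hD0.trans (le_max_right _ _)
  gcongr

lemma exists_abs_div_le (h : IsGrowthCocycle ψ f) :
    ∃ C, ∀ x, ∀ t : ℝ, 1 ≤ t → |1 / t * f t x| ≤ C := by
  obtain ⟨C, hC0, hC⟩ := h.exists_abs_le
  refine ⟨C * 2, fun x t ht ↦ ?_⟩
  have ht0 : 0 < t := by linarith
  rw [abs_mul, abs_of_pos (by positivity : 0 < 1 / t), one_div, inv_mul_le_iff₀ ht0]
  have := hC t x ht0.le
  nlinarith

lemma isBoundedUnder_le (h : IsGrowthCocycle ψ f) (x : K) :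
    IsBoundedUnder (· ≤ ·) atTop (fun t : ℝ ↦ 1 / t * f t x) := by
  obtain ⟨C, hC⟩ := h.exists_abs_div_le
  exact ⟨C, eventually_map.2 <| (eventually_ge_atTop 1).mono fun t ht ↦
    (abs_le.1 (hC x t ht)).2⟩

lemma isBoundedUnder_ge (h : IsGrowthCocycle ψ f) (x : K) :
    IsBoundedUnder (· ≥ ·) atTop (fun t : ℝ ↦ 1 / t * f t x) := by
  obtain ⟨C, hC⟩ := h.exists_abs_div_le
  exact ⟨-C, eventually_map.2 <| (eventually_ge_atTop 1).mono fun t ht ↦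
    (abs_le.1 (hC x t ht)).1⟩

/-- Rounding a good real time up to the next integer adds at most a bounded amount to the cocycle,
by subadditivity, hence nothing to its mean. -/
lemma lowerRate_le_liminf (hψ : IsSemiflow ψ) (h : IsGrowthCocycle ψ f) (x : K) :
    lowerRate (fun n : ℕ ↦ f n) x ≤ liminf (fun t : ℝ ↦ 1 / t * f t x) atTop := by
  obtain ⟨C, hC⟩ := h.isSubadditiveOver hψ
  obtain ⟨D, hD0, hD⟩ := h.exists_bound 1
  set ℓ := liminf (fun t : ℝ ↦ 1 / t * f t x) atTop with hℓ
  refine le_of_forall_pos_le_add fun ε hε ↦ ?_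
  have hfr : ∃ᶠ t : ℝ in atTop, 1 / t * f t x < ℓ + ε / 2 :=
    frequently_lt_of_liminf_lt (h.isBoundedUnder_le x).isCoboundedUnder_ge
      (by linarith)
  refine liminf_le_of_frequently_le ?_ (hC.isBoundedUnder_ge x)
  rw [frequently_atTop] at hfr ⊢
  intro N
  obtain ⟨t, ht, hlt⟩ := hfr (max (max N 1) ((|ℓ + ε / 2| + D) / (ε / 2)))
  have ht1 : 1 ≤ t := ((le_max_right _ _).trans (le_max_left _ _)).trans ht
  have htN : (N : ℝ) ≤ t := ((le_max_left _ _).trans (le_max_left _ _)).trans ht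
  have hte := (le_max_right _ _).trans ht
  rw [div_le_iff₀ (by positivity)] at hte
  have ht0 : 0 < t := by linarith
  have h1 := Nat.le_ceil t
  have h2 := (Nat.ceil_lt_add_one ht0.le).le
  refine ⟨⌈t⌉₊, by exact_mod_cast htN.trans h1, ?_⟩
  have hn0 : (0 : ℝ) < ⌈t⌉₊ := by linarith
  rw [div_le_iff₀ hn0]
  rw [one_div, inv_mul_lt_iff₀ ht0] at hlt
  have h3 := h.add_le (⌈t⌉₊ - t) t (by linarith) ht0.le x
  rw [sub_add_cancel] at h3
  have h4 := (abs_le.1 (hD (⌈t⌉₊ - t) ⟨by linarith, by linarith⟩ (ψ t x))).2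
  have h5 : t * (ℓ + ε / 2) ≤ ⌈t⌉₊ * (ℓ + ε / 2) + |ℓ + ε / 2| := by
    have h6 := neg_abs_le (ℓ + ε / 2)
    have h7 := abs_nonneg (ℓ + ε / 2)
    nlinarith
  nlinarith

variable [T2Space K] [TopologicalSpace.MetrizableSpace K] [MeasurableSpace K] [BorelSpace K]

/-- If this failed, one invariant measure would give all the sums nonnegative integrals, while the
subadditive ergodic bound at this measure makes one of the integrals negative. -/
lemma exists_forall_neg (hψ : IsSemiflow ψ) (hf : IsGrowthCocycle ψ f) (hg : IsGrowthCocycle ψ g)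
    {η : ℝ} (hη : η < 0)
    (H : ∀ ν : Measure K, IsProbabilityMeasure ν → (∀ t, 0 ≤ t → ν.map (ψ t) = ν) → ∀ᵐ x ∂ν,
      liminf (fun t : ℝ ↦ 1 / t * f t x) atTop + liminf (fun t : ℝ ↦ 1 / t * g t x) atTop ≤ η) :
    ∃ n : ℕ, 1 ≤ n ∧ ∀ x, f n x + g n x < 0 := by
  by_contra! hcon
  have hfg := hf.toIsSubadditiveCocycle.add hg.toIsSubadditiveCocycle
  obtain ⟨ν, hν, hinv, hint⟩ := hfg.exists_invariant_integral_nonneg hψ hcon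
  obtain ⟨C, hC⟩ := hf.isSubadditiveOver hψ
  obtain ⟨C', hC'⟩ := hg.isSubadditiveOver hψ
  have mono : ∀ {a : ℕ → K → ℝ} {c d : ℝ}, c ≤ d → IsSubadditiveOver (ψ 1) a c →
      IsSubadditiveOver (ψ 1) a d := fun hcd h ↦
    ⟨h.zero, h.add_le, fun x ↦ (h.one_le x).trans hcd, fun n x ↦ (h.shift_le n x).trans
      (by linarith)⟩
  have hm : ∀ {u : ℝ → K → ℝ}, IsGrowthCocycle ψ u → ∀ n : ℕ, Measurable (u n) :=
    fun h n ↦ (h.continuous n.cast_nonneg).measurable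
  obtain ⟨L, hL, hle⟩ := (mono (le_max_left C C') hC).exists_integral_le
    (mono (le_max_right C C') hC') (hm hf) (hm hg) ν
    ⟨(hψ.continuous zero_le_one).measurable, hinv 1 zero_le_one⟩ (η := η) (by
      filter_upwards [H ν hν hinv] with x hx
      exact (add_le_add (hf.lowerRate_le_liminf hψ x) (hg.lowerRate_le_liminf hψ x)).trans hx)
    -- This leaves the bound `L * (η / 2)`, which is negative because `L ≥ 1`.
    (δ := -η / 2) (by linarith)
  have h1 := (hint L hL).trans hle
  have h2 : (1 : ℝ) ≤ L := by exact_mod_cast hL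
  nlinarith

/-- If the sum of the lower growth rates of two cocycles is negative almost everywhere, uniformly
in the invariant measure, then the sum of the cocycles decays uniformly. -/
theorem exists_decay (hψ : IsSemiflow ψ) (hf : IsGrowthCocycle ψ f) (hg : IsGrowthCocycle ψ g)
    {η : ℝ} (hη : η < 0)
    (H : ∀ ν : Measure K, IsProbabilityMeasure ν → (∀ t, 0 ≤ t → ν.map (ψ t) = ν) → ∀ᵐ x ∂ν,
      liminf (fun t : ℝ ↦ 1 / t * f t x) atTop + liminf (fun t : ℝ ↦ 1 / t * g t x) atTop ≤ η) :
    ∃ D : ℝ, ∃ lam > 0, ∀ x, ∀ t : ℝ, 0 ≤ t → f t x + g t x ≤ D - lam * t := by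
  obtain ⟨n, hn, hneg⟩ := hf.exists_forall_neg hψ hg hη H
  have hfg := hf.toIsSubadditiveCocycle.add hg.toIsSubadditiveCocycle
  have hn0 : (0 : ℝ) < n := by exact_mod_cast hn
  obtain ⟨δ, hδ, hle⟩ : ∃ δ > 0, ∀ x, f n x + g n x ≤ -δ := by
    rcases isEmpty_or_nonempty K with hK | hK
    · exact ⟨1, one_pos, fun x ↦ (hK.false x).elim⟩
    · obtain ⟨x₀, hx₀⟩ := (hfg.continuous hn0.le).exists_forall_ge_of_hasCompactSupport
        (HasCompactSupport.of_compactSpace _)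
      exact ⟨-(f n x₀ + g n x₀), by linarith [hneg x₀], fun x ↦ by simpa using hx₀ x⟩
  obtain ⟨D, hD0, hD⟩ := hfg.exists_bound n
  -- Write `t` as `q * n` plus a remainder below `n`: each full block contributes at most `-δ`, the
  -- remainder is bounded through `D`, and rounding `t / n` down costs at most one `δ`.
  refine ⟨2 * D + δ, δ / n, by positivity, fun x t ht ↦ ?_⟩
  have h1 := Nat.floor_le (div_nonneg ht hn0.le)
  have h2 := Nat.lt_floor_add_one (t / n)
  set q := ⌊t / n⌋₊
  rw [le_div_iff₀ hn0] at h1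
  rw [div_lt_iff₀ hn0] at h2
  have h3 := hfg.add_le (t - q * n) (q * n) (by linarith) (by positivity) x
  have h4 := hfg.le_sum hn0.le q x
  have h5 := Finset.sum_le_card_nsmul (Finset.range q)
    (fun i ↦ f n (ψ (i * n) x) + g n (ψ (i * n) x)) (-δ) fun i _ ↦ hle _
  have h6 := (abs_le.1 (hD (t - q * n) ⟨by linarith, by linarith⟩ (ψ (q * n) x))).2
  rw [Finset.card_range, nsmul_eq_mul] at h5
  simp only [sub_add_cancel, hf.zero, hg.zero] at h3 h4
  have h7 : δ / n * t ≤ δ * (q + 1) := by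
    rw [div_mul_eq_mul_div, div_le_iff₀ hn0]
    nlinarith
  linarith

end IsGrowthCocycle

/-! ### Bases adapted to a splitting and exterior powers -/

section AdaptedBasis

open Module exteriorPower

variable {V : Type*} [AddCommGroup V] [Module ℝ V] {E F : Submodule ℝ V}

/-- The basis `b` consists of vectors of `E` (the indices in `P`) and of `F` (the others). -/
structure IsAdaptedBasis {I : Type*} (b : Basis I ℝ V) (P : I → Prop) (E F : Submodule ℝ V) :
    Prop where
  mem_fst : ∀ i, P i → b i ∈ E
  mem_snd : ∀ i, ¬ P i → b i ∈ F

/-- The lexicographic sum supplies the linear order on indices that the induced basis of the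
exterior power requires. -/
lemma exists_isAdaptedBasis {d k : ℕ} {s : Fin d → V} {r : Fin k → V} (hEF : IsCompl E F)
    (hs : LinearIndependent ℝ s) (hsE : Submodule.span ℝ (range s) = E)
    (hr : LinearIndependent ℝ r) (hrF : Submodule.span ℝ (range r) = F) :
    ∃ b : Basis (Fin d ⊕ₗ Fin k) ℝ V, (∀ i, b (Sum.inlₗ i) = s i) ∧ (∀ j, b (Sum.inrₗ j) = r j) := by
  have hli : LinearIndependent ℝ (Sum.elim s r) := hs.sum_type hr (by
    rw [hsE, hrF]; exact hEF.disjoint)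
  have hsp : ⊤ ≤ Submodule.span ℝ (range (Sum.elim s r)) := by
    rw [Sum.elim_range, Submodule.span_union, hsE, hrF, hEF.sup_eq_top]
  exact ⟨(Basis.mk hli hsp).reindex toLex, fun i ↦ by simp [Sum.inlₗ], fun j ↦ by simp [Sum.inrₗ]⟩

namespace IsAdaptedBasis

variable {I : Type*} {b : Basis I ℝ V} {P : I → Prop}

lemma symm (h : IsAdaptedBasis b P E F) : IsAdaptedBasis b (fun i ↦ ¬ P i) F E :=
  ⟨fun i hi ↦ h.mem_snd i hi, fun i hi ↦ h.mem_fst i (not_not.1 hi)⟩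

lemma coord_eq_zero [Fintype I] (h : IsAdaptedBasis b P E F) (hEF : Disjoint E F) {v : V}
    (hv : v ∈ E) {i : I} (hi : ¬ P i) : b.coord i v = 0 := by
  classical
  have h1 : ∑ j with P j, b.repr v j • b j ∈ E :=
    Submodule.sum_mem _ fun j hj ↦ E.smul_mem _ (h.mem_fst j (Finset.mem_filter.1 hj).2)
  have h2 : ∑ j with ¬ P j, b.repr v j • b j ∈ F :=
    Submodule.sum_mem _ fun j hj ↦ F.smul_mem _ (h.mem_snd j (Finset.mem_filter.1 hj).2)
  have h3 := b.sum_repr v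
  rw [← Finset.sum_filter_add_sum_filter_not _ P] at h3
  have h4 : ∑ j with ¬ P j, b.repr v j • b j = 0 := by
    refine Submodule.disjoint_def.1 hEF _ ?_ h2
    rw [← eq_sub_iff_add_eq'] at h3
    rw [h3]
    exact E.sub_mem hv h1
  exact linearIndependent_iff'.1 b.linearIndependent _ _ h4 i (by simp [hi])

variable [Fintype I] [LinearOrder I]

/-- Coordinates of a product of vectors are minors of their coordinate matrix. If all vectors lie in
`F` and `S` contains an index of `E`, the minor has a zero column. -/
lemma extF_eq (h : IsAdaptedBasis b P E F) (hEF : Disjoint E F) (k : ℕ) :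
    extF k F = Submodule.span ℝ (b.exteriorPower k '' {S | ∀ i ∈ S, ¬ P i}) := by
  apply le_antisymm
  · refine Submodule.span_le.2 ?_
    rintro _ ⟨v, hv, rfl⟩
    rw [SetLike.mem_coe, Basis.mem_span_image]
    intro S hS i hi hP
    rw [Finset.mem_coe, Finsupp.mem_support_iff, basis_repr_apply, ιMultiDual_apply_ιMulti] at hS
    obtain ⟨j, rfl⟩ := (powersetCard.mem_range_ofFinEmbEquiv_symm_iff_mem S i).2 hi
    refine hS (Matrix.det_eq_zero_of_column_eq_zero j fun l ↦ ?_)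
    exact h.symm.coord_eq_zero hEF.symm (hv l) (not_not.2 hP)
  · refine Submodule.span_le.2 ?_
    rintro _ ⟨S, hS, rfl⟩
    refine Submodule.subset_span ⟨_, fun i ↦ ?_, (basis_apply ℝ k b S).symm⟩
    exact h.mem_snd _ (hS _ ((powersetCard.mem_range_ofFinEmbEquiv_symm_iff_mem S _).1 ⟨i, rfl⟩))

/-- Dually to `extF_eq`, a factor in `E` gives a zero row in every minor that uses only indices of
`F`. -/
lemma extE_eq (h : IsAdaptedBasis b P E F) (hEF : Disjoint E F) (k : ℕ) :
    extE k E F = Submodule.span ℝ (b.exteriorPower k '' {S | ∀ i ∈ S, ¬ P i}ᶜ) := by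
  apply le_antisymm
  · refine Submodule.span_le.2 ?_
    rintro _ ⟨v, -, ⟨i, hi⟩, rfl⟩
    rw [SetLike.mem_coe, Basis.mem_span_image]
    intro S hS hP
    rw [Finset.mem_coe, Finsupp.mem_support_iff, basis_repr_apply, ιMultiDual_apply_ιMulti] at hS
    refine hS (Matrix.det_eq_zero_of_row_eq_zero i fun l ↦ ?_)
    exact h.coord_eq_zero hEF hi
      (hP _ ((powersetCard.mem_range_ofFinEmbEquiv_symm_iff_mem S _).1 ⟨l, rfl⟩))
  · refine Submodule.span_le.2 ?_
    rintro _ ⟨S, hS, rfl⟩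
    simp only [mem_compl_iff, mem_ofPred_eq, not_forall, not_not] at hS
    obtain ⟨i, hi, hP⟩ := hS
    obtain ⟨j, rfl⟩ := (powersetCard.mem_range_ofFinEmbEquiv_symm_iff_mem S i).2 hi
    refine Submodule.subset_span ⟨_, fun i ↦ ?_, ⟨j, h.mem_fst _ hP⟩, (basis_apply ℝ k b S).symm⟩
    by_cases hPi : P (powersetCard.ofFinEmbEquiv.symm S i)
    · exact Or.inl (h.mem_fst _ hPi)
    · exact Or.inr (h.mem_snd _ hPi)

lemma isCompl_ext (h : IsAdaptedBasis b P E F) (hEF : Disjoint E F) (k : ℕ) :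
    IsCompl (extE k E F) (extF k F) := by
  rw [h.extE_eq hEF, h.extF_eq hEF]
  refine ⟨(b.exteriorPower k).linearIndependent.disjoint_span_image disjoint_compl_left, ?_⟩
  rw [codisjoint_iff, ← Submodule.span_union, ← image_union, compl_union_self, image_univ,
    Basis.span_eq]

end IsAdaptedBasis

/-- An alternating map with as many arguments as the dimension is determined by its value on a
basis. This is what makes ∧^k F a line. -/
lemma AlternatingMap.eq_det_smul {ι V W : Type*} [Fintype ι] [DecidableEq ι] [AddCommGroup V]
    [Module ℝ V] [AddCommGroup W] [Module ℝ W] (e : Basis ι ℝ V) (f : V [⋀^ι]→ₗ[ℝ] W) (v : ι → V) :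
    f v = e.det v • f e := by
  suffices f = ((LinearMap.id : ℝ →ₗ[ℝ] ℝ).smulRight (f e)).compAlternatingMap e.det by
    conv_lhs => rw [this]
    simp
  refine Basis.ext_alternating e fun σ hσ ↦ ?_
  let τ : Equiv.Perm ι := Equiv.ofBijective σ (Finite.injective_iff_bijective.1 hσ)
  have h1 : (fun i ↦ e (σ i)) = e ∘ τ := rfl
  rw [h1, AlternatingMap.map_perm]
  simp only [LinearMap.compAlternatingMap_apply, AlternatingMap.map_perm, e.det_self,
    LinearMap.smulRight_apply, LinearMap.id_apply]
  rcases Int.units_eq_one_or (Equiv.Perm.sign τ) with h | h <;> simp [h]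

lemma extF_eq_span_singleton {k : ℕ} {r : Fin k → V} (hr : LinearIndependent ℝ r)
    (hrF : Submodule.span ℝ (range r) = F) : extF k F = Submodule.span ℝ {ιMulti ℝ k r} := by
  subst hrF
  apply le_antisymm
  · refine Submodule.span_le.2 ?_
    rintro _ ⟨v, hv, rfl⟩
    have := AlternatingMap.eq_det_smul (Basis.span hr)
      ((ιMulti ℝ k (M := V)).compLinearMap (Submodule.subtype _)) fun i ↦ ⟨v i, hv i⟩
    have h2 : ((Submodule.span ℝ (range r)).subtype ∘ fun i ↦ Basis.span hr i) = r := by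
      ext i; simp [Basis.span_apply]
    simp only [AlternatingMap.compLinearMap_apply, Submodule.subtype_apply, Basis.span_apply]
      at this
    rw [SetLike.mem_coe, this]
    exact Submodule.smul_mem _ _ (Submodule.mem_span_singleton_self _)
  · rw [Submodule.span_singleton_le_iff_mem]
    exact Submodule.subset_span ⟨r, fun i ↦ Submodule.subset_span ⟨i, rfl⟩, rfl⟩

variable {W : Type*} [AddCommGroup W] [Module ℝ W] (A : V →ₗ[ℝ] W) (k : ℕ)

lemma map_extF (F : Submodule ℝ V) :
    (extF k F).map (exteriorPower.map k A) = extF k (F.map A) := by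
  rw [extF, Submodule.map_span, extF]
  congr 1
  ext w
  constructor
  · rintro ⟨_, ⟨v, hv, rfl⟩, rfl⟩
    exact ⟨A ∘ v, fun i ↦ ⟨v i, hv i, rfl⟩, (map_apply_ιMulti A v).symm⟩
  · rintro ⟨w, hw, rfl⟩
    choose v hv hvw using hw
    refine ⟨_, ⟨v, hv, rfl⟩, ?_⟩
    rw [map_apply_ιMulti]
    congr 1
    exact funext hvw

lemma map_extE (E F : Submodule ℝ V) :
    (extE k E F).map (exteriorPower.map k A) = extE k (E.map A) (F.map A) := by
  rw [extE, Submodule.map_span, extE]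
  congr 1
  ext w
  constructor
  · rintro ⟨_, ⟨v, hv, ⟨i, hi⟩, rfl⟩, rfl⟩
    exact ⟨A ∘ v, fun i ↦ (hv i).imp (fun h ↦ ⟨v i, h, rfl⟩) (fun h ↦ ⟨v i, h, rfl⟩),
      ⟨i, v i, hi, rfl⟩, (map_apply_ιMulti A v).symm⟩
  · rintro ⟨w, hw, ⟨i, hi⟩, rfl⟩
    -- Preimages are chosen in `E` whenever possible, so that the distinguished factor keeps its
    -- preimage in `E`.
    have : ∀ i, ∃ v, (v ∈ E ∨ v ∈ F) ∧ (w i ∈ E.map A → v ∈ E) ∧ A v = w i := by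
      intro i
      by_cases h : w i ∈ E.map A
      · obtain ⟨v, hv, hvw⟩ := h
        exact ⟨v, Or.inl hv, fun _ ↦ hv, hvw⟩
      · obtain ⟨v, hv, hvw⟩ := (hw i).resolve_left h
        exact ⟨v, Or.inr hv, fun h' ↦ (h h').elim, hvw⟩
    choose v hv hvE hvw using this
    refine ⟨_, ⟨v, hv, ⟨i, hvE i hi⟩, rfl⟩, ?_⟩
    rw [map_apply_ιMulti]
    congr 1
    exact funext hvw

end AdaptedBasis

/-! ### Norms of exterior products -/

section ExteriorNorm

open Module exteriorPower
open scoped RealInnerProductSpace Nat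

variable {V : Type*} [NormedAddCommGroup V] [InnerProductSpace ℝ V] [FiniteDimensional ℝ V]
  {W : Type*} [NormedAddCommGroup W] [InnerProductSpace ℝ W] [FiniteDimensional ℝ W]
  {U : Type*} [NormedAddCommGroup U] [InnerProductSpace ℝ U] [FiniteDimensional ℝ U]
  {k : ℕ}

/-- Leibniz expansion of the Gram determinant, with Cauchy–Schwarz for each entry; the crude
constant is harmless. -/
lemma norm_ιMulti_le (v : Fin k → V) : ‖ιMulti ℝ k v‖ ≤ k ! * ∏ i, ‖v i‖ := by
  have hP : 0 ≤ ∏ i, ‖v i‖ := Finset.prod_nonneg fun i _ ↦ norm_nonneg _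
  have h1 : ‖ιMulti ℝ k v‖ ^ 2 ≤ k ! * (∏ i, ‖v i‖) ^ 2 := by
    rw [← real_inner_self_eq_norm_sq, inner_ιMulti_self, Matrix.det_apply]
    calc _ ≤ ∑ σ : Equiv.Perm (Fin k), (∏ i, ‖v i‖) ^ 2 := by
          refine Finset.sum_le_sum fun σ _ ↦ (le_abs_self _).trans ?_
          have : |Equiv.Perm.sign σ • ∏ i, Matrix.gram ℝ v (σ i) i| =
              |∏ i, Matrix.gram ℝ v (σ i) i| := by
            rcases Int.units_eq_one_or (Equiv.Perm.sign σ) with h | h <;> simp [h]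
          rw [this, Finset.abs_prod]
          calc _ ≤ ∏ i, (‖v (σ i)‖ * ‖v i‖) :=
                Finset.prod_le_prod (fun _ _ ↦ abs_nonneg _) fun i _ ↦ abs_real_inner_le_norm _ _
            _ = _ := by
              rw [Finset.prod_mul_distrib, Equiv.prod_comp σ fun i ↦ ‖v i‖, sq]
      _ = _ := by simp [Fintype.card_perm]
  have h2 : (1 : ℝ) ≤ k ! := by exact_mod_cast k.factorial_pos
  refine (pow_le_pow_iff_left₀ (norm_nonneg _) (by positivity) two_ne_zero).1 (h1.trans ?_)
  rw [mul_pow]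
  gcongr
  nlinarith

lemma norm_ιMulti_of_orthogonal {v : Fin k → V} (hv : Pairwise fun i j ↦ ⟪v i, v j⟫ = 0) :
    ‖ιMulti ℝ k v‖ = ∏ i, ‖v i‖ := by
  rw [← sq_eq_sq₀ (norm_nonneg _) (Finset.prod_nonneg fun i _ ↦ norm_nonneg _),
    ← real_inner_self_eq_norm_sq, inner_ιMulti_self, ← Finset.prod_pow]
  have : Matrix.gram ℝ v = Matrix.diagonal fun i ↦ ‖v i‖ ^ 2 := by
    ext i j
    rcases eq_or_ne i j with rfl | hij
    · simp [Matrix.gram]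
    · simp [Matrix.gram, hij, hv hij]
  rw [this, Matrix.det_diagonal]

/-- The singular basis of the restriction of `A` to `F`. -/
lemma exists_orthonormal_map_orthogonal (A : V →ₗ[ℝ] W) {F : Submodule ℝ V}
    (hF : finrank ℝ F = k) : ∃ f : Fin k → V, Orthonormal ℝ f ∧
      Submodule.span ℝ (range f) = F ∧ Pairwise fun i j ↦ ⟪A (f i), A (f j)⟫ = 0 := by
  let B : F →ₗ[ℝ] W := A ∘ₗ F.subtype
  have hT : (B.adjoint ∘ₗ B).IsSymmetric := fun x y ↦ by
    simp [LinearMap.adjoint_inner_left, LinearMap.adjoint_inner_right]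
  let u := hT.eigenvectorBasis hF
  refine ⟨fun i ↦ u i, ?_, ?_, fun i j hij ↦ ?_⟩
  · exact u.orthonormal.comp_linearIsometry F.subtypeₗᵢ
  · have : range (fun i ↦ (u i : V)) = F.subtype '' range u := by
      rw [← range_comp]; rfl
    rw [this, ← Submodule.map_span, ← u.coe_toBasis, Basis.span_eq, Submodule.map_subtype_top]
  -- The `u i` are orthonormal eigenvectors of B*B, and ⟪B u_i, B u_j⟫ = ⟪B*B u_i, u_j⟫.
  · change ⟪B (u i), B (u j)⟫ = 0
    have h1 := hT.apply_eigenvectorBasis hF i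
    have h2 : ⟪B (u i), B (u j)⟫ = ⟪(B.adjoint ∘ₗ B) (u i), u j⟫ :=
      (LinearMap.adjoint_inner_left B _ _).symm
    rw [h2, h1, inner_smul_left, u.orthonormal.2 hij, mul_zero]

/-- Each coordinate functional on the exterior power is the inner product with the exterior product
of the Riesz vectors of the coordinate functionals on `V`. -/
lemma abs_repr_exteriorPower_le {I : Type*} [Fintype I] [LinearOrder I] (b : Basis I ℝ V) {c : ℝ}
    (hc : ∀ i v, |b.coord i v| ≤ c * ‖v‖) (hc0 : 0 ≤ c) (S : powersetCard I k) (w : ⋀[ℝ]^k V) :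
    |(b.exteriorPower k).repr w S| ≤ k ! * c ^ k * ‖w‖ := by
  let bd : I → V := fun i ↦ (InnerProductSpace.toDual ℝ V).symm (b.coord i).toContinuousLinearMap
  have hbd : ∀ i v, ⟪bd i, v⟫ = b.coord i v := fun i v ↦ by
    simp only [bd, InnerProductSpace.toDual_symm_apply, LinearMap.coe_toContinuousLinearMap']
  have hbdn : ∀ i, ‖bd i‖ ≤ c := fun i ↦ by
    simp only [bd, LinearIsometryEquiv.norm_map]
    exact ContinuousLinearMap.opNorm_le_bound _ hc0 fun v ↦ hc i v
  let s := powersetCard.ofFinEmbEquiv.symm S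
  have h1 : (b.exteriorPower k).repr w S = ⟪ιMulti ℝ k fun i ↦ bd (s i), w⟫ := by
    rw [basis_repr_apply]
    change _ = innerₗ _ (ιMulti ℝ k fun i ↦ bd (s i)) w
    congr 1
    apply exteriorPower.linearMap_ext
    ext v
    simp only [LinearMap.compAlternatingMap_apply, ιMultiDual_apply_ιMulti, innerₗ_apply_apply,
      inner_ιMulti_ιMulti, hbd]
    rfl
  rw [h1]
  refine (abs_real_inner_le_norm _ _).trans ?_
  gcongr
  refine (norm_ιMulti_le _).trans ?_
  gcongr
  refine (Finset.prod_le_prod (fun i _ ↦ norm_nonneg _) fun i _ ↦ hbdn (s i)).trans ?_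
  simp

end ExteriorNorm

/-! ### Domination on exterior powers of one linear map -/

section ExteriorDomination

open Module exteriorPower
open scoped RealInnerProductSpace Nat

variable {V : Type*} [NormedAddCommGroup V] [InnerProductSpace ℝ V] [FiniteDimensional ℝ V]
  {W : Type*} [NormedAddCommGroup W] [InnerProductSpace ℝ W] [FiniteDimensional ℝ W]
  {U : Type*} [NormedAddCommGroup U] [InnerProductSpace ℝ U] [FiniteDimensional ℝ U]
  {k : ℕ}

/-- The norms of the two projections of the splitting `E ⊕ F` are at most `c`. -/
def IsSplittingBound {V : Type*} [NormedAddCommGroup V] [NormedSpace ℝ V] (E F : Submodule ℝ V)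
    (c : ℝ) : Prop :=
  ∀ v ∈ E, ∀ w ∈ F, ‖v‖ ≤ c * ‖v + w‖ ∧ ‖w‖ ≤ c * ‖v + w‖

lemma exists_eq_inrₗ {α β : Type*} {i : α ⊕ₗ β} (h : ¬ ∃ j, i = Sum.inlₗ j) :
    ∃ j, i = Sum.inrₗ j := by
  obtain ⟨i, rfl⟩ := toLex.surjective i
  rcases i with j | j
  · exact (h ⟨j, rfl⟩).elim
  · exact ⟨j, rfl⟩

lemma inlₗ_injective {α β : Type*} : Function.Injective fun j : α ↦ (Sum.inlₗ j : α ⊕ₗ β) :=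
  fun _ _ h ↦ Sum.inl_injective (toLex.injective h)

lemma inrₗ_injective {α β : Type*} : Function.Injective fun j : β ↦ (Sum.inrₗ j : α ⊕ₗ β) :=
  fun _ _ h ↦ Sum.inr_injective (toLex.injective h)

omit [FiniteDimensional ℝ V] in
lemma coord_eq_inner {I J : Type*} {b : Basis I ℝ V} {u : J → V} (hu : Orthonormal ℝ u)
    {ι : J → I} (hι : Function.Injective ι) (hb : ∀ j, b (ι j) = u j) {v : V}
    (hv : v ∈ Submodule.span ℝ (range u)) (j : J) : b.coord (ι j) v = ⟪u j, v⟫ := by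
  classical
  induction hv using Submodule.span_induction with
  | mem x hx =>
    obtain ⟨l, rfl⟩ := hx
    rw [orthonormal_iff_ite.1 hu, ← hb l, Basis.coord_apply, Basis.repr_self,
      Finsupp.single_apply]
    simp [hι.eq_iff, eq_comm]
  | zero => simp
  | add x y _ _ hx hy => rw [map_add, hx, hy, inner_add_right]
  | smul a x _ hx => rw [map_smul, hx, inner_smul_right, smul_eq_mul]

/-- If `S` has `p ≥ 1` indices in `P`, exactly `p` indices outside `P` are missing from it. Trading
each factor at most `κ * m` against a missing factor at least `m` gains `κ ^ p`, and all but one of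
these `κ` are bounded by `M`. -/
lemma prod_le_of_mem {I : Type*} [Fintype I] {P : I → Prop} [DecidablePred P] {g : I → ℝ}
    {S : Finset I} {m κ M : ℝ} (hm : 0 < m) (hκ : 0 ≤ κ) (hκM : κ ≤ M) (hM : 1 ≤ M)
    (hg : ∀ i, 0 ≤ g i) (hgP : ∀ i, P i → g i ≤ κ * m) (hgF : ∀ i, ¬ P i → m ≤ g i)
    (hS : S.card = k) (hk : (Finset.univ.filter fun i ↦ ¬ P i).card = k) (hSP : ∃ i ∈ S, P i) :
    ∏ i ∈ S, g i ≤ κ * M ^ k * ∏ i with ¬ P i, g i := by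
  classical
  set R := Finset.univ.filter fun i ↦ ¬ P i with hR
  set p := (S.filter P).card with hp
  have hsub : S.filter (fun i ↦ ¬ P i) ⊆ R := Finset.filter_subset_filter _ (Finset.subset_univ _)
  have hcard : (R \ S.filter (fun i ↦ ¬ P i)).card = p := by
    rw [Finset.card_sdiff_of_subset hsub, hk, ← hS, hp]
    have := S.card_filter_add_card_filter_not P
    omega
  have hp1 : 1 ≤ p := by
    obtain ⟨i, hi, hPi⟩ := hSP
    exact Finset.card_pos.2 ⟨i, Finset.mem_filter.2 ⟨hi, hPi⟩⟩
  have hpk : p ≤ k := hS ▸ Finset.card_filter_le _ _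
  have h1 : ∏ i ∈ S with P i, g i ≤ (κ * m) ^ p :=
    (Finset.prod_le_prod (fun i _ ↦ hg i) fun i hi ↦ hgP i (Finset.mem_filter.1 hi).2).trans
      (by simp [hp])
  have h2 : m ^ p ≤ ∏ i ∈ R \ S.filter (fun i ↦ ¬ P i), g i := by
    rw [← hcard, ← Finset.prod_const]
    refine Finset.prod_le_prod (fun _ _ ↦ hm.le) fun i hi ↦ hgF i ?_
    exact (Finset.mem_filter.1 (Finset.mem_sdiff.1 hi).1).2
  have h3 : κ ^ p ≤ κ * M ^ k := by
    obtain ⟨q, hq⟩ := Nat.exists_eq_add_of_le hp1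
    rw [hq, pow_add, pow_one]
    refine mul_le_mul_of_nonneg_left ?_ hκ
    calc κ ^ q ≤ M ^ q := pow_le_pow_left₀ hκ hκM _
      _ ≤ M ^ k := pow_le_pow_right₀ hM (by omega)
  have h0 : 0 ≤ ∏ i ∈ S with ¬ P i, g i := Finset.prod_nonneg fun i _ ↦ hg i
  have hM0 : 0 ≤ M := by linarith
  rw [← Finset.prod_filter_mul_prod_filter_not S P, ← Finset.prod_sdiff hsub, ← mul_assoc]
  refine mul_le_mul_of_nonneg_right ?_ h0
  calc _ ≤ (κ * m) ^ p := h1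
    _ = κ ^ p * m ^ p := mul_pow _ _ _
    _ ≤ _ := by gcongr

/-- The operator `∧^k A`. -/
noncomputable def extMap (k : ℕ) (A : V →L[ℝ] W) : ⋀[ℝ]^k V →L[ℝ] ⋀[ℝ]^k W :=
  LinearMap.toContinuousLinearMap (exteriorPower.map k A.toLinearMap)

lemma extMap_ιMulti (A : V →L[ℝ] W) (v : Fin k → V) :
    extMap k A (ιMulti ℝ k v) = ιMulti ℝ k fun i ↦ A (v i) := by
  simp [extMap]
  rfl

lemma restrictNorm_le {V W : Type*} [NormedAddCommGroup V] [NormedSpace ℝ V]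
    [NormedAddCommGroup W] [NormedSpace ℝ W] (L : V →L[ℝ] W) (S : Submodule ℝ V) {C : ℝ}
    (hC : 0 ≤ C) (h : ∀ v ∈ S, ‖L v‖ ≤ C * ‖v‖) : restrictNorm L S ≤ C :=
  ContinuousLinearMap.opNorm_le_bound _ hC fun v ↦ h v v.2

lemma le_restrictNorm {V W : Type*} [NormedAddCommGroup V] [NormedSpace ℝ V]
    [NormedAddCommGroup W] [NormedSpace ℝ W] (L : V →L[ℝ] W) (S : Submodule ℝ V) {v : V}
    (hv : v ∈ S) : ‖L v‖ ≤ restrictNorm L S * ‖v‖ :=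
  (L.comp S.subtypeL).le_opNorm ⟨v, hv⟩

lemma restrictNorm_nonneg {V W : Type*} [NormedAddCommGroup V] [NormedSpace ℝ V]
    [NormedAddCommGroup W] [NormedSpace ℝ W] (L : V →L[ℝ] W) (S : Submodule ℝ V) :
    0 ≤ restrictNorm L S :=
  norm_nonneg (L.comp S.subtypeL)

lemma norm_extMap_le {I : Type*} [Fintype I] [LinearOrder I] {b : Basis I ℝ V} {P : I → Prop}
    [DecidablePred P] {E F : Submodule ℝ V} (h : IsAdaptedBasis b P E F) (hEF : Disjoint E F)
    {c : ℝ} (hc : ∀ i v, |b.coord i v| ≤ c * ‖v‖) (hc0 : 0 ≤ c)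
    (A : V →L[ℝ] W) {m κ M : ℝ} (hm : 0 < m) (hκ : 0 ≤ κ) (hκM : κ ≤ M) (hM : 1 ≤ M)
    (hbP : ∀ i, P i → ‖A (b i)‖ ≤ κ * m) (hbF : ∀ i, ¬ P i → m ≤ ‖A (b i)‖)
    (hk : (Finset.univ.filter fun i ↦ ¬ P i).card = k) {w : ⋀[ℝ]^k V} (hw : w ∈ extE k E F) :
    ‖extMap k A w‖ ≤ Fintype.card (powersetCard I k) * (k ! * c ^ k * (k ! * (κ * M ^ k *
      ∏ i with ¬ P i, ‖A (b i)‖))) * ‖w‖ := by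
  have hD : 0 ≤ ∏ i with ¬ P i, ‖A (b i)‖ := Finset.prod_nonneg fun _ _ ↦ norm_nonneg _
  have hM0 : 0 ≤ M := by linarith
  rw [h.extE_eq hEF, Basis.mem_span_image] at hw
  conv_lhs => rw [← (b.exteriorPower k).sum_repr w, map_sum]
  refine (norm_sum_le _ _).trans ?_
  rw [← nsmul_eq_mul, smul_mul_assoc]
  refine Finset.sum_le_card_nsmul _ _ _ fun S _ ↦ ?_
  rw [map_smul, norm_smul, Real.norm_eq_abs]
  by_cases hS : (b.exteriorPower k).repr w S = 0
  · rw [hS, abs_zero, zero_mul]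
    positivity
  · have hS' : ∃ i ∈ (S : Finset I), P i := by
      have := hw (Finsupp.mem_support_iff.2 hS)
      simp only [mem_compl_iff, mem_ofPred_eq, not_forall, not_not] at this
      obtain ⟨i, hi, hP⟩ := this
      exact ⟨i, hi, hP⟩
    have h1 := abs_repr_exteriorPower_le b hc hc0 S w
    have h2 : ‖extMap k A (b.exteriorPower k S)‖ ≤
        k ! * (κ * M ^ k * ∏ i with ¬ P i, ‖A (b i)‖) := by
      rw [basis_apply, ιMulti_family, extMap_ιMulti]
      refine (norm_ιMulti_le _).trans ?_
      gcongr
      refine le_trans (le_of_eq ?_) (prod_le_of_mem hm hκ hκM hM (fun i ↦ norm_nonneg (A (b i)))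
        hbP hbF S.2 hk hS')
      have : (S : Finset I) = Finset.univ.map (powersetCard.ofFinEmbEquiv.symm S).toEmbedding := by
        ext i
        simp only [Finset.mem_map, Finset.mem_univ, true_and]
        exact (powersetCard.mem_range_ofFinEmbEquiv_symm_iff_mem S i).symm
      rw [this, Finset.prod_map]
      rfl
    calc _ ≤ (k ! * c ^ k * ‖w‖) * (k ! * (κ * M ^ k * ∏ i with ¬ P i, ‖A (b i)‖)) := by gcongr
      _ = _ := by ring

-- The basis is orthonormal inside `E` and inside `F`, so a coordinate of `v` is an inner product of
-- a unit vector with the projection of `v` to one summand.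
omit [FiniteDimensional ℝ V] in
lemma abs_coord_le {d : ℕ} {e : Fin d → V} {f : Fin k → V} {E F : Submodule ℝ V}
    (hEF : IsCompl E F) (he : Orthonormal ℝ e) (hf : Orthonormal ℝ f)
    (heE : Submodule.span ℝ (range e) = E) (hfF : Submodule.span ℝ (range f) = F)
    {b : Basis (Fin d ⊕ₗ Fin k) ℝ V} (hbe : ∀ i, b (Sum.inlₗ i) = e i)
    (hbf : ∀ i, b (Sum.inrₗ i) = f i) (hb : IsAdaptedBasis b (fun i ↦ ∃ j, i = Sum.inlₗ j) E F)
    {c : ℝ} (hc : IsSplittingBound E F c) (i : Fin d ⊕ₗ Fin k) (v : V) :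
    |b.coord i v| ≤ c * ‖v‖ := by
  obtain ⟨x, hx, y, hy, rfl⟩ : ∃ x ∈ E, ∃ y ∈ F, x + y = v :=
    Submodule.mem_sup.1 (hEF.sup_eq_top ▸ Submodule.mem_top)
  have hxy := hc x hx y hy
  rw [map_add]
  by_cases hP : ∃ j, i = Sum.inlₗ j
  · rw [hb.symm.coord_eq_zero hEF.symm.disjoint hy (not_not.2 hP), add_zero]
    obtain ⟨j, rfl⟩ := hP
    rw [coord_eq_inner (ι := fun j ↦ Sum.inlₗ j) he
      inlₗ_injective hbe (heE ▸ hx)]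
    refine (abs_real_inner_le_norm _ _).trans ?_
    rw [he.1, one_mul]
    exact hxy.1
  · rw [hb.coord_eq_zero hEF.disjoint hx hP, zero_add]
    obtain ⟨j, rfl⟩ := exists_eq_inrₗ hP
    rw [coord_eq_inner (ι := fun j ↦ Sum.inrₗ j) hf
      inrₗ_injective hbf (hfF ▸ hy)]
    refine (abs_real_inner_le_norm _ _).trans ?_
    rw [hf.1, one_mul]
    exact hxy.2

-- The exterior power of the image of `F` is a line, spanned by a vector whose norm is the product
-- of the singular values and which `B` sends to a unit vector. The isometry `J` plays the role of
-- the identity, since in the application the base point after going forth and back is only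
-- propositionally the original one.
omit [FiniteDimensional ℝ V] in
lemma restrictNorm_extMap_extF {A : V →L[ℝ] W} {B : W →L[ℝ] U} {J : V →ₗᵢ[ℝ] U}
    (hBA : ∀ v, B (A v) = J v) {f : Fin k → V} {F : Submodule ℝ V} (hf : Orthonormal ℝ f)
    (hfF : Submodule.span ℝ (range f) = F) (hAf : Pairwise fun i j ↦ ⟪A (f i), A (f j)⟫ = 0) :
    0 < ∏ i, ‖A (f i)‖ ∧
    restrictNorm (extMap k B) (extF k (F.map A.toLinearMap)) = (∏ i, ‖A (f i)‖)⁻¹ := by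
  have hinj : Function.Injective A := fun v w h ↦ J.injective (by rw [← hBA, ← hBA, h])
  have hAf0 : ∀ i, 0 < ‖A (f i)‖ := fun i ↦ norm_pos_iff.2 fun h ↦
    hf.ne_zero i (hinj (by rw [h, map_zero]))
  have hpos : 0 < ∏ i, ‖A (f i)‖ := Finset.prod_pos fun i _ ↦ hAf0 i
  refine ⟨hpos, ?_⟩
  have hspan : extF k (F.map A.toLinearMap) = Submodule.span ℝ {ιMulti ℝ k fun i ↦ A (f i)} := by
    refine extF_eq_span_singleton (hf.linearIndependent.map' A.toLinearMap
      (LinearMap.ker_eq_bot.2 hinj)) ?_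
    rw [← hfF, Submodule.map_span, ← range_comp]
    rfl
  have hn : ‖ιMulti ℝ k fun i ↦ A (f i)‖ = ∏ i, ‖A (f i)‖ := norm_ιMulti_of_orthogonal hAf
  have hn' : ‖extMap k B (ιMulti ℝ k fun i ↦ A (f i))‖ = 1 := by
    rw [extMap_ιMulti]
    simp only [hBA]
    rw [norm_ιMulti_of_orthogonal fun i j hij ↦ by simp [hf.2 hij]]
    simp [hf.1]
  apply le_antisymm
  · refine restrictNorm_le _ _ (by positivity) fun w hw ↦ ?_
    rw [hspan, Submodule.mem_span_singleton] at hw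
    obtain ⟨t, rfl⟩ := hw
    rw [map_smul, norm_smul, norm_smul, hn, hn', inv_mul_eq_div, mul_div_cancel_right₀ _ hpos.ne',
      mul_one]
  · have := le_restrictNorm (extMap k B) (extF k (F.map A.toLinearMap))
      (v := ιMulti ℝ k fun i ↦ A (f i)) (by rw [hspan]; exact Submodule.mem_span_singleton_self _)
    rwa [hn, hn', ← div_le_iff₀ hpos, one_div] at this

/-- If `A` expands `E` less than `F`, then `∧^k A` expands `extE k E F` less than `extF k F`. -/
theorem restrictNorm_extMap_mul_le {A : V →L[ℝ] W} {B : W →L[ℝ] U} {J : V →ₗᵢ[ℝ] U}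
    (hBA : ∀ v, B (A v) = J v) {E F : Submodule ℝ V} (hEF : IsCompl E F)
    (hF : finrank ℝ F = k) {c : ℝ} (hc : IsSplittingBound E F c) (hc0 : 0 ≤ c) {m κ M : ℝ}
    (hm : 0 < m) (hκ : 0 ≤ κ) (hκM : κ ≤ M) (hM : 1 ≤ M)
    (hAE : ∀ v ∈ E, ‖A v‖ ≤ κ * m * ‖v‖) (hAF : ∀ v ∈ F, m * ‖v‖ ≤ ‖A v‖) :
    restrictNorm (extMap k A) (extE k E F) *
        restrictNorm (extMap k B) (extF k (F.map A.toLinearMap)) ≤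
      ((finrank ℝ V).choose k * (k ! * c ^ k * (k ! * M ^ k))) * κ := by
  classical
  obtain ⟨f, hf, hfF, hAf⟩ := exists_orthonormal_map_orthogonal A.toLinearMap hF
  -- Applied to the zero map, this merely produces an orthonormal basis of `E`.
  obtain ⟨e, he, heE, -⟩ := exists_orthonormal_map_orthogonal (0 : V →ₗ[ℝ] V) (F := E) rfl
  obtain ⟨b, hbe, hbf⟩ := exists_isAdaptedBasis hEF he.linearIndependent heE
    hf.linearIndependent hfF
  have hb : IsAdaptedBasis b (fun i ↦ ∃ j, i = Sum.inlₗ j) E F := by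
    refine ⟨?_, fun i hi ↦ ?_⟩
    · rintro _ ⟨j, rfl⟩
      rw [hbe, ← heE]
      exact Submodule.subset_span ⟨j, rfl⟩
    · obtain ⟨j, rfl⟩ := exists_eq_inrₗ hi
      rw [hbf, ← hfF]
      exact Submodule.subset_span ⟨j, rfl⟩
  have hR : (Finset.univ.filter fun i : Fin (finrank ℝ E) ⊕ₗ Fin k ↦ ¬ ∃ j, i = Sum.inlₗ j) =
      Finset.univ.map ⟨fun j ↦ Sum.inrₗ j, inrₗ_injective⟩ := by
    ext i
    simp only [Finset.mem_filter, Finset.mem_univ, true_and, Finset.mem_map]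
    refine ⟨fun h ↦ (exists_eq_inrₗ h).imp fun _ ↦ Eq.symm, ?_⟩
    rintro ⟨j, rfl⟩ ⟨l, hl⟩
    exact Sum.inr_ne_inl (toLex.injective hl)
  obtain ⟨hpos, hBn⟩ := restrictNorm_extMap_extF hBA hf hfF hAf
  have hprod : ∏ i with ¬ (∃ j, i = Sum.inlₗ j), ‖A (b i)‖ = ∏ i, ‖A (f i)‖ := by
    rw [hR, Finset.prod_map]
    exact Finset.prod_congr rfl fun i _ ↦ congrArg (fun x ↦ ‖A x‖) (hbf i)
  have hM0 : 0 ≤ M := by linarith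
  have key : restrictNorm (extMap k A) (extE k E F) ≤
      Fintype.card (powersetCard (Fin (finrank ℝ E) ⊕ₗ Fin k) k) * (k ! * c ^ k * (k ! * (κ * M ^ k *
      ∏ i, ‖A (f i)‖))) := by
    refine restrictNorm_le _ _ (by positivity) fun w hw ↦ ?_
    rw [← hprod]
    refine norm_extMap_le hb hEF.disjoint (abs_coord_le hEF he hf heE hfF hbe hbf hb hc) hc0 A hm hκ
      hκM hM ?_ ?_ ?_ hw
    · rintro _ ⟨j, rfl⟩
      have := hAE _ (hb.mem_fst _ ⟨j, rfl⟩)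
      rwa [hbe, he.1, mul_one, ← hbe] at this
    · intro i hi
      have := hAF _ (hb.mem_snd i hi)
      obtain ⟨j, rfl⟩ := exists_eq_inrₗ hi
      rwa [hbf, hf.1, mul_one, ← hbf] at this
    · rw [hR]; simp
  have hcard : Fintype.card (powersetCard (Fin (finrank ℝ E) ⊕ₗ Fin k) k) =
      (finrank ℝ V).choose k := by
    rw [Fintype.card_eq_nat_card, powersetCard.card, finrank_eq_nat_card_basis b]
  rw [hcard] at key
  rw [hBn]
  refine (mul_le_mul_of_nonneg_right key (by positivity)).trans (le_of_eq ?_)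
  -- The product of the singular values cancels against its inverse, leaving a constant times `κ`.
  field_simp

/-- If `∧^k A` expands `extE k E F` less than `extF k F`, then `A` expands `E` less than `F`. -/
theorem norm_mul_norm_le_of_extMap {A : V →L[ℝ] W} {B : W →L[ℝ] U} {J : V →ₗᵢ[ℝ] U}
    (hBA : ∀ v, B (A v) = J v) {E F : Submodule ℝ V} (hk : 1 ≤ k)
    (hF : finrank ℝ F = k) {c : ℝ}
    (hc : IsSplittingBound (E.map A.toLinearMap) (F.map A.toLinearMap) c)
    {v w : V} (hv : v ∈ E) (hw : w ∈ F) :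
    ‖A v‖ * ‖w‖ ≤ c * k ! * (restrictNorm (extMap k A) (extE k E F) *
      restrictNorm (extMap k B) (extF k (F.map A.toLinearMap))) * (‖A w‖ * ‖v‖) := by
  classical
  obtain ⟨f, hf, hfF, hAf⟩ := exists_orthonormal_map_orthogonal A.toLinearMap hF
  obtain ⟨hpos, hBn⟩ := restrictNorm_extMap_extF hBA hf hfF hAf
  have hinj : Function.Injective A := fun v w h ↦ J.injective (by rw [← hBA, ← hBA, h])
  have hAf0 : ∀ i, 0 < ‖A (f i)‖ := fun i ↦ norm_pos_iff.2 fun h ↦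
    hf.ne_zero i (hinj (by rw [h, map_zero]))
  have hfm : ∀ i, f i ∈ F := fun i ↦ hfF ▸ Submodule.subset_span ⟨i, rfl⟩
  -- The vector `f j` realizes the co-norm of `A` on `F`; it is the factor that `v` will replace.
  obtain ⟨j, -, hj⟩ := Finset.exists_min_image (Finset.univ : Finset (Fin k)) (fun i ↦ ‖A (f i)‖)
    ⟨⟨0, hk⟩, Finset.mem_univ _⟩
  set N := restrictNorm (extMap k A) (extE k E F)
  -- the smallest singular value bounds `‖A w‖` from below
  have h1 : ‖A (f j)‖ * ‖w‖ ≤ ‖A w‖ := by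
    obtain ⟨t, rfl⟩ := (Submodule.mem_span_range_iff_exists_fun ℝ).1 (hfF ▸ hw)
    rw [← sq_le_sq₀ (by positivity) (by positivity), mul_pow]
    have e1 : ‖∑ i, t i • f i‖ ^ 2 = ∑ i, t i ^ 2 := by
      rw [← real_inner_self_eq_norm_sq, hf.inner_sum]
      simp [sq]
    have e2 : ‖A (∑ i, t i • f i)‖ ^ 2 = ∑ i, t i ^ 2 * ‖A (f i)‖ ^ 2 := by
      rw [← real_inner_self_eq_norm_sq, map_sum, sum_inner]
      refine Finset.sum_congr rfl fun i _ ↦ ?_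
      rw [inner_sum, Finset.sum_eq_single i]
      · rw [map_smul, inner_smul_left, inner_smul_right, real_inner_self_eq_norm_sq]
        simp; ring
      · intro l _ hl
        rw [map_smul, map_smul, inner_smul_left, inner_smul_right]
        have : ⟪A (f i), A (f l)⟫ = 0 := hAf hl.symm
        simp [this]
      · simp
    rw [e1, e2, Finset.mul_sum]
    refine Finset.sum_le_sum fun i _ ↦ ?_
    rw [mul_comm]
    have := hj i (Finset.mem_univ _)
    gcongr
  -- the product of `v` with the other singular vectors
  have h2 : ‖ιMulti ℝ k (Function.update (fun i ↦ A (f i)) j (A v))‖ ≤ N * (k ! * ‖v‖) := by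
    have e1 : extMap k A (ιMulti ℝ k (Function.update f j v)) =
        ιMulti ℝ k (Function.update (fun i ↦ A (f i)) j (A v)) := by
      rw [extMap_ιMulti]
      congr 1
      ext i
      by_cases h : i = j
      · subst h; simp
      · simp [h]
    rw [← e1]
    refine (le_restrictNorm _ (extE k E F) ?_).trans ?_
    · refine Submodule.subset_span ⟨_, fun i ↦ ?_, ⟨j, by simpa using hv⟩, rfl⟩
      by_cases h : i = j
      · subst h; left; simpa using hv
      · right; simpa [h] using hfm i
    · refine mul_le_mul_of_nonneg_left ((norm_ιMulti_le _).trans (le_of_eq ?_))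
        (restrictNorm_nonneg _ _)
      rw [← Finset.mul_prod_erase _ _ (Finset.mem_univ j), Finset.prod_eq_one, mul_one]
      · simp
      · intro i hi
        simp [Finset.ne_of_mem_erase hi, hf.1]
  -- orthogonalization of `A v`
  set s : Fin k → ℝ := fun i ↦ ⟪A (f i), A v⟫ / ‖A (f i)‖ ^ 2 with hs
  set u : W := A v - ∑ i ∈ Finset.univ.erase j, s i • A (f i) with hu
  have h3 : ‖A v‖ ≤ c * ‖u‖ := by
    have := (hc (A v) ⟨v, hv, rfl⟩ (-∑ i ∈ Finset.univ.erase j, s i • A (f i))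
      (Submodule.neg_mem _ (Submodule.sum_mem _ fun i _ ↦
        Submodule.smul_mem _ _ ⟨f i, hfm i, rfl⟩))).1
    rwa [← sub_eq_add_neg] at this
  have h4 : ∀ i ≠ j, ⟪A (f i), u⟫ = 0 := by
    intro i hi
    rw [hu, inner_sub_right, inner_sum, Finset.sum_eq_single i]
    · rw [inner_smul_right, real_inner_self_eq_norm_sq, hs]
      have := (hAf0 i).ne'
      field_simp
      simp
    · intro l _ hl
      have : ⟪A (f i), A (f l)⟫ = 0 := hAf hl.symm
      rw [inner_smul_right, this, mul_zero]
    · intro h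
      exact (h (Finset.mem_erase.2 ⟨hi, Finset.mem_univ _⟩)).elim
  -- Multiples of the other factors can be added to one factor without changing the product. After
  -- this the factors are orthogonal and the norm is exactly a product.
  have h5 : ιMulti ℝ k (Function.update (fun i ↦ A (f i)) j (A v)) =
      ιMulti ℝ k (Function.update (fun i ↦ A (f i)) j u) := by
    have : A v = u + ∑ i ∈ Finset.univ.erase j, s i • A (f i) := by rw [hu]; abel
    rw [this, AlternatingMap.map_update_add, add_eq_left, AlternatingMap.map_update_sum]
    refine Finset.sum_eq_zero fun i hi ↦ ?_
    rw [AlternatingMap.map_update_smul, AlternatingMap.map_update_self _ _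
      (Finset.ne_of_mem_erase hi).symm, smul_zero]
  have h6 : ‖ιMulti ℝ k (Function.update (fun i ↦ A (f i)) j u)‖ =
      ‖u‖ * ∏ i ∈ Finset.univ.erase j, ‖A (f i)‖ := by
    rw [norm_ιMulti_of_orthogonal, ← Finset.mul_prod_erase _ _ (Finset.mem_univ j)]
    · congr 1
      · simp
      · refine Finset.prod_congr rfl fun i hi ↦ ?_
        simp [Finset.ne_of_mem_erase hi]
    · intro i l hil
      by_cases hi : i = j
      · subst hi
        simpa [hil.symm, real_inner_comm] using h4 l hil.symm
      · by_cases hl : l = j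
        · subst hl
          simpa [hi] using h4 i hi
        · simpa [hi, hl] using hAf hil
  rw [h5, h6] at h2
  rw [hBn, ← Finset.mul_prod_erase _ _ (Finset.mem_univ j)] at *
  set Q := ∏ i ∈ Finset.univ.erase j, ‖A (f i)‖
  have hσ := hAf0 j
  have hQ : 0 < Q := (mul_pos_iff_of_pos_left hσ).1 hpos
  have hN : 0 ≤ N := restrictNorm_nonneg _ _
  rcases eq_or_ne v 0 with rfl | hv0
  · simp
  have hu0 : 0 < ‖A v‖ := norm_pos_iff.2 fun h ↦ hv0 (hinj (by rw [h, map_zero]))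
  have hc0 : 0 < c := pos_of_mul_pos_left (hu0.trans_le h3) (norm_nonneg _)
  have h7 : ‖A v‖ * Q ≤ c * (N * (k ! * ‖v‖)) :=
    calc ‖A v‖ * Q ≤ c * ‖u‖ * Q := by gcongr
      _ = c * (‖u‖ * Q) := by ring
      _ ≤ _ := by gcongr
  have h8 : ‖w‖ ≤ ‖A w‖ / ‖A (f j)‖ := by rw [le_div_iff₀ hσ]; linarith
  calc ‖A v‖ * ‖w‖ ≤ (c * (N * (k ! * ‖v‖)) / Q) * (‖A w‖ / ‖A (f j)‖) := by
        gcongr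
        rwa [le_div_iff₀ hQ]
    _ = _ := by field_simp

end ExteriorDomination

/-! ### The derivative of a flow -/

section FlowDerivative

variable {n : ℕ} {H : Type*} [TopologicalSpace H]
  {I : ModelWithCorners ℝ (EuclideanSpace ℝ (Fin n)) H}
  {M : Type*} [TopologicalSpace M] [ChartedSpace H M]
  {X : ∀ x : M, TangentSpace I x} {φ : ℝ → M → M}

omit [TopologicalSpace M] [ChartedSpace H M] in
lemma flowDomain_of_nonneg (φ : ℝ → M → M) {t : ℝ} (ht : 0 ≤ t) : flowDomain φ t = univ := by
  simp [flowDomain, ht]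

lemma flowDeriv_of_nonneg (φ : ℝ → M → M) {t : ℝ} (ht : 0 ≤ t) (x : M) :
    flowDeriv I φ t x = mfderiv I I (φ t) x := by
  rw [flowDeriv, flowDomain_of_nonneg φ ht, mfderivWithin_univ]

namespace IsC1FlowOf

lemma mdifferentiable (hφ : IsC1FlowOf I X φ) {t : ℝ} (ht : 0 ≤ t) : MDifferentiable I I (φ t) := by
  have h1 : ContMDiff I I 1 (φ t) := by
    rw [← contMDiffOn_univ]
    exact hφ.contMDiffOn.comp (f := fun x ↦ (t, x))
      (contMDiff_const.prodMk contMDiff_id).contMDiffOn fun x _ ↦ ⟨ht, mem_univ _⟩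
  exact h1.mdifferentiable one_ne_zero

/-- Chain rule, stated in the total space because the two sides lie over base points that are only
propositionally equal. -/
lemma mk_flowDeriv_add (hφ : IsC1FlowOf I X φ) {s t : ℝ} (hs : 0 ≤ s) (ht : 0 ≤ t) (x : M)
    (v : TangentSpace I x) :
    (⟨φ (s + t) x, flowDeriv I φ (s + t) x v⟩ : TangentBundle I M) =
      ⟨φ s (φ t x), flowDeriv I φ s (φ t x) (flowDeriv I φ t x v)⟩ := by
  have h1 : φ (s + t) = φ s ∘ φ t := funext fun x ↦ hφ.map_add s t hs ht x
  have h2 := tangentMap_comp_at (I := I) (I' := I) (I'' := I) (⟨x, v⟩ : TangentBundle I M)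
    (hφ.mdifferentiable hs (φ t x)) (hφ.mdifferentiable ht x)
  rw [flowDeriv_of_nonneg φ hs, flowDeriv_of_nonneg φ ht, flowDeriv_of_nonneg φ (add_nonneg hs ht)]
  rw [← h1] at h2
  exact h2

lemma mk_flowDeriv_zero (hφ : IsC1FlowOf I X φ) (x : M) (v : TangentSpace I x) :
    (⟨φ 0 x, flowDeriv I φ 0 x v⟩ : TangentBundle I M) = ⟨x, v⟩ := by
  have h1 : φ 0 = id := funext fun x ↦ hφ.map_zero x
  rw [flowDeriv_of_nonneg φ le_rfl]
  change tangentMap I I (φ 0) ⟨x, v⟩ = _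
  rw [h1, tangentMap_id]
  rfl

lemma mk_flowDeriv_neg (hφ : IsC1FlowOf I X φ) {t : ℝ} (ht : 0 < t) (x : M)
    (v : TangentSpace I x) :
    (⟨φ (-t) (φ t x), flowDeriv I φ (-t) (φ t x) (flowDeriv I φ t x v)⟩ : TangentBundle I M) =
      ⟨x, v⟩ := by
  have h1 : φ (-t) ∘ φ t = id := funext fun x ↦ hφ.neg_apply t ht.le x
  have hmem : ∀ x, φ t x ∈ flowDomain φ (-t) := fun x ↦ Or.inr ⟨x, by simp⟩
  have h2 := tangentMapWithin_comp_at (I := I) (I' := I) (I'' := I) (s := univ)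
    (⟨x, v⟩ : TangentBundle I M)
    (((hφ.contMDiffOn_neg (-t) (by linarith)).mdifferentiableOn one_ne_zero) _ (hmem x))
    (hφ.mdifferentiable ht.le x).mdifferentiableWithinAt
    (fun x _ ↦ hmem x) (uniqueMDiffWithinAt_univ I)
  rw [tangentMapWithin_univ, tangentMapWithin_univ, h1, tangentMap_id] at h2
  rw [flowDeriv_of_nonneg φ ht.le]
  exact h2.symm

variable [IsManifold I 1 M]

/-- The derivative of the semiflow is jointly continuous. -/
theorem continuousOn_mk_flowDeriv (hφ : IsC1FlowOf I X φ) :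
    ContinuousOn (fun q : ℝ × TangentBundle I M ↦
      (⟨φ q.1 q.2.1, flowDeriv I φ q.1 q.2.1 q.2.2⟩ : TangentBundle I M)) (Ici 0 ×ˢ univ) := by
  have hS : UniqueMDiffOn (𝓘(ℝ, ℝ).prod I) (Ici (0 : ℝ) ×ˢ (univ : Set M)) :=
    (uniqueDiffOn_Ici (0 : ℝ)).uniqueMDiffOn.prod uniqueMDiffOn_univ
  have h1 := hφ.contMDiffOn.continuousOn_tangentMapWithin le_rfl hS
  -- A tangent vector of `M` at time `t` is viewed as a tangent vector of `ℝ × M` with zero time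
  -- component; the tangent map of the joint flow then computes the derivative in space.
  have h2 : Continuous fun q : ℝ × TangentBundle I M ↦
      (equivTangentBundleProd 𝓘(ℝ, ℝ) ℝ I M).symm (zeroSection ℝ (TangentSpace 𝓘(ℝ, ℝ)) q.1, q.2) :=
    (contMDiff_equivTangentBundleProd_symm (n := 0)).continuous.comp
      (((Bundle.contMDiff_zeroSection ℝ (TangentSpace 𝓘(ℝ, ℝ)) (IB := 𝓘(ℝ, ℝ))
        (n := 0)).continuous.comp continuous_fst).prodMk continuous_snd)
  refine (h1.comp h2.continuousOn fun q hq ↦ ⟨hq.1, mem_univ _⟩).congr ?_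
  rintro ⟨t, x, v⟩ ⟨ht, -⟩
  have ht : 0 ≤ t := ht
  have h3 : mfderiv I I (φ t) x = (mfderivWithin (𝓘(ℝ, ℝ).prod I) I
      (fun p : ℝ × M ↦ φ p.1 p.2) (Ici 0 ×ˢ univ) (t, x)).comp
      (mfderiv I (𝓘(ℝ, ℝ).prod I) (fun y : M ↦ (t, y)) x) := by
    have := mfderivWithin_comp (I := I) (I' := 𝓘(ℝ, ℝ).prod I) (I'' := I) (x := x) (s := univ)
      (f := fun y : M ↦ (t, y)) (g := fun p : ℝ × M ↦ φ p.1 p.2) (u := Ici 0 ×ˢ univ)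
      ((hφ.contMDiffOn.mdifferentiableOn one_ne_zero) _ ⟨ht, mem_univ _⟩)
      (mdifferentiableAt_const.prodMk mdifferentiableAt_id).mdifferentiableWithinAt
      (fun y _ ↦ ⟨ht, mem_univ _⟩) (uniqueMDiffWithinAt_univ I)
    rw [mfderivWithin_univ, mfderivWithin_univ] at this
    exact this
  rw [mfderiv_prod_right] at h3
  simp only [flowDeriv_of_nonneg φ ht, h3]
  rfl

end IsC1FlowOf

end FlowDerivative

/-! ### Norms of restrictions in terms of frames -/

section Frames

variable {V W : Type*} [NormedAddCommGroup V] [NormedSpace ℝ V]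
  [NormedAddCommGroup W] [NormedSpace ℝ W] {d : ℕ}

/-- The expansion of `L` on the combination of the vectors `s` with coefficients `c`. -/
noncomputable def frameRatio (L : V →L[ℝ] W) (s : Fin d → V) (c : Fin d → ℝ) : ℝ :=
  ‖L (∑ i, c i • s i)‖ / ‖∑ i, c i • s i‖

lemma frame_sum_ne_zero {s : Fin d → V} (hs : LinearIndependent ℝ s) {c : Fin d → ℝ}
    (hc : c ≠ 0) : ∑ i, c i • s i ≠ 0 := fun h ↦
  hc (funext fun i ↦ Fintype.linearIndependent_iff.1 hs c h i)

/-- The ratio is homogeneous of degree zero in the coefficients, so the unit sphere of a varying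
subspace can be replaced by one fixed compact sphere of coefficients. Continuity of norms and
co-norms in the base point follows from this. -/
lemma frameRatio_image (L : V →L[ℝ] W) {s : Fin d → V} (hs : LinearIndependent ℝ s) :
    frameRatio L s '' Metric.sphere 0 1 =
      (fun v ↦ ‖L v‖) '' {v | v ∈ Submodule.span ℝ (range s) ∧ ‖v‖ = 1} := by
  ext r
  constructor
  · rintro ⟨c, hc, rfl⟩
    have hc0 : c ≠ 0 := by
      rintro rfl
      simp at hc
    have hv := norm_pos_iff.2 (frame_sum_ne_zero hs hc0)
    have hmem : ∑ i, c i • s i ∈ Submodule.span ℝ (range s) :=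
      Submodule.sum_mem _ fun i _ ↦ Submodule.smul_mem _ _ (Submodule.subset_span ⟨i, rfl⟩)
    refine ⟨‖∑ i, c i • s i‖⁻¹ • ∑ i, c i • s i, ⟨Submodule.smul_mem _ _ hmem, ?_⟩, ?_⟩
    · rw [norm_smul, norm_inv, norm_norm, inv_mul_cancel₀ hv.ne']
    · simp only [frameRatio]
      rw [map_smul, norm_smul, norm_inv, norm_norm, inv_mul_eq_div]
  · rintro ⟨v, ⟨hv, hv1⟩, rfl⟩
    obtain ⟨c, rfl⟩ := (Submodule.mem_span_range_iff_exists_fun ℝ).1 hv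
    have hc0 : c ≠ 0 := by
      rintro rfl
      simp at hv1
    have hcn := norm_pos_iff.2 hc0
    have e : ∑ i, (‖c‖⁻¹ • c) i • s i = ‖c‖⁻¹ • ∑ i, c i • s i := by
      simp [Finset.smul_sum, mul_smul]
    refine ⟨‖c‖⁻¹ • c, ?_, ?_⟩
    · rw [mem_sphere_zero_iff_norm, norm_smul, norm_inv, norm_norm, inv_mul_cancel₀ hcn.ne']
    · simp only [frameRatio]
      rw [e, map_smul, norm_smul, norm_smul, hv1, norm_inv, norm_norm, mul_one,
        mul_div_cancel_left₀ _ (inv_ne_zero hcn.ne')]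

lemma restrictNorm_eq_sSup (L : V →L[ℝ] W) (S : Submodule ℝ V) :
    restrictNorm L S = sSup ((fun v ↦ ‖L v‖) '' {v | v ∈ S ∧ ‖v‖ = 1}) := by
  rw [restrictNorm, ← ContinuousLinearMap.sSup_sphere_eq_norm]
  congr 1
  ext r
  constructor
  · rintro ⟨v, hv, rfl⟩
    exact ⟨v, ⟨v.2, by simpa using hv⟩, rfl⟩
  · rintro ⟨v, ⟨hv, hv1⟩, rfl⟩
    exact ⟨⟨v, hv⟩, by simpa using hv1, rfl⟩

lemma restrictNorm_eq_sSup_frameRatio (L : V →L[ℝ] W) {s : Fin d → V}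
    (hs : LinearIndependent ℝ s) {S : Submodule ℝ V} (hS : Submodule.span ℝ (range s) = S) :
    restrictNorm L S = sSup (frameRatio L s '' Metric.sphere 0 1) := by
  rw [frameRatio_image L hs, hS, restrictNorm_eq_sSup]

lemma restrictConorm_eq_sInf_frameRatio (L : V →L[ℝ] W) {s : Fin d → V}
    (hs : LinearIndependent ℝ s) {S : Submodule ℝ V} (hS : Submodule.span ℝ (range s) = S) :
    restrictConorm L S = sInf (frameRatio L s '' Metric.sphere 0 1) := by
  rw [frameRatio_image L hs, hS, restrictConorm]

variable {γ β : Type*} [TopologicalSpace γ] [TopologicalSpace β]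

lemma IsCompact.continuousOn_sSup {f : γ → β → ℝ} {S : Set γ} {K : Set β} (hK : IsCompact K)
    (hf : ContinuousOn (fun p : γ × β ↦ f p.1 p.2) (S ×ˢ K)) :
    ContinuousOn (fun x ↦ sSup (f x '' K)) S := by
  rw [continuousOn_iff_continuous_domRestrict]
  have : CompactSpace K := isCompact_iff_compactSpace.1 hK
  have h : Continuous ↿(fun (x : S) (y : K) ↦ f x y) :=
    hf.comp_continuous (f := fun p : S × K ↦ ((p.1 : γ), (p.2 : β))) (by fun_prop)
      fun p ↦ ⟨p.1.2, p.2.2⟩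
  refine (isCompact_univ.continuous_sSup h).congr fun x ↦ ?_
  rw [image_univ]
  congr 1
  ext r
  simp

lemma IsCompact.continuousOn_sInf {f : γ → β → ℝ} {S : Set γ} {K : Set β} (hK : IsCompact K)
    (hf : ContinuousOn (fun p : γ × β ↦ f p.1 p.2) (S ×ˢ K)) :
    ContinuousOn (fun x ↦ sInf (f x '' K)) S := by
  rw [continuousOn_iff_continuous_domRestrict]
  have : CompactSpace K := isCompact_iff_compactSpace.1 hK
  have h : Continuous ↿(fun (x : S) (y : K) ↦ f x y) :=
    hf.comp_continuous (f := fun p : S × K ↦ ((p.1 : γ), (p.2 : β))) (by fun_prop)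
      fun p ↦ ⟨p.1.2, p.2.2⟩
  refine (isCompact_univ.continuous_sInf h).congr fun x ↦ ?_
  rw [image_univ]
  congr 1
  ext r
  simp

end Frames

/-! ### Continuity of norms and co-norms of the derivative along a continuous subbundle. -/

section TangentFrames

variable {n : ℕ} {H : Type*} [TopologicalSpace H]
  {I : ModelWithCorners ℝ (EuclideanSpace ℝ (Fin n)) H}
  {M : Type*} [TopologicalSpace M] [ChartedSpace H M] [IsManifold I 1 M]

lemma continuousOn_mk_frame_sum {x₀ : M} {S : Set M} {d : ℕ}
    {s : Fin d → ∀ x : M, TangentSpace I x}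
    (hs : ∀ i, ContinuousOn (fun x ↦ tangentCoord I x₀ x (s i x)) S)
    (hS : S ⊆ (trivializationAt (EuclideanSpace ℝ (Fin n)) (TangentSpace I : M → Type _)
      x₀).baseSet) :
    ContinuousOn (fun q : M × (Fin d → ℝ) ↦
      (⟨q.1, ∑ i, q.2 i • s i q.1⟩ : TangentBundle I M)) (S ×ˢ univ) := by
  set e := trivializationAt (EuclideanSpace ℝ (Fin n)) (TangentSpace I : M → Type _) x₀
  have h1 : ContinuousOn (fun q : M × (Fin d → ℝ) ↦
      (q.1, ∑ i, q.2 i • tangentCoord I x₀ q.1 (s i q.1))) (S ×ˢ univ) := by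
    refine continuousOn_fst.prodMk (continuousOn_finsetSum _ fun i _ ↦ ?_)
    refine ContinuousOn.smul
      ((continuous_apply i).comp continuous_snd).continuousOn ?_
    exact (hs i).comp continuousOn_fst fun q hq ↦ hq.1
  refine (e.continuousOn_symm.comp h1 fun q hq ↦ ⟨hS hq.1, mem_univ _⟩).congr ?_
  rintro ⟨x, c⟩ ⟨hx, -⟩
  have h2 : ∑ i, c i • tangentCoord I x₀ x (s i x) = (e ⟨x, ∑ i, c i • s i x⟩).2 := by
    rw [← e.continuousLinearMapAt_apply_of_mem ℝ (hS hx), map_sum]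
    simp only [map_smul]
    rfl
  simp only [Function.comp_apply, h2]
  rw [e.symm_apply_apply_mk (hS hx)]

variable [RiemannianBundle (fun x : M ↦ TangentSpace I x)]
    [IsContinuousRiemannianBundle (EuclideanSpace ℝ (Fin n)) (fun x : M ↦ TangentSpace I x)]

lemma continuous_tangent_norm : Continuous fun p : TangentBundle I M ↦ ‖p.2‖ := by
  have h : Continuous fun p : TangentBundle I M ↦ inner ℝ p.2 p.2 :=
    Continuous.inner_bundle (F := EuclideanSpace ℝ (Fin n))
      (E := fun x : M ↦ TangentSpace I x) (b := fun p : TangentBundle I M ↦ p.1)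
      (v := fun p ↦ p.2) (w := fun p ↦ p.2) continuous_id continuous_id
  refine h.sqrt.congr fun p ↦ ?_
  rw [real_inner_self_eq_norm_sq, Real.sqrt_sq (norm_nonneg _)]

variable {X : ∀ x : M, TangentSpace I x} {φ : ℝ → M → M} {Λ : Set M}
  {E F : ∀ x : M, Submodule ℝ (TangentSpace I x)}

omit [IsContinuousRiemannianBundle (EuclideanSpace ℝ (Fin n)) (fun x : M ↦ TangentSpace I x)] in
lemma exists_continuous_frame (hE : IsContinuousSubbundle (W := fun x : M ↦ TangentSpace I x) (tangentCoord I) Λ E) {x₀ : M}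
    (hx₀ : x₀ ∈ Λ) : ∃ U : Set M, IsOpen U ∧ x₀ ∈ U ∧ ∃ (d : ℕ) (s : Fin d → ∀ x, TangentSpace I x),
      ContinuousOn (fun q : M × (Fin d → ℝ) ↦
        (⟨q.1, ∑ i, q.2 i • s i q.1⟩ : TangentBundle I M)) ((U ∩ Λ) ×ˢ univ) ∧
      ∀ x ∈ U ∩ Λ, LinearIndependent ℝ (fun i ↦ s i x) ∧
        Submodule.span ℝ (range fun i ↦ s i x) = E x := by
  obtain ⟨U, hU, hxU, d, s, hs, hsE⟩ := hE x₀ hx₀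
  set e := trivializationAt (EuclideanSpace ℝ (Fin n)) (TangentSpace I : M → Type _) x₀
  refine ⟨U ∩ e.baseSet, hU.inter e.open_baseSet, ⟨hxU, mem_baseSet_trivializationAt _ _ _⟩, d, s,
    continuousOn_mk_frame_sum (x₀ := x₀) (fun i ↦ (hs i).mono ?_) fun x hx ↦ hx.1.2,
    fun x hx ↦ hsE x ⟨hx.1.1, hx.2⟩⟩
  exact fun x hx ↦ ⟨hx.1.1, hx.2⟩

lemma continuousOn_frameRatio_flowDeriv (hφ : IsC1FlowOf I X φ) {S : Set M} {d : ℕ}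
    {s : Fin d → ∀ x : M, TangentSpace I x}
    (hs : ContinuousOn (fun q : M × (Fin d → ℝ) ↦
        (⟨q.1, ∑ i, q.2 i • s i q.1⟩ : TangentBundle I M)) (S ×ˢ univ))
    (hli : ∀ x ∈ S, LinearIndependent ℝ (fun i ↦ s i x)) :
    ContinuousOn (fun q : (ℝ × M) × (Fin d → ℝ) ↦
      frameRatio (flowDeriv I φ q.1.1 q.1.2) (fun i ↦ s i q.1.2) q.2)
      ((Ici 0 ×ˢ S) ×ˢ Metric.sphere 0 1) := by
  have h1 : ContinuousOn (fun q : (ℝ × M) × (Fin d → ℝ) ↦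
      (⟨q.1.2, ∑ i, q.2 i • s i q.1.2⟩ : TangentBundle I M))
      ((Ici 0 ×ˢ S) ×ˢ Metric.sphere 0 1) :=
    hs.comp (f := fun q : (ℝ × M) × (Fin d → ℝ) ↦ (q.1.2, q.2))
      (Continuous.continuousOn (by fun_prop)) fun q hq ↦ ⟨hq.1.2, mem_univ _⟩
  have h2 : ContinuousOn (fun q : (ℝ × M) × (Fin d → ℝ) ↦
      (⟨φ q.1.1 q.1.2, flowDeriv I φ q.1.1 q.1.2 (∑ i, q.2 i • s i q.1.2)⟩ : TangentBundle I M))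
      ((Ici 0 ×ˢ S) ×ˢ Metric.sphere 0 1) :=
    hφ.continuousOn_mk_flowDeriv.comp
      (f := fun q : (ℝ × M) × (Fin d → ℝ) ↦
        (q.1.1, (⟨q.1.2, ∑ i, q.2 i • s i q.1.2⟩ : TangentBundle I M)))
      (ContinuousOn.prodMk (Continuous.continuousOn (by fun_prop)) h1)
      fun q hq ↦ ⟨hq.1.1, mem_univ _⟩
  have h3 : ContinuousOn (fun q : (ℝ × M) × (Fin d → ℝ) ↦ ‖∑ i, q.2 i • s i q.1.2‖)
      ((Ici 0 ×ˢ S) ×ˢ Metric.sphere 0 1) :=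
    (continuous_tangent_norm.comp_continuousOn h1).congr fun q _ ↦ rfl
  have h4 : ContinuousOn (fun q : (ℝ × M) × (Fin d → ℝ) ↦
      ‖flowDeriv I φ q.1.1 q.1.2 (∑ i, q.2 i • s i q.1.2)‖)
      ((Ici 0 ×ˢ S) ×ˢ Metric.sphere 0 1) :=
    (continuous_tangent_norm.comp_continuousOn h2).congr fun q _ ↦ rfl
  unfold frameRatio
  refine h4.div h3 fun q hq ↦ ?_
  refine norm_ne_zero_iff.2 (frame_sum_ne_zero (hli _ hq.1.2) fun h ↦ ?_)
  have := hq.2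
  simp [h] at this

lemma ContinuousOn.of_local {Y : Type*} [TopologicalSpace Y] {f : ℝ × M → Y}
    (h : ∀ x ∈ Λ, ∃ U : Set M, IsOpen U ∧ x ∈ U ∧ ContinuousOn f (Ici 0 ×ˢ (U ∩ Λ))) :
    ContinuousOn f (Ici 0 ×ˢ Λ) := by
  rintro ⟨t, x⟩ ⟨ht, hx⟩
  obtain ⟨U, hU, hxU, hf⟩ := h x hx
  refine (hf (t, x) ⟨ht, hxU, hx⟩).mono_of_mem_nhdsWithin ?_
  have : Ici (0 : ℝ) ×ˢ (U ∩ Λ) = (Prod.snd ⁻¹' U) ∩ (Ici 0 ×ˢ Λ) := by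
    ext p
    simp only [mem_prod, mem_inter_iff, mem_preimage]
    tauto
  rw [this]
  exact inter_mem (mem_nhdsWithin_of_mem_nhds ((hU.preimage continuous_snd).mem_nhds hxU))
    self_mem_nhdsWithin

theorem continuousOn_restrictNorm_flowDeriv (hφ : IsC1FlowOf I X φ)
    (hE : IsContinuousSubbundle (W := fun x : M ↦ TangentSpace I x) (tangentCoord I) Λ E) :
    ContinuousOn (fun p : ℝ × M ↦ restrictNorm (flowDeriv I φ p.1 p.2) (E p.2)) (Ici 0 ×ˢ Λ) := by
  refine ContinuousOn.of_local fun x hx ↦ ?_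
  obtain ⟨U, hU, hxU, d, s, hs, hsE⟩ := exists_continuous_frame hE hx
  refine ⟨U, hU, hxU, ?_⟩
  have h := continuousOn_frameRatio_flowDeriv hφ hs fun x hx ↦ (hsE x hx).1
  have h' := IsCompact.continuousOn_sSup (S := Ici 0 ×ˢ (U ∩ Λ))
    (f := fun (p : ℝ × M) c ↦ frameRatio (flowDeriv I φ p.1 p.2) (fun i ↦ s i p.2) c)
    (isCompact_sphere (0 : Fin d → ℝ) 1) h
  refine h'.congr fun p hp ↦ ?_
  exact restrictNorm_eq_sSup_frameRatio _ (hsE p.2 hp.2).1 (hsE p.2 hp.2).2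

theorem continuousOn_restrictConorm_flowDeriv (hφ : IsC1FlowOf I X φ)
    (hE : IsContinuousSubbundle (W := fun x : M ↦ TangentSpace I x) (tangentCoord I) Λ E) :
    ContinuousOn (fun p : ℝ × M ↦ restrictConorm (flowDeriv I φ p.1 p.2) (E p.2)) (Ici 0 ×ˢ Λ) := by
  refine ContinuousOn.of_local fun x hx ↦ ?_
  obtain ⟨U, hU, hxU, d, s, hs, hsE⟩ := exists_continuous_frame hE hx
  refine ⟨U, hU, hxU, ?_⟩
  have h := continuousOn_frameRatio_flowDeriv hφ hs fun x hx ↦ (hsE x hx).1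
  have h' := IsCompact.continuousOn_sInf (S := Ici 0 ×ˢ (U ∩ Λ))
    (f := fun (p : ℝ × M) c ↦ frameRatio (flowDeriv I φ p.1 p.2) (fun i ↦ s i p.2) c)
    (isCompact_sphere (0 : Fin d → ℝ) 1) h
  refine h'.congr fun p hp ↦ ?_
  exact restrictConorm_eq_sInf_frameRatio _ (hsE p.2 hp.2).1 (hsE p.2 hp.2).2

end TangentFrames

/-! ### Norms and co-norms of restrictions -/

section Conorm

variable {V W : Type*} [NormedAddCommGroup V] [NormedSpace ℝ V]
  [NormedAddCommGroup W] [NormedSpace ℝ W] (L : V →L[ℝ] W) {S : Submodule ℝ V}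

lemma bddBelow_norm_image (S : Submodule ℝ V) :
    BddBelow ((fun v ↦ ‖L v‖) '' {v | v ∈ S ∧ ‖v‖ = 1}) :=
  ⟨0, by rintro _ ⟨v, -, rfl⟩; exact norm_nonneg _⟩

lemma restrictConorm_mul_le {v : V} (hv : v ∈ S) : restrictConorm L S * ‖v‖ ≤ ‖L v‖ := by
  rcases eq_or_ne v 0 with rfl | hv0
  · simp
  have hn := norm_pos_iff.2 hv0
  rw [← le_div_iff₀ hn]
  refine csInf_le (bddBelow_norm_image L S) ⟨‖v‖⁻¹ • v, ⟨S.smul_mem _ hv, ?_⟩, ?_⟩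
  · rw [norm_smul, norm_inv, norm_norm, inv_mul_cancel₀ hn.ne']
  · simp only [map_smul, norm_smul, norm_inv, norm_norm]
    rw [inv_mul_eq_div]

lemma le_restrictConorm (hS : S ≠ ⊥) {c : ℝ} (h : ∀ v ∈ S, c * ‖v‖ ≤ ‖L v‖) :
    c ≤ restrictConorm L S := by
  obtain ⟨v, hv, hv0⟩ := S.exists_mem_ne_zero_of_ne_bot hS
  have hn := norm_pos_iff.2 hv0
  refine le_csInf ⟨_, ‖v‖⁻¹ • v, ⟨S.smul_mem _ hv, ?_⟩, rfl⟩ ?_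
  · rw [norm_smul, norm_inv, norm_norm, inv_mul_cancel₀ hn.ne']
  · rintro _ ⟨w, ⟨hw, hw1⟩, rfl⟩
    simpa [hw1] using h w hw

lemma restrictConorm_pos [FiniteDimensional ℝ V] (hS : S ≠ ⊥) (hL : Function.Injective L) :
    0 < restrictConorm L S := by
  obtain ⟨K, hK, hLK⟩ := L.toLinearMap.exists_antilipschitzWith (LinearMap.ker_eq_bot.2 hL)
  have hK' : (0 : ℝ) < K := hK
  refine lt_of_lt_of_le (inv_pos.2 hK') (le_restrictConorm L hS fun v _ ↦ ?_)
  have := hLK.le_mul_dist v 0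
  rw [map_zero, dist_zero_right, dist_zero_right] at this
  rw [inv_mul_le_iff₀ hK']
  exact this

lemma restrictNorm_pos (hS : S ≠ ⊥) (hL : Function.Injective L) : 0 < restrictNorm L S := by
  obtain ⟨v, hv, hv0⟩ := S.exists_mem_ne_zero_of_ne_bot hS
  have h1 := le_restrictNorm L S hv
  have h2 : 0 < ‖L v‖ := norm_pos_iff.2 fun h ↦ hv0 (hL (by rw [h, map_zero]))
  exact pos_of_mul_pos_left (h2.trans_le h1) (norm_nonneg _)

end Conorm

/-! ### Uniform bounds for the projections of a continuous splitting. -/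

section SplittingBound

lemma IsCompact.exists_bound_nhdsWithin {γ β : Type*} [TopologicalSpace γ] [TopologicalSpace β]
    {f : γ → β → ℝ} {S : Set γ} {K : Set β} (hK : IsCompact K)
    (hf : ContinuousOn (fun p : γ × β ↦ f p.1 p.2) (S ×ˢ K)) {x₀ : γ} (hx₀ : x₀ ∈ S) :
    ∃ B, ∀ᶠ x in 𝓝[S] x₀, ∀ y ∈ K, f x y ≤ B := by
  have h := hK.continuousOn_sSup hf x₀ hx₀
  refine ⟨sSup (f x₀ '' K) + 1, ?_⟩
  filter_upwards [h.eventually_lt_const (lt_add_one _), self_mem_nhdsWithin] with x hx hxS y hy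
  have hb : BddAbove (f x '' K) := by
    refine (hK.image_of_continuousOn ?_).bddAbove
    exact hf.comp (f := fun y ↦ (x, y)) (Continuous.continuousOn (by fun_prop))
      fun y hy ↦ ⟨hxS, hy⟩
  exact (le_csSup hb ⟨y, hy, rfl⟩).trans hx.le

variable {n : ℕ} {H : Type*} [TopologicalSpace H]
  {I : ModelWithCorners ℝ (EuclideanSpace ℝ (Fin n)) H}
  {M : Type*} [TopologicalSpace M] [ChartedSpace H M] [IsManifold I 1 M]
  [RiemannianBundle (fun x : M ↦ TangentSpace I x)]
  [IsContinuousRiemannianBundle (EuclideanSpace ℝ (Fin n)) (fun x : M ↦ TangentSpace I x)]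
  {Λ : Set M} {E F : ∀ x : M, Submodule ℝ (TangentSpace I x)}

/-- Expanding the square of the norm of the sum reduces its continuity to that of the metric on the
two given sections. -/
lemma continuousOn_norm_div_norm_add {Z : Type*} [TopologicalSpace Z] {S : Set Z} {b : Z → M}
    {v w : ∀ z, TangentSpace I (b z)}
    (hv : ContinuousOn (fun z ↦ (⟨b z, v z⟩ : TangentBundle I M)) S)
    (hw : ContinuousOn (fun z ↦ (⟨b z, w z⟩ : TangentBundle I M)) S)
    (h0 : ∀ z ∈ S, v z + w z ≠ 0) :
    ContinuousOn (fun z ↦ (‖v z‖ + ‖w z‖) / ‖v z + w z‖) S := by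
  have h1 : ContinuousOn (fun z ↦ ‖v z‖) S :=
    (continuous_tangent_norm.comp_continuousOn hv).congr fun z _ ↦ rfl
  have h2 : ContinuousOn (fun z ↦ ‖w z‖) S :=
    (continuous_tangent_norm.comp_continuousOn hw).congr fun z _ ↦ rfl
  have h3 : ContinuousOn (fun z ↦ inner ℝ (v z) (w z)) S :=
    ContinuousOn.inner_bundle (F := EuclideanSpace ℝ (Fin n))
      (E := fun x : M ↦ TangentSpace I x) (b := b) (v := v) (w := w) hv hw
  have h4 : ContinuousOn (fun z ↦ ‖v z + w z‖) S := by
    have h5 : ContinuousOn (fun z ↦ √(‖v z‖ ^ 2 + 2 * inner ℝ (v z) (w z) + ‖w z‖ ^ 2)) S :=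
      (((h1.pow 2).add (h3.const_smul (2 : ℝ))).add (h2.pow 2)).sqrt
    refine h5.congr fun z _ ↦ ?_
    have h6 := norm_add_sq_real (v z) (w z)
    exact ((congrArg Real.sqrt h6.symm).trans (Real.sqrt_sq (norm_nonneg _))).symm
  exact (h1.add h2).div h4 fun z hz ↦ norm_ne_zero_iff.2 (h0 z hz)

/-- A continuous splitting over a compact set has uniformly bounded projections. -/
theorem exists_isSplittingBound (hΛ : IsCompact Λ) (hEF : ∀ x ∈ Λ, IsCompl (E x) (F x))
    (hE : IsContinuousSubbundle (W := fun x : M ↦ TangentSpace I x) (tangentCoord I) Λ E)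
    (hF : IsContinuousSubbundle (W := fun x : M ↦ TangentSpace I x) (tangentCoord I) Λ F) :
    ∃ c : ℝ, 1 ≤ c ∧ ∀ x ∈ Λ, IsSplittingBound (E x) (F x) c := by
  -- The property passes to subsets and, by taking the larger constant, to unions; so a bound near
  -- each point suffices.
  refine hΛ.induction_on (p := fun S ↦ ∃ c : ℝ, 1 ≤ c ∧ ∀ x ∈ S, IsSplittingBound (E x) (F x) c)
    ⟨1, le_rfl, fun x hx ↦ hx.elim⟩ (fun S T hST ⟨c, hc1, hc⟩ ↦ ⟨c, hc1, fun x hx ↦ hc x (hST hx)⟩)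
    ?_ fun x₀ hx₀ ↦ ?_
  · rintro S T ⟨c, hc1, hc⟩ ⟨c', hc1', hc'⟩
    have mono : ∀ {x : M} {a b : ℝ}, a ≤ b → IsSplittingBound (E x) (F x) a →
        IsSplittingBound (E x) (F x) b := fun hab h v hv w hw ↦
      ⟨(h v hv w hw).1.trans (by gcongr), (h v hv w hw).2.trans (by gcongr)⟩
    refine ⟨max c c', le_max_of_le_left hc1, fun x hx ↦ ?_⟩
    rcases hx with hx | hx
    · exact mono (le_max_left _ _) (hc x hx)
    · exact mono (le_max_right _ _) (hc' x hx)
  obtain ⟨U₁, hU₁, hxU₁, d, s, hs, hsE⟩ := exists_continuous_frame hE hx₀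
  obtain ⟨U₂, hU₂, hxU₂, l, r, hr, hrF⟩ := exists_continuous_frame hF hx₀
  set S : Set M := (U₁ ∩ U₂) ∩ Λ with hS
  have hS₁ : S ⊆ U₁ ∩ Λ := fun x hx ↦ ⟨hx.1.1, hx.2⟩
  have hS₂ : S ⊆ U₂ ∩ Λ := fun x hx ↦ ⟨hx.1.2, hx.2⟩
  have memE : ∀ x ∈ S, ∀ c : Fin d → ℝ, ∑ i, c i • s i x ∈ E x := fun x hx c ↦ by
    rw [← (hsE x (hS₁ hx)).2]
    exact Submodule.sum_mem _ fun i _ ↦ Submodule.smul_mem _ _ (Submodule.subset_span ⟨i, rfl⟩)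
  have memF : ∀ x ∈ S, ∀ c : Fin l → ℝ, ∑ i, c i • r i x ∈ F x := fun x hx c ↦ by
    rw [← (hrF x (hS₂ hx)).2]
    exact Submodule.sum_mem _ fun i _ ↦ Submodule.smul_mem _ _ (Submodule.subset_span ⟨i, rfl⟩)
  set K : Set ((Fin d → ℝ) × (Fin l → ℝ)) := Metric.sphere 0 1
  have h1 : ContinuousOn (fun q : M × ((Fin d → ℝ) × (Fin l → ℝ)) ↦
      (⟨q.1, ∑ i, q.2.1 i • s i q.1⟩ : TangentBundle I M)) (S ×ˢ K) :=
    hs.comp (f := fun q : M × ((Fin d → ℝ) × (Fin l → ℝ)) ↦ (q.1, q.2.1))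
      (Continuous.continuousOn (by fun_prop)) fun q hq ↦ ⟨hS₁ hq.1, mem_univ _⟩
  have h2 : ContinuousOn (fun q : M × ((Fin d → ℝ) × (Fin l → ℝ)) ↦
      (⟨q.1, ∑ i, q.2.2 i • r i q.1⟩ : TangentBundle I M)) (S ×ˢ K) :=
    hr.comp (f := fun q : M × ((Fin d → ℝ) × (Fin l → ℝ)) ↦ (q.1, q.2.2))
      (Continuous.continuousOn (by fun_prop)) fun q hq ↦ ⟨hS₂ hq.1, mem_univ _⟩
  have h0 : ∀ x ∈ S, ∀ c : (Fin d → ℝ) × (Fin l → ℝ), c ≠ 0 →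
      ∑ i, c.1 i • s i x + ∑ i, c.2 i • r i x ≠ 0 := by
    intro x hx c hc h
    have hE0 : ∑ i, c.1 i • s i x = 0 := Submodule.disjoint_def.1 (hEF x hx.2).disjoint _
      (memE x hx _) (by rw [eq_neg_of_add_eq_zero_left h]; exact neg_mem (memF x hx _))
    have hF0 : ∑ i, c.2 i • r i x = 0 := by rwa [hE0, zero_add] at h
    refine hc (Prod.ext (funext fun i ↦ ?_) (funext fun i ↦ ?_))
    · exact Fintype.linearIndependent_iff.1 (hsE x (hS₁ hx)).1 _ hE0 i
    · exact Fintype.linearIndependent_iff.1 (hrF x (hS₂ hx)).1 _ hF0 i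
  have hK0 : ∀ c ∈ K, c ≠ 0 := by
    rintro c hc rfl
    simp [K] at hc
  have h3 := continuousOn_norm_div_norm_add (b := fun q : M × ((Fin d → ℝ) × (Fin l → ℝ)) ↦ q.1)
    h1 h2 fun q hq ↦ h0 q.1 hq.1 q.2 (hK0 _ hq.2)
  obtain ⟨B, hB⟩ := IsCompact.exists_bound_nhdsWithin (f := fun (x : M)
    (c : (Fin d → ℝ) × (Fin l → ℝ)) ↦ (‖∑ i, c.1 i • s i x‖ + ‖∑ i, c.2 i • r i x‖) /
      ‖∑ i, c.1 i • s i x + ∑ i, c.2 i • r i x‖) (isCompact_sphere _ _) h3 (x₀ := x₀)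
    ⟨⟨hxU₁, hxU₂⟩, hx₀⟩
  have hnhds : 𝓝[S] x₀ = 𝓝[Λ] x₀ := by
    rw [hS, inter_comm]
    exact nhdsWithin_inter_of_mem'
      (mem_nhdsWithin_of_mem_nhds ((hU₁.inter hU₂).mem_nhds ⟨hxU₁, hxU₂⟩))
  refine ⟨_, hnhds ▸ hB.and self_mem_nhdsWithin, max B 1, le_max_right _ _, ?_⟩
  rintro x ⟨hx, hxS⟩ v hv w hw
  suffices h : ‖v‖ + ‖w‖ ≤ max B 1 * ‖v + w‖ from
    ⟨by linarith [norm_nonneg w], by linarith [norm_nonneg v]⟩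
  rw [← (hsE x (hS₁ hxS)).2, Submodule.mem_span_range_iff_exists_fun] at hv
  rw [← (hrF x (hS₂ hxS)).2, Submodule.mem_span_range_iff_exists_fun] at hw
  obtain ⟨a, rfl⟩ := hv
  obtain ⟨b, rfl⟩ := hw
  rcases eq_or_ne ((a, b) : (Fin d → ℝ) × (Fin l → ℝ)) 0 with hab | hab
  · obtain ⟨rfl, rfl⟩ := Prod.mk_eq_zero.1 hab
    simp
  have hn := norm_pos_iff.2 hab
  have h4 := hx (‖((a, b) : (Fin d → ℝ) × (Fin l → ℝ))‖⁻¹ • (a, b)) (by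
    rw [mem_sphere_zero_iff_norm, norm_smul, norm_inv, norm_norm, inv_mul_cancel₀ hn.ne'])
  set p := ‖((a, b) : (Fin d → ℝ) × (Fin l → ℝ))‖⁻¹ with hp
  have hp0 : 0 < p := inv_pos.2 hn
  have e1 : ∑ i, (p • (a, b)).1 i • s i x = p • ∑ i, a i • s i x := by
    simp [Finset.smul_sum, mul_smul]
  have e2 : ∑ i, (p • (a, b)).2 i • r i x = p • ∑ i, b i • r i x := by
    simp [Finset.smul_sum, mul_smul]
  rw [e1, e2, ← smul_add, norm_smul, norm_smul, norm_smul, ← mul_add, Real.norm_of_nonneg hp0.le,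
    mul_div_mul_left _ _ hp0.ne', div_le_iff₀ (norm_pos_iff.2 (h0 x hxS (a, b) hab))] at h4
  exact h4.trans (mul_le_mul_of_nonneg_right (le_max_left _ _) (norm_nonneg _))

end SplittingBound

/-! ### The growth cocycles of an invariant subbundle -/

section Growth

variable {n : ℕ} {H : Type*} [TopologicalSpace H]
  {I : ModelWithCorners ℝ (EuclideanSpace ℝ (Fin n)) H}
  {M : Type*} [TopologicalSpace M] [ChartedSpace H M]
  {X : ∀ x : M, TangentSpace I x} {φ : ℝ → M → M} {Λ : Set M}

omit [TopologicalSpace M] [ChartedSpace H M] in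
lemma IsFlowInvariant.mem (h : IsFlowInvariant φ Λ) (t : ℝ) {x : M} (hx : x ∈ Λ) : φ t x ∈ Λ :=
  (h t).le (mem_image_of_mem _ hx)

/-- The flow restricted to an invariant set. -/
def IsFlowInvariant.flow {M : Type*} {φ : ℝ → M → M} {Λ : Set M} (h : IsFlowInvariant φ Λ) (t : ℝ)
    (x : Λ) : Λ :=
  ⟨φ t x, h.mem t x.2⟩

lemma IsC1FlowOf.isSemiflow (hφ : IsC1FlowOf I X φ) (h : IsFlowInvariant φ Λ) :
    IsSemiflow h.flow where
  zero x := Subtype.ext (hφ.map_zero x)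
  add s t hs ht x := Subtype.ext (hφ.map_add s t hs ht x)
  continuousOn := by
    rw [continuousOn_iff_continuous_domRestrict]
    refine Continuous.subtype_mk ?_ _
    exact hφ.contMDiffOn.continuousOn.comp_continuous
      (f := fun q : (Ici (0 : ℝ) ×ˢ (univ : Set Λ) : Set (ℝ × Λ)) ↦ (q.1.1, (q.1.2 : M)))
      (by fun_prop) fun q ↦ ⟨q.2.1, mem_univ _⟩

lemma IsC1FlowOf.flow_neg (hφ : IsC1FlowOf I X φ) (h : IsFlowInvariant φ Λ) {t : ℝ} (ht : 0 ≤ t)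
    (x : Λ) : h.flow (-t) (h.flow t x) = x :=
  Subtype.ext (hφ.neg_apply t ht x)

/-- Every point of `Λ` is the image under time `t` of a point of `Λ`, so the left inverse is also a
right inverse there. -/
lemma IsC1FlowOf.flow_flow_neg (hφ : IsC1FlowOf I X φ) (h : IsFlowInvariant φ Λ) {t : ℝ}
    (ht : 0 ≤ t) (x : Λ) : h.flow t (h.flow (-t) x) = x := by
  obtain ⟨y, hy, hyx⟩ := (h t).ge x.2
  have : x = h.flow t ⟨y, hy⟩ := Subtype.ext hyx.symm
  rw [this, hφ.flow_neg h ht]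

lemma IsC1FlowOf.continuous_flow (hφ : IsC1FlowOf I X φ) (h : IsFlowInvariant φ Λ) (t : ℝ) :
    Continuous (h.flow t) := by
  rcases le_or_gt 0 t with ht | ht
  · exact (hφ.isSemiflow h).continuous ht
  · refine Continuous.subtype_mk ?_ _
    refine (hφ.contMDiffOn_neg t ht).continuousOn.comp_continuous continuous_subtype_val
      fun x ↦ Or.inr ?_
    exact ⟨h.flow t x, congrArg Subtype.val (by
      simpa using hφ.flow_flow_neg h (t := -t) (by linarith) x)⟩

variable [RiemannianBundle (fun x : M ↦ TangentSpace I x)]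

namespace IsC1FlowOf

lemma norm_flowDeriv_add (hφ : IsC1FlowOf I X φ) {s t : ℝ} (hs : 0 ≤ s) (ht : 0 ≤ t) (x : M)
    (v : TangentSpace I x) :
    ‖flowDeriv I φ (s + t) x v‖ = ‖flowDeriv I φ s (φ t x) (flowDeriv I φ t x v)‖ :=
  congrArg (fun p : TangentBundle I M ↦ ‖p.2‖) (hφ.mk_flowDeriv_add hs ht x v)

lemma norm_flowDeriv_zero (hφ : IsC1FlowOf I X φ) (x : M) (v : TangentSpace I x) :
    ‖flowDeriv I φ 0 x v‖ = ‖v‖ :=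
  congrArg (fun p : TangentBundle I M ↦ ‖p.2‖) (hφ.mk_flowDeriv_zero x v)

lemma norm_flowDeriv_neg (hφ : IsC1FlowOf I X φ) {t : ℝ} (ht : 0 < t) (x : M)
    (v : TangentSpace I x) :
    ‖flowDeriv I φ (-t) (φ t x) (flowDeriv I φ t x v)‖ = ‖v‖ :=
  congrArg (fun p : TangentBundle I M ↦ ‖p.2‖) (hφ.mk_flowDeriv_neg ht x v)

lemma flowDeriv_injective (hφ : IsC1FlowOf I X φ) {t : ℝ} (ht : 0 ≤ t) (x : M) :
    Function.Injective (flowDeriv I φ t x) := by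
  rw [injective_iff_map_eq_zero]
  intro v hv
  rcases ht.eq_or_lt with rfl | ht
  · rw [← norm_eq_zero, ← hφ.norm_flowDeriv_zero x v, hv, norm_zero]
  · rw [← norm_eq_zero, ← hφ.norm_flowDeriv_neg ht x v, hv]
    exact (congrArg norm (ContinuousLinearMap.map_zero _)).trans norm_zero

variable {V : ∀ x : M, Submodule ℝ (TangentSpace I x)}

lemma restrictNorm_flowDeriv_pos (hφ : IsC1FlowOf I X φ) {t : ℝ} (ht : 0 ≤ t) {x : M}
    (hV : V x ≠ ⊥) : 0 < restrictNorm (flowDeriv I φ t x) (V x) :=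
  restrictNorm_pos _ hV (hφ.flowDeriv_injective ht x)

lemma restrictConorm_flowDeriv_pos (hφ : IsC1FlowOf I X φ) {t : ℝ} (ht : 0 ≤ t) {x : M}
    (hV : V x ≠ ⊥) : 0 < restrictConorm (flowDeriv I φ t x) (V x) :=
  restrictConorm_pos _ hV (hφ.flowDeriv_injective ht x)

lemma restrictNorm_flowDeriv_zero (hφ : IsC1FlowOf I X φ) {x : M} (hV : V x ≠ ⊥) :
    restrictNorm (flowDeriv I φ 0 x) (V x) = 1 := by
  obtain ⟨v, hv, hv0⟩ := (V x).exists_mem_ne_zero_of_ne_bot hV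
  apply le_antisymm
  · exact restrictNorm_le _ _ zero_le_one fun v _ ↦ by rw [hφ.norm_flowDeriv_zero, one_mul]
  · have := le_restrictNorm (flowDeriv I φ 0 x) (V x) hv
    rw [hφ.norm_flowDeriv_zero] at this
    exact (le_mul_iff_one_le_left (norm_pos_iff.2 hv0)).1 this

lemma restrictConorm_flowDeriv_zero (hφ : IsC1FlowOf I X φ) {x : M} (hV : V x ≠ ⊥) :
    restrictConorm (flowDeriv I φ 0 x) (V x) = 1 := by
  obtain ⟨v, hv, hv0⟩ := (V x).exists_mem_ne_zero_of_ne_bot hV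
  apply le_antisymm
  · have := restrictConorm_mul_le (flowDeriv I φ 0 x) hv
    rw [hφ.norm_flowDeriv_zero] at this
    exact (mul_le_iff_le_one_left (norm_pos_iff.2 hv0)).1 this
  · exact le_restrictConorm _ hV fun v _ ↦ by rw [hφ.norm_flowDeriv_zero, one_mul]

variable {x : M} {s t : ℝ}

lemma restrictNorm_flowDeriv_add_le (hφ : IsC1FlowOf I X φ) (hs : 0 ≤ s) (ht : 0 ≤ t)
    (hmap : (V x).map (flowDeriv I φ t x).toLinearMap = V (φ t x)) :
    restrictNorm (flowDeriv I φ (s + t) x) (V x) ≤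
      restrictNorm (flowDeriv I φ s (φ t x)) (V (φ t x)) *
        restrictNorm (flowDeriv I φ t x) (V x) := by
  refine restrictNorm_le _ _ (mul_nonneg (restrictNorm_nonneg _ _) (restrictNorm_nonneg _ _))
    fun v hv ↦ ?_
  rw [hφ.norm_flowDeriv_add hs ht]
  refine (le_restrictNorm _ (V (φ t x)) (hmap ▸ ⟨v, hv, rfl⟩)).trans ?_
  rw [mul_assoc]
  exact mul_le_mul_of_nonneg_left (le_restrictNorm _ _ hv) (restrictNorm_nonneg _ _)

lemma mul_le_restrictConorm_flowDeriv_add (hφ : IsC1FlowOf I X φ) (hs : 0 ≤ s) (ht : 0 ≤ t)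
    (hV : V x ≠ ⊥) (hV' : V (φ t x) ≠ ⊥)
    (hmap : (V x).map (flowDeriv I φ t x).toLinearMap = V (φ t x)) :
    restrictConorm (flowDeriv I φ s (φ t x)) (V (φ t x)) *
      restrictConorm (flowDeriv I φ t x) (V x) ≤
      restrictConorm (flowDeriv I φ (s + t) x) (V x) := by
  refine le_restrictConorm _ hV fun v hv ↦ ?_
  rw [hφ.norm_flowDeriv_add hs ht, mul_assoc]
  exact (mul_le_mul_of_nonneg_left (restrictConorm_mul_le _ hv)
    (hφ.restrictConorm_flowDeriv_pos hs hV').le).trans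
    (restrictConorm_mul_le _ (hmap ▸ ⟨v, hv, rfl⟩))

/-- Invariance lets every vector over `φ t x` be pulled back along the flow, at a cost controlled by
the co-norm. With `t = 1` this gives the bounded loss in `shift_le`. -/
lemma restrictNorm_mul_restrictConorm_le (hφ : IsC1FlowOf I X φ) (hs : 0 ≤ s) (ht : 0 ≤ t)
    (hV : V x ≠ ⊥) (hmap : (V x).map (flowDeriv I φ t x).toLinearMap = V (φ t x)) :
    restrictNorm (flowDeriv I φ s (φ t x)) (V (φ t x)) *
      restrictConorm (flowDeriv I φ t x) (V x) ≤
      restrictNorm (flowDeriv I φ (s + t) x) (V x) := by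
  have hm := hφ.restrictConorm_flowDeriv_pos ht hV
  rw [← le_div_iff₀ hm]
  refine restrictNorm_le _ _ (div_nonneg (restrictNorm_nonneg _ _) hm.le) fun w hw ↦ ?_
  obtain ⟨v, hv, rfl⟩ := hmap.symm ▸ hw
  have h1 := le_restrictNorm (flowDeriv I φ (s + t) x) (V x) hv
  rw [hφ.norm_flowDeriv_add hs ht] at h1
  rw [div_mul_eq_mul_div, le_div_iff₀ hm]
  have h2 := mul_le_mul_of_nonneg_left (restrictConorm_mul_le (flowDeriv I φ t x) hv)
    (restrictNorm_nonneg (flowDeriv I φ (s + t) x) (V x))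
  have h3 := mul_le_mul_of_nonneg_right h1 hm.le
  refine h3.trans (le_trans (le_of_eq ?_) h2)
  ring

lemma restrictConorm_flowDeriv_add_le (hφ : IsC1FlowOf I X φ) (hs : 0 ≤ s) (ht : 0 ≤ t)
    (hV : V x ≠ ⊥) (hV' : V (φ t x) ≠ ⊥)
    (hmap : (V x).map (flowDeriv I φ t x).toLinearMap = V (φ t x)) :
    restrictConorm (flowDeriv I φ (s + t) x) (V x) ≤
      restrictConorm (flowDeriv I φ s (φ t x)) (V (φ t x)) *
        restrictNorm (flowDeriv I φ t x) (V x) := by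
  have hN := hφ.restrictNorm_flowDeriv_pos ht hV
  have hm := hφ.restrictConorm_flowDeriv_pos (add_nonneg hs ht) hV
  rw [← div_le_iff₀ hN]
  refine le_restrictConorm _ hV' fun w hw ↦ ?_
  obtain ⟨v, hv, rfl⟩ := hmap.symm ▸ hw
  have h1 := restrictConorm_mul_le (flowDeriv I φ (s + t) x) hv
  rw [hφ.norm_flowDeriv_add hs ht] at h1
  rw [div_mul_eq_mul_div, div_le_iff₀ hN]
  have h2 := mul_le_mul_of_nonneg_left (le_restrictNorm (flowDeriv I φ t x) (V x) hv) hm.le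
  have h3 := mul_le_mul_of_nonneg_right h1 hN.le
  refine h2.trans (le_trans (le_of_eq ?_) h3)
  ring

variable [IsManifold I 1 M]
  [IsContinuousRiemannianBundle (EuclideanSpace ℝ (Fin n)) (fun x : M ↦ TangentSpace I x)]

lemma exists_abs_log_le (hΛ : IsCompact Λ) {f : M → ℝ} (hf : ContinuousOn f Λ)
    (hpos : ∀ x ∈ Λ, 0 < f x) : ∃ C, ∀ x ∈ Λ, |Real.log (f x)| ≤ C :=
  hΛ.exists_bound_of_continuousOn (hf.log fun x hx ↦ (hpos x hx).ne')

theorem isGrowthCocycle_log_restrictNorm (hφ : IsC1FlowOf I X φ) (hΛ : IsCompact Λ)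
    (h : IsFlowInvariant φ Λ)
    (hV : IsContinuousSubbundle (W := fun x : M ↦ TangentSpace I x) (tangentCoord I) Λ V)
    (hmap : ∀ t, ∀ x ∈ Λ, (V x).map (flowDeriv I φ t x).toLinearMap = V (φ t x))
    (hV0 : ∀ x ∈ Λ, V x ≠ ⊥) :
    IsGrowthCocycle h.flow
      (fun t (x : Λ) ↦ Real.log (restrictNorm (flowDeriv I φ t x) (V x))) where
  continuousOn := by
    refine ContinuousOn.log ?_ fun p hp ↦
      (hφ.restrictNorm_flowDeriv_pos hp.1 (hV0 p.2 p.2.2)).ne'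
    have h1 := continuousOn_restrictNorm_flowDeriv hφ hV
    exact h1.comp (f := fun p : ℝ × Λ ↦ (p.1, (p.2 : M)))
      (Continuous.continuousOn (by fun_prop)) fun p hp ↦ ⟨hp.1, p.2.2⟩
  add_le s t hs ht x := by
    have p1 := hφ.restrictNorm_flowDeriv_pos (V := V) hs (hV0 _ (h.mem t x.2))
    have p2 := hφ.restrictNorm_flowDeriv_pos (V := V) ht (hV0 _ x.2)
    refine le_of_le_of_eq ?_ (Real.log_mul p1.ne' p2.ne')
    exact Real.log_le_log (hφ.restrictNorm_flowDeriv_pos (add_nonneg hs ht) (hV0 _ x.2))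
      (hφ.restrictNorm_flowDeriv_add_le hs ht (hmap t x x.2))
  zero x := by rw [hφ.restrictNorm_flowDeriv_zero (hV0 _ x.2), Real.log_one]
  shift_le := by
    have h1 := continuousOn_restrictConorm_flowDeriv hφ hV
    have h2 : ContinuousOn (fun x ↦ restrictConorm (flowDeriv I φ 1 x) (V x)) Λ :=
      h1.comp (f := fun x ↦ ((1 : ℝ), x)) (Continuous.continuousOn (by fun_prop))
        fun x hx ↦ ⟨zero_le_one' ℝ, hx⟩
    obtain ⟨C, hC⟩ := exists_abs_log_le hΛ h2
      fun x hx ↦ hφ.restrictConorm_flowDeriv_pos zero_le_one (hV0 x hx)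
    refine ⟨C, fun t x ht ↦ ?_⟩
    have p1 := hφ.restrictNorm_flowDeriv_pos (V := V) ht (hV0 _ (h.mem 1 x.2))
    have p2 := hφ.restrictConorm_flowDeriv_pos (V := V) zero_le_one (hV0 _ x.2)
    have h3 := Real.log_le_log (mul_pos p1 p2)
      (hφ.restrictNorm_mul_restrictConorm_le ht zero_le_one (hV0 _ x.2) (hmap 1 x x.2))
    rw [Real.log_mul p1.ne' p2.ne'] at h3
    have h4 := (abs_le.1 (hC x x.2)).1
    exact (by linarith : Real.log (restrictNorm (flowDeriv I φ t (φ 1 x)) (V (φ 1 x))) ≤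
      Real.log (restrictNorm (flowDeriv I φ (t + 1) x) (V x)) + C)

theorem isGrowthCocycle_neg_log_restrictConorm (hφ : IsC1FlowOf I X φ) (hΛ : IsCompact Λ)
    (h : IsFlowInvariant φ Λ)
    (hV : IsContinuousSubbundle (W := fun x : M ↦ TangentSpace I x) (tangentCoord I) Λ V)
    (hmap : ∀ t, ∀ x ∈ Λ, (V x).map (flowDeriv I φ t x).toLinearMap = V (φ t x))
    (hV0 : ∀ x ∈ Λ, V x ≠ ⊥) :
    IsGrowthCocycle h.flow
      (fun t (x : Λ) ↦ -Real.log (restrictConorm (flowDeriv I φ t x) (V x))) where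
  continuousOn := by
    refine (ContinuousOn.log ?_ fun p hp ↦
      (hφ.restrictConorm_flowDeriv_pos hp.1 (hV0 p.2 p.2.2)).ne').neg
    have h1 := continuousOn_restrictConorm_flowDeriv hφ hV
    exact h1.comp (f := fun p : ℝ × Λ ↦ (p.1, (p.2 : M)))
      (Continuous.continuousOn (by fun_prop)) fun p hp ↦ ⟨hp.1, p.2.2⟩
  add_le s t hs ht x := by
    have p1 := hφ.restrictConorm_flowDeriv_pos (V := V) hs (hV0 _ (h.mem t x.2))
    have p2 := hφ.restrictConorm_flowDeriv_pos (V := V) ht (hV0 _ x.2)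
    have h3 := Real.log_le_log (mul_pos p1 p2)
      (hφ.mul_le_restrictConorm_flowDeriv_add hs ht (hV0 _ x.2) (hV0 _ (h.mem t x.2)) (hmap t x x.2))
    rw [Real.log_mul p1.ne' p2.ne'] at h3
    exact (by linarith : -Real.log (restrictConorm (flowDeriv I φ (s + t) x) (V x)) ≤
      -Real.log (restrictConorm (flowDeriv I φ s (φ t x)) (V (φ t x))) +
        -Real.log (restrictConorm (flowDeriv I φ t x) (V x)))
  zero x := by rw [hφ.restrictConorm_flowDeriv_zero (hV0 _ x.2), Real.log_one, neg_zero]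
  shift_le := by
    have h1 := continuousOn_restrictNorm_flowDeriv hφ hV
    have h2 : ContinuousOn (fun x ↦ restrictNorm (flowDeriv I φ 1 x) (V x)) Λ :=
      h1.comp (f := fun x ↦ ((1 : ℝ), x)) (Continuous.continuousOn (by fun_prop))
        fun x hx ↦ ⟨zero_le_one' ℝ, hx⟩
    obtain ⟨C, hC⟩ := exists_abs_log_le hΛ h2
      fun x hx ↦ hφ.restrictNorm_flowDeriv_pos zero_le_one (hV0 x hx)
    refine ⟨C, fun t x ht ↦ ?_⟩
    have p1 := hφ.restrictConorm_flowDeriv_pos (V := V) ht (hV0 _ (h.mem 1 x.2))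
    have p2 := hφ.restrictNorm_flowDeriv_pos (V := V) zero_le_one (hV0 _ x.2)
    have h3 := Real.log_le_log
      (hφ.restrictConorm_flowDeriv_pos (add_nonneg ht zero_le_one) (hV0 _ x.2))
      (hφ.restrictConorm_flowDeriv_add_le ht zero_le_one (hV0 _ x.2) (hV0 _ (h.mem 1 x.2))
        (hmap 1 x x.2))
    rw [Real.log_mul p1.ne' p2.ne'] at h3
    have h4 := (abs_le.1 (hC x x.2)).2
    exact (by linarith : -Real.log (restrictConorm (flowDeriv I φ t (φ 1 x)) (V (φ 1 x))) ≤
      -Real.log (restrictConorm (flowDeriv I φ (t + 1) x) (V x)) + C)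

end IsC1FlowOf

end Growth

/-! ### The induced splitting of the exterior powers -/

section ExteriorSplitting

open Module exteriorPower

lemma continuous_ιMulti {V : Type*} [NormedAddCommGroup V] [InnerProductSpace ℝ V]
    [FiniteDimensional ℝ V] (k : ℕ) : Continuous fun v : Fin k → V ↦ ιMulti ℝ k v :=
  ((ιMulti ℝ k (M := V)).mkContinuous (k.factorial : ℝ) fun v ↦ norm_ιMulti_le v).cont

variable {n : ℕ} {H : Type*} [TopologicalSpace H]
  {I : ModelWithCorners ℝ (EuclideanSpace ℝ (Fin n)) H}
  {M : Type*} [TopologicalSpace M] [ChartedSpace H M] [IsManifold I 1 M]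
  [RiemannianBundle (fun x : M ↦ TangentSpace I x)]
  {φ : ℝ → M → M} {Λ : Set M} {E F : ∀ x : M, Submodule ℝ (TangentSpace I x)} {k : ℕ}

-- Products of frame vectors over a fixed family of index sets form a continuous frame. The frame is
-- built before the pointwise bases are chosen, so it does not depend on them.
omit [RiemannianBundle (fun x : M ↦ TangentSpace I x)] in
lemma exists_exterior_frame {x₀ : M} {S : Set M} {d : ℕ} {s : Fin d → ∀ x : M, TangentSpace I x}
    {r : Fin k → ∀ x : M, TangentSpace I x}
    (hs : ∀ i, ContinuousOn (fun x ↦ tangentCoord I x₀ x (s i x)) S)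
    (hr : ∀ i, ContinuousOn (fun x ↦ tangentCoord I x₀ x (r i x)) S)
    (J : Set (powersetCard (Fin d ⊕ₗ Fin k) k)) :
    ∃ (d' : ℕ) (u : Fin d' → ∀ x, ⋀[ℝ]^k (TangentSpace I x)),
      (∀ i, ContinuousOn (fun x ↦ extTangentCoord I k x₀ x (u i x)) S) ∧
      ∀ x ∈ S, ∀ b : Basis (Fin d ⊕ₗ Fin k) ℝ (TangentSpace I x),
        (∀ i, b (Sum.inlₗ i) = s i x) → (∀ i, b (Sum.inrₗ i) = r i x) →
        LinearIndependent ℝ (fun i ↦ u i x) ∧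
        Submodule.span ℝ (range fun i ↦ u i x) = Submodule.span ℝ (b.exteriorPower k '' J) := by
  classical
  let w : Fin d ⊕ₗ Fin k → ∀ x : M, TangentSpace I x := fun i ↦ Sum.elim s r (ofLex i)
  have hw : ∀ i, ContinuousOn (fun x ↦ tangentCoord I x₀ x (w i x)) S := by
    intro i
    obtain ⟨i, rfl⟩ := toLex.surjective i
    rcases i with i | i
    · exact hs i
    · exact hr i
  let e : Fin (Fintype.card J) ≃ J := (Fintype.equivFin J).symm
  refine ⟨Fintype.card J, fun i x ↦ ιMulti ℝ k fun j ↦ w (powersetCard.ofFinEmbEquiv.symm (e i) j) x,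
    fun i ↦ ?_, fun x hx b hbs hbr ↦ ?_⟩
  · have h1 : ContinuousOn (fun x ↦ ιMulti ℝ k fun j ↦
        tangentCoord I x₀ x (w (powersetCard.ofFinEmbEquiv.symm (e i) j) x)) S :=
      (continuous_ιMulti k).comp_continuousOn (continuousOn_pi.2 fun j ↦ hw _)
    refine h1.congr fun x _ ↦ ?_
    exact map_apply_ιMulti _ _
  · have hbw : ∀ i, b i = w i x := by
      intro i
      obtain ⟨i, rfl⟩ := toLex.surjective i
      rcases i with i | i
      · exact hbs i
      · exact hbr i
    have hu : (fun i ↦ ιMulti ℝ k fun j ↦ w (powersetCard.ofFinEmbEquiv.symm (e i) j) x) =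
        b.exteriorPower k ∘ (fun i ↦ (e i : powersetCard (Fin d ⊕ₗ Fin k) k)) := by
      ext1 i
      rw [Function.comp_apply, basis_apply, ιMulti_family]
      congr 1
      ext1 j
      exact (hbw _).symm
    rw [hu]
    refine ⟨(b.exteriorPower k).linearIndependent.comp _
      (Subtype.val_injective.comp e.injective), ?_⟩
    rw [range_comp]
    congr 2
    ext S
    exact ⟨by rintro ⟨i, rfl⟩; exact (e i).2, fun hS ↦ ⟨e.symm ⟨S, hS⟩, by simp⟩⟩

lemma isAdaptedBasis_of_frames {V : Type*} [AddCommGroup V] [Module ℝ V] {E F : Submodule ℝ V}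
    {d : ℕ} {s : Fin d → V} {r : Fin k → V} (hsE : Submodule.span ℝ (range s) = E)
    (hrF : Submodule.span ℝ (range r) = F) {b : Basis (Fin d ⊕ₗ Fin k) ℝ V}
    (hbs : ∀ i, b (Sum.inlₗ i) = s i) (hbr : ∀ i, b (Sum.inrₗ i) = r i) :
    IsAdaptedBasis b (fun i ↦ ∃ j, i = Sum.inlₗ j) E F := by
  refine ⟨?_, fun i hi ↦ ?_⟩
  · rintro _ ⟨j, rfl⟩
    rw [hbs, ← hsE]
    exact Submodule.subset_span ⟨j, rfl⟩
  · obtain ⟨j, rfl⟩ := exists_eq_inrₗ hi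
    rw [hbr, ← hrF]
    exact Submodule.subset_span ⟨j, rfl⟩

variable (hEF : ∀ x ∈ Λ, IsCompl (E x) (F x))
  (hE : IsContinuousSubbundle (W := fun x : M ↦ TangentSpace I x) (tangentCoord I) Λ E)
  (hF : IsContinuousSubbundle (W := fun x : M ↦ TangentSpace I x) (tangentCoord I) Λ F)
  (hk : ∀ x ∈ Λ, finrank ℝ (F x) = k)

include hEF hE hF hk

/-- Frames of `E` and `F` near a point, in local coordinates. -/
lemma exists_splitting_frame {x₀ : M} (hx₀ : x₀ ∈ Λ) :
    ∃ U : Set M, IsOpen U ∧ x₀ ∈ U ∧ ∃ (d : ℕ) (s : Fin d → ∀ x : M, TangentSpace I x)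
      (r : Fin k → ∀ x : M, TangentSpace I x),
      (∀ i, ContinuousOn (fun x ↦ tangentCoord I x₀ x (s i x)) (U ∩ Λ)) ∧
      (∀ i, ContinuousOn (fun x ↦ tangentCoord I x₀ x (r i x)) (U ∩ Λ)) ∧
      ∀ x ∈ U ∩ Λ, Submodule.span ℝ (range fun i ↦ s i x) = E x ∧
        Submodule.span ℝ (range fun i ↦ r i x) = F x ∧
        ∃ b : Basis (Fin d ⊕ₗ Fin k) ℝ (TangentSpace I x),
          (∀ i, b (Sum.inlₗ i) = s i x) ∧ ∀ i, b (Sum.inrₗ i) = r i x := by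
  obtain ⟨U₁, hU₁, hxU₁, d, s, hs, hsE⟩ := hE x₀ hx₀
  obtain ⟨U₂, hU₂, hxU₂, l, r, hr, hrF⟩ := hF x₀ hx₀
  obtain rfl : l = k := by
    have h1 := hrF x₀ ⟨hxU₂, hx₀⟩
    have h2 := hk x₀ hx₀
    rw [← h1.2, finrank_span_eq_card h1.1, Fintype.card_fin] at h2
    exact h2
  refine ⟨U₁ ∩ U₂, hU₁.inter hU₂, ⟨hxU₁, hxU₂⟩, d, s, r,
    fun i ↦ (hs i).mono fun x hx ↦ ⟨hx.1.1, hx.2⟩,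
    fun i ↦ (hr i).mono fun x hx ↦ ⟨hx.1.2, hx.2⟩, fun x hx ↦ ?_⟩
  have h1 := hsE x ⟨hx.1.1, hx.2⟩
  have h2 := hrF x ⟨hx.1.2, hx.2⟩
  exact ⟨h1.2, h2.2, exists_isAdaptedBasis (hEF x hx.2) h1.1 h1.2 h2.1 h2.2⟩

lemma isContinuousSubbundle_extE :
    IsContinuousSubbundle (W := fun x : M ↦ ⋀[ℝ]^k (TangentSpace I x)) (extTangentCoord I k) Λ
      fun x ↦ extE k (E x) (F x) := by
  intro x₀ hx₀
  obtain ⟨U, hU, hxU, d, s, r, hs, hr, hb⟩ := exists_splitting_frame hEF hE hF hk hx₀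
  obtain ⟨d', u, hu, hub⟩ := exists_exterior_frame hs hr
    {S | ∀ i ∈ S, ¬ ∃ j, i = Sum.inlₗ j}ᶜ
  refine ⟨U, hU, hxU, d', u, hu, fun x hx ↦ ?_⟩
  obtain ⟨hsE, hrF, b, hbs, hbr⟩ := hb x hx
  have h := isAdaptedBasis_of_frames hsE hrF hbs hbr
  have h' := hub x hx b hbs hbr
  rw [← h.extE_eq (hEF x hx.2).disjoint] at h'
  exact h'

lemma isContinuousSubbundle_extF :
    IsContinuousSubbundle (W := fun x : M ↦ ⋀[ℝ]^k (TangentSpace I x)) (extTangentCoord I k) Λ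
      fun x ↦ extF k (F x) := by
  intro x₀ hx₀
  obtain ⟨U, hU, hxU, d, s, r, hs, hr, hb⟩ := exists_splitting_frame hEF hE hF hk hx₀
  obtain ⟨d', u, hu, hub⟩ := exists_exterior_frame hs hr
    {S | ∀ i ∈ S, ¬ ∃ j, i = Sum.inlₗ j}
  refine ⟨U, hU, hxU, d', u, hu, fun x hx ↦ ?_⟩
  obtain ⟨hsE, hrF, b, hbs, hbr⟩ := hb x hx
  have h := isAdaptedBasis_of_frames hsE hrF hbs hbr
  have h' := hub x hx b hbs hbr
  rw [← h.extF_eq (hEF x hx.2).disjoint] at h'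
  exact h'

lemma isContinuousInvariantSplitting_ext
    (hmapE : ∀ t, ∀ x ∈ Λ, (E x).map (flowDeriv I φ t x).toLinearMap = E (φ t x))
    (hmapF : ∀ t, ∀ x ∈ Λ, (F x).map (flowDeriv I φ t x).toLinearMap = F (φ t x)) :
    IsContinuousInvariantSplitting (W := fun x : M ↦ ⋀[ℝ]^k (TangentSpace I x))
      (extTangentCoord I k) φ (extFlowDeriv I k φ) Λ
      (fun x ↦ extE k (E x) (F x)) (fun x ↦ extF k (F x)) where
  isCompl x hx := by
    obtain ⟨U, hU, hxU, d, s, r, hs, hr, hb⟩ := exists_splitting_frame hEF hE hF hk hx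
    obtain ⟨hsE, hrF, b, hbs, hbr⟩ := hb x ⟨hxU, hx⟩
    exact (isAdaptedBasis_of_frames hsE hrF hbs hbr).isCompl_ext (hEF x hx).disjoint k
  continuous_fst := isContinuousSubbundle_extE hEF hE hF hk
  continuous_snd := isContinuousSubbundle_extF hEF hE hF hk
  map_fst t x hx := by
    have := map_extE (flowDeriv I φ t x).toLinearMap k (E x) (F x)
    rw [hmapE t x hx, hmapF t x hx] at this
    exact this
  map_snd t x hx := by
    have := map_extF (flowDeriv I φ t x).toLinearMap k (F x)
    rw [hmapF t x hx] at this
    exact this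

end ExteriorSplitting

/-! ### Invariant measures of the restricted flow -/

section InvariantMeasures

variable {n : ℕ} {H : Type*} [TopologicalSpace H]
  {I : ModelWithCorners ℝ (EuclideanSpace ℝ (Fin n)) H}
  {M : Type*} [TopologicalSpace M] [ChartedSpace H M] [T2Space M]
  [MeasurableSpace M] [BorelSpace M]
  {X : ∀ x : M, TangentSpace I x} {φ : ℝ → M → M} {Λ : Set M}

/-- An invariant measure of the flow restricted to `Λ` gives an invariant measure carried
by `Λ`. -/
lemma IsC1FlowOf.isInvariantProbabilityOn_map (hφ : IsC1FlowOf I X φ) (hΛ : IsCompact Λ)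
    (h : IsFlowInvariant φ Λ) (ν : Measure Λ) [IsProbabilityMeasure ν]
    (hν : ∀ t, 0 ≤ t → ν.map (h.flow t) = ν) :
    IsInvariantProbabilityOn φ Λ (ν.map Subtype.val) where
  isProbabilityMeasure := Measure.isProbabilityMeasure_map measurable_subtype_coe.aemeasurable
  compl_eq_zero := by
    rw [Measure.map_apply measurable_subtype_coe hΛ.isClosed.measurableSet.compl]
    simp
  invariant t A hA := by
    have hmeas : ∀ t, Measurable (h.flow t) := fun t ↦ (hφ.continuous_flow h t).measurable
    have hν' : ν.map (h.flow t) = ν := by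
      rcases le_or_gt 0 t with ht | ht
      · exact hν t ht
      -- Invariance under negative times follows from invariance under the inverse, forward map.
      · have hid : h.flow t ∘ h.flow (-t) = id := funext fun x ↦ by
          simpa using hφ.flow_neg h (t := -t) (by linarith) x
        conv_lhs => rw [← hν (-t) (by linarith), Measure.map_map (hmeas t) (hmeas _), hid,
          Measure.map_id]
    have hA' : MeasurableSet ((Subtype.val : Λ → M) ⁻¹' A) := measurable_subtype_coe hA
    have hB : MeasurableSet (h.flow t ⁻¹' ((Subtype.val : Λ → M) ⁻¹' A)) := hmeas t hA'
    have hC : Λ ∩ φ t ⁻¹' A = Subtype.val '' (h.flow t ⁻¹' ((Subtype.val : Λ → M) ⁻¹' A)) := by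
      ext x
      constructor
      · rintro ⟨hx, hxA⟩
        exact ⟨⟨x, hx⟩, hxA, rfl⟩
      · rintro ⟨y, hy, rfl⟩
        exact ⟨y.2, hy⟩
    have hC' : MeasurableSet (Λ ∩ φ t ⁻¹' A) :=
      hC ▸ hΛ.isClosed.measurableSet.subtype_image hB
    have h1 : ν (h.flow t ⁻¹' ((Subtype.val : Λ → M) ⁻¹' A)) = ν (Subtype.val ⁻¹' A) := by
      rw [← Measure.map_apply (hmeas t) hA', hν']
    rw [Measure.map_apply measurable_subtype_coe hC', Measure.map_apply measurable_subtype_coe hA,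
      hC, preimage_image_eq _ Subtype.val_injective, h1]

lemma HasTotalProbability.ae_subtype {Y : Set M} (hY : HasTotalProbability φ Λ Y)
    (hφ : IsC1FlowOf I X φ) (hΛ : IsCompact Λ) (h : IsFlowInvariant φ Λ) (ν : Measure Λ)
    [IsProbabilityMeasure ν] (hν : ∀ t, 0 ≤ t → ν.map (h.flow t) = ν) :
    ∀ᵐ x : Λ ∂ν, (x : M) ∈ Y := by
  have h1 : ∀ᵐ x ∂(ν.map Subtype.val), x ∈ Y :=
    hY _ (hφ.isInvariantProbabilityOn_map hΛ h ν hν)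
  exact ae_of_ae_map measurable_subtype_coe.aemeasurable h1

end InvariantMeasures

/-! ### Domination of the induced splitting -/

section Domination

open Module

variable {n : ℕ} {H : Type*} [TopologicalSpace H]
  {I : ModelWithCorners ℝ (EuclideanSpace ℝ (Fin n)) H}
  {M : Type*} [TopologicalSpace M] [ChartedSpace H M]
  [RiemannianBundle (fun x : M ↦ TangentSpace I x)]
  {X : ∀ x : M, TangentSpace I x} {φ : ℝ → M → M} {Λ : Set M}
  {E F : ∀ x : M, Submodule ℝ (TangentSpace I x)} {k : ℕ}

/-- The composition `DX_{-t} ∘ DX_t`, as a linear isometry. -/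
noncomputable def IsC1FlowOf.flowDerivNegComp (hφ : IsC1FlowOf I X φ) {t : ℝ} (ht : 0 < t) (x : M) :
    TangentSpace I x →ₗᵢ[ℝ] TangentSpace I (φ (-t) (φ t x)) where
  toLinearMap := (flowDeriv I φ (-t) (φ t x)).toLinearMap ∘ₗ (flowDeriv I φ t x).toLinearMap
  norm_map' v := hφ.norm_flowDeriv_neg ht x v

/-- The quantity whose exponential decay is the domination of the induced splitting. -/
noncomputable def extGrowth (k : ℕ) (φ : ℝ → M → M) (E F : ∀ x : M, Submodule ℝ (TangentSpace I x)) (t : ℝ)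
    (x : M) : ℝ :=
  restrictNorm (extFlowDeriv I k φ t x) (extE k (E x) (F x)) *
    restrictNorm (extFlowDeriv I k φ (-t) (φ t x)) (extF k (F (φ t x)))

lemma IsC1FlowOf.extGrowth_le (hφ : IsC1FlowOf I X φ) {t : ℝ} (ht : 0 < t) {x : M}
    (hEF : IsCompl (E x) (F x)) (hFk : finrank ℝ (F x) = k) (hF0 : F x ≠ ⊥)
    (hmap : (F x).map (flowDeriv I φ t x).toLinearMap = F (φ t x)) {c : ℝ}
    (hc : IsSplittingBound (E x) (F x) c) (hc0 : 0 ≤ c) {κ C : ℝ} (hκ : 0 ≤ κ) (hκC : κ ≤ C)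
    (hC : 1 ≤ C)
    (h : restrictNorm (flowDeriv I φ t x) (E x) ≤ κ * restrictConorm (flowDeriv I φ t x) (F x)) :
    extGrowth k φ E F t x ≤
      n.choose k * (k.factorial * c ^ k * (k.factorial * C ^ k)) * κ := by
  have key := restrictNorm_extMap_mul_le (k := k) (A := flowDeriv I φ t x)
    (B := flowDeriv I φ (-t) (φ t x)) (J := hφ.flowDerivNegComp ht x) (fun _ ↦ rfl) hEF hFk hc hc0
    (hφ.restrictConorm_flowDeriv_pos ht.le hF0) hκ hκC hC
    (fun v hv ↦ (le_restrictNorm _ _ hv).trans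
      (mul_le_mul_of_nonneg_right h (norm_nonneg v)))
    (fun v hv ↦ restrictConorm_mul_le _ hv)
  rw [hmap, show finrank ℝ (TangentSpace I x) = n from finrank_euclideanSpace_fin] at key
  exact key

lemma IsC1FlowOf.restrictNorm_le_mul_restrictConorm (hφ : IsC1FlowOf I X φ) {t : ℝ} (ht : 0 < t)
    {x : M} (hk : 1 ≤ k) (hFk : finrank ℝ (F x) = k) (hF0 : F x ≠ ⊥)
    (hmapE : (E x).map (flowDeriv I φ t x).toLinearMap = E (φ t x))
    (hmapF : (F x).map (flowDeriv I φ t x).toLinearMap = F (φ t x)) {c : ℝ}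
    (hc : IsSplittingBound (E (φ t x)) (F (φ t x)) c) (hc0 : 0 < c) :
    restrictNorm (flowDeriv I φ t x) (E x) ≤
      c * k.factorial * extGrowth k φ E F t x * restrictConorm (flowDeriv I φ t x) (F x) := by
  rw [← hmapE, ← hmapF] at hc
  have key : ∀ v ∈ E x, ∀ w ∈ F x, ‖flowDeriv I φ t x v‖ * ‖w‖ ≤
      c * k.factorial * extGrowth k φ E F t x * (‖flowDeriv I φ t x w‖ * ‖v‖) := by
    intro v hv w hw
    have := norm_mul_norm_le_of_extMap (k := k) (A := flowDeriv I φ t x)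
      (B := flowDeriv I φ (-t) (φ t x)) (J := hφ.flowDerivNegComp ht x) (fun _ ↦ rfl) hk hFk hc
      hv hw
    rw [hmapF] at this
    exact this
  have hQ : 0 ≤ c * k.factorial * extGrowth k φ E F t x :=
    mul_nonneg (by positivity) (mul_nonneg (restrictNorm_nonneg _ _) (restrictNorm_nonneg _ _))
  generalize c * k.factorial * extGrowth k φ E F t x = Q at key hQ
  obtain ⟨w, hw, hw0⟩ := (F x).exists_mem_ne_zero_of_ne_bot hF0
  have hm := hφ.restrictConorm_flowDeriv_pos (V := F) ht.le hF0
  refine restrictNorm_le _ _ (mul_nonneg hQ hm.le) fun v hv ↦ ?_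
  rcases eq_or_ne v 0 with rfl | hv0
  · simp
  have hvn := norm_pos_iff.2 hv0
  have hAv : 0 < ‖flowDeriv I φ t x v‖ := norm_pos_iff.2 fun h ↦
    hv0 (hφ.flowDeriv_injective ht.le x (h.trans (ContinuousLinearMap.map_zero _).symm))
  -- Were `Q` zero, `key` would force `A v` or `w` to vanish; positivity is needed to divide by `Q`.
  have hQ' : 0 < Q := by
    refine hQ.lt_of_ne fun h ↦ ?_
    have := key v hv w hw
    rw [← h, zero_mul] at this
    exact absurd this (not_le.2 (mul_pos hAv (norm_pos_iff.2 hw0)))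
  have : ‖flowDeriv I φ t x v‖ / (Q * ‖v‖) ≤ restrictConorm (flowDeriv I φ t x) (F x) := by
    refine le_restrictConorm _ hF0 fun w hw ↦ ?_
    rw [div_mul_eq_mul_div, div_le_iff₀ (by positivity)]
    linarith [key v hv w hw]
  rw [div_le_iff₀ (by positivity)] at this
  linarith

/-- The comparison `norm_mul_norm_le_of_extMap` for the identity map bounds ‖v‖‖w‖ by a multiple of
the product of the two restricted norms, which would vanish if either subspace were trivial. -/
lemma extE_ne_bot_and_extF_ne_bot {x : M} (hk : 1 ≤ k) (hE0 : E x ≠ ⊥) (hF0 : F x ≠ ⊥)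
    (hFk : finrank ℝ (F x) = k) {c : ℝ} (hc : IsSplittingBound (E x) (F x) c) :
    extE k (E x) (F x) ≠ ⊥ ∧ extF k (F x) ≠ ⊥ := by
  obtain ⟨v, hv, hv0⟩ := (E x).exists_mem_ne_zero_of_ne_bot hE0
  obtain ⟨w, hw, hw0⟩ := (F x).exists_mem_ne_zero_of_ne_bot hF0
  have hmap : ∀ S : Submodule ℝ (TangentSpace I x),
      S.map (ContinuousLinearMap.id ℝ (TangentSpace I x)).toLinearMap = S := Submodule.map_id
  have key := norm_mul_norm_le_of_extMap (k := k) (A := .id ℝ (TangentSpace I x))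
    (B := .id ℝ (TangentSpace I x)) (J := .id) (fun _ ↦ rfl) hk hFk
    (by rwa [hmap, hmap]) hv hw
  rw [hmap] at key
  have hpos : 0 < ‖v‖ * ‖w‖ := mul_pos (norm_pos_iff.2 hv0) (norm_pos_iff.2 hw0)
  have hbot : ∀ L : ⋀[ℝ]^k (TangentSpace I x) →L[ℝ] ⋀[ℝ]^k (TangentSpace I x),
      restrictNorm L ⊥ = 0 := fun L ↦
    le_antisymm (restrictNorm_le _ _ le_rfl fun v hv ↦ by
      rw [(Submodule.mem_bot ℝ).1 hv, map_zero, norm_zero, mul_zero]) (restrictNorm_nonneg _ _)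
  constructor <;> intro h <;> rw [h, hbot] at key <;> simp only [zero_mul, mul_zero] at key <;>
    exact absurd key (not_le.2 hpos)

end Domination

/-! ### Domination and mean growth rates -/

section MeanGrowth

lemma isBoundedUnder_le_of_neg {f : ℝ → ℝ}
    (hf : IsBoundedUnder (· ≥ ·) atTop fun t : ℝ ↦ 1 / t * -f t) :
    IsBoundedUnder (· ≤ ·) atTop fun t : ℝ ↦ 1 / t * f t := by
  obtain ⟨b, hb⟩ := hf
  refine ⟨-b, ?_⟩
  rw [eventually_map] at hb ⊢
  filter_upwards [hb] with t ht
  simp only [mul_neg, ge_iff_le] at ht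
  linarith

lemma isBoundedUnder_ge_of_neg {f : ℝ → ℝ}
    (hf : IsBoundedUnder (· ≤ ·) atTop fun t : ℝ ↦ 1 / t * -f t) :
    IsBoundedUnder (· ≥ ·) atTop fun t : ℝ ↦ 1 / t * f t := by
  obtain ⟨b, hb⟩ := hf
  refine ⟨-b, ?_⟩
  rw [eventually_map] at hb ⊢
  filter_upwards [hb] with t ht
  simp only [mul_neg] at ht
  simp only [ge_iff_le]
  linarith

lemma liminf_mean_neg {f : ℝ → ℝ}
    (hf : IsBoundedUnder (· ≤ ·) atTop fun t : ℝ ↦ 1 / t * -f t)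
    (hf' : IsBoundedUnder (· ≥ ·) atTop fun t : ℝ ↦ 1 / t * -f t) :
    liminf (fun t : ℝ ↦ 1 / t * -f t) atTop = -limsup (fun t : ℝ ↦ 1 / t * f t) atTop := by
  have := liminf_const_sub atTop (fun t : ℝ ↦ 1 / t * f t) 0 (isBoundedUnder_le_of_neg hf')
    (isBoundedUnder_ge_of_neg hf).isCoboundedUnder_le
  rw [zero_sub] at this
  rw [← this]
  simp only [mul_neg, zero_sub]

/-- For large `t` the constant `C` uses up at most a quarter of `lam * t`. The remaining rate `3 *
lam / 4` exceeds `lam / 2`, which makes the conclusion strict. -/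
lemma liminf_sub_limsup_lt {f g : ℝ → ℝ}
    (hf : IsBoundedUnder (· ≤ ·) atTop fun t : ℝ ↦ 1 / t * f t)
    (hf' : IsBoundedUnder (· ≥ ·) atTop fun t : ℝ ↦ 1 / t * f t)
    (hg : IsBoundedUnder (· ≤ ·) atTop fun t : ℝ ↦ 1 / t * g t)
    (hg' : IsBoundedUnder (· ≥ ·) atTop fun t : ℝ ↦ 1 / t * g t)
    {C lam : ℝ} (hlam : 0 < lam) (h : ∀ t, 0 < t → f t ≤ g t + (C - lam * t)) :
    liminf (fun t : ℝ ↦ 1 / t * f t) atTop - limsup (fun t : ℝ ↦ 1 / t * g t) atTop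
      < -(lam / 2) := by
  have h1 : (fun t : ℝ ↦ 1 / t * f t) ≤ᶠ[atTop] fun t ↦ 1 / t * g t - 3 * lam / 4 := by
    filter_upwards [eventually_gt_atTop 0, eventually_ge_atTop (4 * C / lam)] with t ht hCt
    rw [div_le_iff₀ hlam] at hCt
    rw [div_mul_eq_mul_div, div_mul_eq_mul_div, one_mul, one_mul, le_sub_iff_add_le,
      div_add' _ _ _ ht.ne', div_le_div_iff_of_pos_right ht]
    linarith [h t ht]
  have hg2 : IsBoundedUnder (· ≤ ·) atTop fun t : ℝ ↦ 1 / t * g t - 3 * lam / 4 := by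
    obtain ⟨b, hb⟩ := hg
    refine ⟨b - 3 * lam / 4, ?_⟩
    rw [eventually_map] at hb ⊢
    filter_upwards [hb] with t ht using sub_le_sub_right ht _
  have h2 := liminf_le_limsup hf hf'
  have h3 := limsup_le_limsup h1 hf'.isCoboundedUnder_le hg2
  rw [limsup_sub_const atTop _ _ hg hg'.isCoboundedUnder_le] at h3
  linarith

end MeanGrowth

/-! ### Equivalence of exterior domination with the inequality of growth rates. -/

section Main

open Module

lemma isContinuousRiemannianBundle_of_contMDiff {n : ℕ} {H : Type*} [TopologicalSpace H]
    (I : ModelWithCorners ℝ (EuclideanSpace ℝ (Fin n)) H)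
    {M : Type*} [TopologicalSpace M] [ChartedSpace H M] [IsManifold I ∞ M]
    [RiemannianBundle (fun x : M ↦ TangentSpace I x)]
    [h : IsContMDiffRiemannianBundle I ∞ (EuclideanSpace ℝ (Fin n))
      (fun x : M ↦ TangentSpace I x)] :
    IsContinuousRiemannianBundle (EuclideanSpace ℝ (Fin n)) (fun x : M ↦ TangentSpace I x) := by
  obtain ⟨g, hg, hg'⟩ := h.exists_contMDiff
  exact ⟨g, hg.continuous, hg'⟩

variable {n : ℕ} {H : Type*} [TopologicalSpace H]
  {I : ModelWithCorners ℝ (EuclideanSpace ℝ (Fin n)) H}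
  {M : Type*} [TopologicalSpace M] [ChartedSpace H M] [IsManifold I 1 M]
  [RiemannianBundle (fun x : M ↦ TangentSpace I x)]
  [IsContinuousRiemannianBundle (EuclideanSpace ℝ (Fin n)) (fun x : M ↦ TangentSpace I x)]
  {X : ∀ x : M, TangentSpace I x} {φ : ℝ → M → M} {Λ : Set M}
  {E F : ∀ x : M, Submodule ℝ (TangentSpace I x)} {k : ℕ}

theorem IsC1FlowOf.liminf_sub_limsup_lt_of_domination (hφ : IsC1FlowOf I X φ) (hΛ : IsCompact Λ)
    (h : IsFlowInvariant φ Λ) (hk : 1 ≤ k)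
    (hEF : IsContinuousInvariantSplitting (W := fun x : M ↦ TangentSpace I x)
      (tangentCoord I) φ (flowDeriv I φ) Λ E F)
    (hE : ∀ x ∈ Λ, E x ≠ ⊥) (hF0 : ∀ x ∈ Λ, F x ≠ ⊥) (hF : ∀ x ∈ Λ, finrank ℝ (F x) = k)
    {K lam : ℝ} (hK : 0 < K) (hlam : 0 < lam)
    (hdom : ∀ x ∈ Λ, ∀ t, 0 < t → extGrowth k φ E F t x < K * Real.exp (-lam * t))
    {x : M} (hx : x ∈ Λ) :
    liminf (fun t : ℝ ↦ 1 / t * Real.log (restrictNorm (flowDeriv I φ t x) (E x))) atTop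
      - limsup (fun t : ℝ ↦ 1 / t * Real.log (restrictConorm (flowDeriv I φ t x) (F x))) atTop
      < -(lam / 2) := by
  obtain ⟨c, hc1, hc⟩ := exists_isSplittingBound hΛ hEF.isCompl hEF.continuous_fst
    hEF.continuous_snd
  have : CompactSpace Λ := isCompact_iff_compactSpace.1 hΛ
  have hα := hφ.isGrowthCocycle_log_restrictNorm hΛ h hEF.continuous_fst hEF.map_fst hE
  have hβ := hφ.isGrowthCocycle_neg_log_restrictConorm hΛ h hEF.continuous_snd hEF.map_snd hF0
  refine liminf_sub_limsup_lt (C := Real.log (c * k.factorial * K))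
    (hα.isBoundedUnder_le ⟨x, hx⟩) (hα.isBoundedUnder_ge ⟨x, hx⟩)
    (isBoundedUnder_le_of_neg (hβ.isBoundedUnder_ge ⟨x, hx⟩))
    (isBoundedUnder_ge_of_neg (hβ.isBoundedUnder_le ⟨x, hx⟩)) hlam fun t ht ↦ ?_
  have hc0 : 0 < c := by linarith
  have hm := hφ.restrictConorm_flowDeriv_pos (V := F) ht.le (hF0 x hx)
  have hfac : (0 : ℝ) < k.factorial := by exact_mod_cast k.factorial_pos
  have h1 := hφ.restrictNorm_le_mul_restrictConorm ht hk (hF x hx) (hF0 x hx) (hEF.map_fst t x hx)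
    (hEF.map_snd t x hx) (hc _ (h.mem t hx)) hc0
  have h2 : c * k.factorial * extGrowth k φ E F t x ≤
      c * k.factorial * K * Real.exp (-lam * t) := by
    rw [mul_assoc (c * _)]
    exact mul_le_mul_of_nonneg_left (hdom x hx t ht).le (by positivity)
  have h3 := h1.trans (mul_le_mul_of_nonneg_right h2 hm.le)
  have h4 := Real.log_le_log (hφ.restrictNorm_flowDeriv_pos (V := E) ht.le (hE x hx)) h3
  rw [Real.log_mul (by positivity) hm.ne', Real.log_mul (by positivity) (by positivity),
    Real.log_exp] at h4
  linarith

theorem IsC1FlowOf.exists_extGrowth_lt [CompactSpace M] [T2Space M] [MeasurableSpace M]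
    [BorelSpace M] (hφ : IsC1FlowOf I X φ) (hΛ : IsCompact Λ) (h : IsFlowInvariant φ Λ)
    (hEF : IsContinuousInvariantSplitting (W := fun x : M ↦ TangentSpace I x)
      (tangentCoord I) φ (flowDeriv I φ) Λ E F)
    (hE : ∀ x ∈ Λ, E x ≠ ⊥) (hF0 : ∀ x ∈ Λ, F x ≠ ⊥) (hF : ∀ x ∈ Λ, finrank ℝ (F x) = k)
    {η : ℝ} (hη : η < 0) {Y : Set M} (hY : HasTotalProbability φ Λ Y)
    (hYη : ∀ x ∈ Y,
      liminf (fun t : ℝ ↦ 1 / t * Real.log (restrictNorm (flowDeriv I φ t x) (E x))) atTop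
        - limsup (fun t : ℝ ↦ 1 / t * Real.log (restrictConorm (flowDeriv I φ t x) (F x))) atTop
        < η) :
    ∃ K > (0 : ℝ), ∃ lam > (0 : ℝ), ∀ x ∈ Λ, ∀ t : ℝ, 0 < t →
      extGrowth k φ E F t x < K * Real.exp (-lam * t) := by
  obtain ⟨c, hc1, hc⟩ := exists_isSplittingBound hΛ hEF.isCompl hEF.continuous_fst
    hEF.continuous_snd
  have : CompactSpace Λ := isCompact_iff_compactSpace.1 hΛ
  have : TopologicalSpace.MetrizableSpace M := Manifold.metrizableSpace I M
  have hα := hφ.isGrowthCocycle_log_restrictNorm hΛ h hEF.continuous_fst hEF.map_fst hE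
  have hβ := hφ.isGrowthCocycle_neg_log_restrictConorm hΛ h hEF.continuous_snd hEF.map_snd hF0
  obtain ⟨D, lam, hlam, hD⟩ := IsGrowthCocycle.exists_decay (hφ.isSemiflow h) hα hβ hη
    fun ν _ hν ↦ by
      filter_upwards [hY.ae_subtype hφ hΛ h ν hν] with x hx
      have h1 := hYη x hx
      -- Minus the `limsup` of the co-norm rate is the lower rate of the second cocycle, so the
      -- hypothesis is about a sum of two lower rates.
      have h2 := liminf_mean_neg (hβ.isBoundedUnder_le x) (hβ.isBoundedUnder_ge x)
      rw [h2]
      linarith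
  set C : ℝ := n.choose k * (k.factorial * c ^ k * (k.factorial * Real.exp |D| ^ k)) with hC
  have hC0 : 0 ≤ C := by positivity
  -- The summand `1` makes the final inequality strict.
  refine ⟨C * Real.exp D + 1, by positivity, lam, hlam, fun x hx t ht ↦ ?_⟩
  have hm := hφ.restrictConorm_flowDeriv_pos (V := F) ht.le (hF0 x hx)
  have hN := hφ.restrictNorm_flowDeriv_pos (V := E) ht.le (hE x hx)
  have h1 := hφ.extGrowth_le ht (hEF.isCompl x hx) (hF x hx) (hF0 x hx) (hEF.map_snd t x hx)
    (hc x hx) (by linarith) (κ := Real.exp (D - lam * t)) (C := Real.exp |D|) (Real.exp_pos _).le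
    (Real.exp_le_exp.2 (by nlinarith [le_abs_self D])) (Real.one_le_exp (abs_nonneg D)) (by
      rw [← div_le_iff₀ hm, ← Real.log_le_iff_le_exp (div_pos hN hm), Real.log_div hN.ne' hm.ne']
      exact hD ⟨x, hx⟩ t ht.le)
  refine h1.trans_lt ?_
  rw [sub_eq_add_neg, Real.exp_add, ← mul_assoc, ← neg_mul]
  exact mul_lt_mul_of_pos_right (lt_add_one _) (Real.exp_pos _)

end Main

theorem mainTheorem3 {n : ℕ} {H : Type*} [TopologicalSpace H]
    (I : ModelWithCorners ℝ (EuclideanSpace ℝ (Fin n)) H)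
    {M : Type*} [TopologicalSpace M] [ChartedSpace H M] [IsManifold I ∞ M]
    [CompactSpace M] [T2Space M]
    [RiemannianBundle (fun x : M ↦ TangentSpace I x)]
    [IsContMDiffRiemannianBundle I ∞ (EuclideanSpace ℝ (Fin n)) (fun x : M ↦ TangentSpace I x)]
    [MeasurableSpace M] [BorelSpace M]
    (X : ∀ x : M, TangentSpace I x)
    (hX : ContMDiff I I.tangent 1 (fun x ↦ (⟨x, X x⟩ : TangentBundle I M)))
    (φ : ℝ → M → M) (hφ : IsC1FlowOf I X φ)
    (Λ : Set M) (hΛ : IsCompact Λ) (hΛinv : IsFlowInvariant φ Λ)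
    (k : ℕ) (hk : 2 ≤ k)
    (E F : ∀ x : M, Submodule ℝ (TangentSpace I x))
    (hEF : IsContinuousInvariantSplitting (tangentCoord I) φ (flowDeriv I φ) Λ E F)
    (hE : ∀ x ∈ Λ, E x ≠ ⊥)
    (hF : ∀ x ∈ Λ, Module.finrank ℝ (F x) = k) :
    IsDominatedSplitting (extTangentCoord I k) φ (extFlowDeriv I k φ) Λ
        (fun x ↦ extE k (E x) (F x)) (fun x ↦ extF k (F x)) ↔
      ∃ η : ℝ, η < 0 ∧ ∃ Y : Set M, Y ⊆ Λ ∧ HasTotalProbability φ Λ Y ∧ ∀ x ∈ Y,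
        liminf (fun t : ℝ ↦ 1 / t * Real.log (restrictNorm (flowDeriv I φ t x) (E x))) atTop
          - limsup (fun t : ℝ ↦ 1 / t * Real.log (restrictConorm (flowDeriv I φ t x) (F x))) atTop
          < η := by
  have : IsContinuousRiemannianBundle (EuclideanSpace ℝ (Fin n)) (fun x : M ↦ TangentSpace I x) :=
    isContinuousRiemannianBundle_of_contMDiff I
  have hF0 : ∀ x ∈ Λ, F x ≠ ⊥ := fun x hx h ↦ by
    have := hF x hx
    rw [h, finrank_bot] at this
    omega
  have hk1 : 1 ≤ k := by omega
  constructor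
  · intro hdom
    obtain ⟨K, hK, lam, hlam, hdom⟩ := hdom.domination
    -- The estimate holds at every point of `Λ`, and `Λ` has total probability because the measures
    -- are carried by it.
    exact ⟨-(lam / 2), by linarith, Λ, Subset.rfl,
      fun μ hμ ↦ mem_ae_iff.2 hμ.compl_eq_zero, fun x hx ↦
      hφ.liminf_sub_limsup_lt_of_domination hΛ hΛinv hk1 hEF hE hF0 hF hK hlam hdom hx⟩
  · rintro ⟨η, hη, Y, -, hY, hYη⟩
    obtain ⟨c, -, hc⟩ := exists_isSplittingBound hΛ hEF.isCompl hEF.continuous_fst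
      hEF.continuous_snd
    have hne := fun x hx ↦ extE_ne_bot_and_extF_ne_bot hk1 (hE x hx) (hF0 x hx) (hF x hx) (hc x hx)
    have hsplit := isContinuousInvariantSplitting_ext (φ := φ) hEF.isCompl hEF.continuous_fst
      hEF.continuous_snd hF hEF.map_fst hEF.map_snd
    have hdom := hφ.exists_extGrowth_lt hΛ hΛinv hEF hE hF0 hF hη hY hYη
    exact
      { toIsContinuousInvariantSplitting := hsplit
        fst_ne_bot := fun x hx ↦ (hne x hx).1
        snd_ne_bot := fun x hx ↦ (hne x hx).2
        domination := hdom }
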